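/- Let $F$ be a totally real number field of degree $d$ with ring of integers $\mathbb Z_F$ and real embeddings $\sigma_1,\dots,\sigma_d$, let $a\in\mathbb Z_F$ be totally negative, and let $K=F(\beta)$ with $\beta^2=a$, a CM field with ring of integers $\mathbb Z_K$. Put $\sigma_{k,+}(a_0+a_1\beta)=\sigma_k(a_0)+i\,\sigma_k(a_1)\sqrt{|\sigma_k(a)|}$ for $a_0,a_1\in F$, and define $\boldsymbol\sigma:\mathbb Z_K\to\mathbb R^{2d}$ by $\boldsymbol\sigma(z)=(\mathrm{Re}\,\sigma_{1,+}(z),\mathrm{Im}\,\sigma_{1,+}(z),\dots,\mathrm{Re}\,\sigma_{d,+}(z),\mathrm{Im}\,\sigma_{d,+}(z))$. For a totally positive $r\in\mathbb Z_F$ and real $\varphi,\varepsilon$ let $z_0=\sqrt{\sigma_1(r)}\,(1-\varepsilon^2)e^{-i\varphi/2}$, $$S_{r,\varphi,\varepsilon}=\{x\in\mathbb R^{2d}:\ \mathrm{Re}\big((x_1+ix_2-z_0)e^{i\varphi/2}\big)\ge 0,\ |x_{2k-1}+ix_{2k}|^2\le\sigma_k(r)\text{ for }k=1,\dots,d\},$$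 $$\mathrm{Cand}_{r,\varphi,\varepsilon}=\{z\in\mathbb Z_K:\boldsymbol\sigma(z)\in S_{r,\varphi,\varepsilon}\}.$$ Model of computation. A randomized register machine has finitely many integer registers, the operations $+,-,\cdot$, floor division, sign tests and fair coin tosses. Every instruction costs at least $1$ and at least the bit length of its operands (the product of the bit lengths, each increased by $1$, for multiplication and division). Fix $\mathbb Z$-bases of $\mathbb Z_F$ and $\mathbb Z_K$. The input $r$ is given by its integer coordinates, and the output $z\in\mathbb Z_K$ is returned by its integer coordinates. The machine may ask, at cost at least $p$, for an integer within distance $1$ of $2^p\theta$, where $\theta$ is one of $\varepsilon$, $\cos(\varphi/2)$, $\sin(\varphi/2)$, or one of the fixed numbers $\sigma_k(\omega)$, $\mathrm{Re}\,\sigma_{k,+}(\omega')$, $\mathrm{Im}\,\sigma_{k,+}(\omega')$ with $\omega,\omega'$ in the two bases. The only exact comparison of reals available, at cost the bit length of the coordinates of $z$ plus $1$, is whether $\mathrm{Re}\big((\sigma_{1,+}(z)-z_0)e^{i\varphi/2}\big)\ge 0$ for a given $z\in\mathbb Z_K$. Theorem. There is a vector $R^{\min}\in(0,\infty)^d$ such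 that for every $R^{\max}\in(0,\infty)^d$ there are real numbers $p_0>0$ and $M>0$, a program (RANDOM-INTEGER-POINT) for this machine, and a polynomial $P$ with the following property. Let $\varphi\in\mathbb R$, $\varepsilon\in(0,1/2)$ and let $r\in\mathbb Z_F$ be totally positive with $$\sqrt{\sigma_1(r)}\,\varepsilon^2/4\in[R_1^{\min},R_1^{\max}],\qquad \sqrt{\sigma_k(r)}\in[R_k^{\min},R_k^{\max}]\ \text{ for }k=2,\dots,d .$$ Then: 1. there is $z\in\mathbb Z_K$ with $\boldsymbol\sigma(z)\in S_{r,\varphi,\varepsilon}$; 2. $\mathrm{Cand}_{r,\varphi,\varepsilon}$ is finite and $$\frac{2\sqrt{4-\varepsilon^2}}{\varepsilon}\ \le\ |\mathrm{Cand}_{r,\varphi,\varepsilon}|\ \le\ \Big(\frac{4\sqrt{4-4\varepsilon^2}}{\varepsilon}+2\Big)M;$$ 3. for every choice of valid approximations, the program on input $(r,\varphi,\varepsilon)$ always halts within total cost at most $P(\log(1/\varepsilon))$, its output always lies in $\mathrm{Cand}_{r,\varphi,\varepsilon}$, and each $z\in\mathrm{Cand}_{r,\varphi,\varepsilon}$ is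 returned with probability at least $p_0/|\mathrm{Cand}_{r,\varphi,\varepsilon}|$. -/

import Mathlib

open scoped NumberField

noncomputable section

namespace RandomIntegerPoint

/-! ### The CM field, the lattice and the target region -/

section Geometry

variable {F : Type*} [Field F] {n : ℕ}

/-- `K = F(√a)`: elements are `a₀ + a₁ β` with `a₀ = re`, `a₁ = im` in `F` and `β ^ 2 = a`. -/
abbrev CMField (a : 𝓞 F) : Type _ := QuadraticAlgebra F (a : F) 0

/-- The ring of integers `ℤ_K` of `K = F(√a)`. -/
abbrev CMIntegers (a : 𝓞 F) : Subalgebra ℤ (CMField a) := integralClosure ℤ (CMField a)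

/-- The embedding `σ_{k,+}` of `K` into `ℂ` that belongs to the real embedding `s = σ_k` of `F`:
`σ_{k,+}(a₀ + a₁ β) = σ_k(a₀) + i σ_k(a₁) √|σ_k(a)|`. -/
def sigmaPlus (s : F →+* ℝ) (a : 𝓞 F) (x : CMField a) : ℂ :=
  (s x.re : ℂ) + Complex.I * ((s x.im * Real.sqrt |s a| : ℝ) : ℂ)

/-- The lattice map of `ℤ_K` into `ℝ^{2d}`, `d = n + 1`. Here and below `ℝ^{2d}` is written as
`ℂ^d`: the `k`-th complex coordinate of `x` is `x_{2k-1} + i x_{2k}`. -/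
def vecSigma (σ : Fin (n + 1) → F →+* ℝ) (a : 𝓞 F) (z : CMIntegers a) : Fin (n + 1) → ℂ :=
  fun k => sigmaPlus (σ k) a z

/-- `z₀ = √σ₁(r) (1 - ε²) e^{-iφ/2}`. -/
def zZero (σ : Fin (n + 1) → F →+* ℝ) (r : 𝓞 F) (φ ε : ℝ) : ℂ :=
  ((Real.sqrt (σ 0 r) * (1 - ε ^ 2) : ℝ) : ℂ) * Complex.exp (-(Complex.I * φ / 2))

/-- The closed half-plane `Re ((w - z₀) e^{iφ/2}) ≥ 0`. -/
def halfPlane (σ : Fin (n + 1) → F →+* ℝ) (r : 𝓞 F) (φ ε : ℝ) : Set ℂ :=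
  {w | 0 ≤ ((w - zZero σ r φ ε) * Complex.exp (Complex.I * φ / 2)).re}

/-- The convex set `S_{r,φ,ε}`. -/
def region (σ : Fin (n + 1) → F →+* ℝ) (r : 𝓞 F) (φ ε : ℝ) : Set (Fin (n + 1) → ℂ) :=
  {x | x 0 ∈ halfPlane σ r φ ε ∧ ∀ k, ‖x k‖ ^ 2 ≤ σ k r}

/-- `Cand_{r,φ,ε}`, the integers of `K` whose image lies in `S_{r,φ,ε}`. -/
def Cand (σ : Fin (n + 1) → F →+* ℝ) (a r : 𝓞 F) (φ ε : ℝ) : Set (CMIntegers a) :=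
  {z | vecSigma σ a z ∈ region σ r φ ε}

/-- The integer of `K` with the given coordinates in a `ℤ`-basis of `ℤ_K`. -/
def ofCoords {a : 𝓞 F} (bK : Module.Basis (Fin (2 * (n + 1))) ℤ (CMIntegers a))
    (w : Fin (2 * (n + 1)) → ℤ) : CMIntegers a :=
  ∑ j, w j • bK j

end Geometry

/-! ### The machine model

A randomized register machine with logarithmic (bit) cost. A program uses finitely many integer
registers; each instruction is charged at least one step and at least the bit length of the
integers it handles (the product of the bit lengths for multiplication and division). Real numbers
never enter a register: a program can only ask for a dyadic approximation of one of finitely many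
real numbers, and `p` bits of precision cost at least `p` steps. The real numbers on offer are the
input data `ε` and `e^{iφ/2}` and, as data of the offline part, the coordinates of the fixed
integral bases under the embeddings. Membership of the closed half-plane that depends on the
arbitrary real inputs is not decidable from finitely many digits of them, so this one comparison
of reals is an instruction; everything else has to be computed. -/

/-- The real numbers that a program may ask for. -/
inductive RealName (n : ℕ) : Type
  /-- the precision `ε` -/
  | eps
  /-- `cos (φ / 2)` -/
  | cosHalf
  /-- `sin (φ / 2)` -/
  | sinHalf
  /-- `σ_k` of the `j`-th element of the basis of `ℤ_F` -/
  | embF (k j : Fin (n + 1))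
  /-- the real part of `σ_{k,+}` of the `j`-th element of the basis of `ℤ_K` -/
  | embRe (k : Fin (n + 1)) (j : Fin (2 * (n + 1)))
  /-- the imaginary part of `σ_{k,+}` of the `j`-th element of the basis of `ℤ_K` -/
  | embIm (k : Fin (n + 1)) (j : Fin (2 * (n + 1)))

/-- The value of each real number on offer. -/
def RealName.value {F : Type*} [Field F] {n : ℕ} (σ : Fin (n + 1) → F →+* ℝ) {a : 𝓞 F}
    (bF : Module.Basis (Fin (n + 1)) ℤ (𝓞 F))
    (bK : Module.Basis (Fin (2 * (n + 1))) ℤ (CMIntegers a)) (φ ε : ℝ) : RealName n → ℝ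
  | .eps => ε
  | .cosHalf => Real.cos (φ / 2)
  | .sinHalf => Real.sin (φ / 2)
  | .embF k j => σ k (bF j)
  | .embRe k j => (sigmaPlus (σ k) a (bK j)).re
  | .embIm k j => (sigmaPlus (σ k) a (bK j)).im

/-- Programs; `x y z` are register numbers. -/
inductive Prog (n : ℕ) : Type
  | skip
  /-- `x := c` -/
  | const (x : ℕ) (c : ℤ)
  /-- `x := y + z` -/
  | add (x y z : ℕ)
  /-- `x := y - z` -/
  | sub (x y z : ℕ)
  /-- `x := y * z` -/
  | mul (x y z : ℕ)
  /-- `x := ⌊y / z⌋` (and `0` if `z = 0`) -/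
  | div (x y z : ℕ)
  /-- `x :=` a fair random bit -/
  | toss (x : ℕ)
  /-- `x :=` an integer within distance `1` of `2 ^ y * q` -/
  | approx (x : ℕ) (q : RealName n) (y : ℕ)
  /-- `x := 1` if the element of `ℤ_K` whose coordinates are in the registers `w` has its image
  under `σ_{1,+}` in the half-plane, `x := 0` otherwise -/
  | test (x : ℕ) (w : Fin (2 * (n + 1)) → ℕ)
  | seq (P Q : Prog n)
  /-- if `x > 0` then `P` else `Q` -/
  | branch (x : ℕ) (P Q : Prog n)
  /-- while `x > 0` do `P` -/
  | loop (x : ℕ) (P : Prog n)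

/-- What answers the two kinds of questions about real numbers. -/
structure Oracle (n : ℕ) where
  approx : RealName n → ℕ → ℤ
  test : (Fin (2 * (n + 1)) → ℤ) → Bool

/-- The oracle answers correctly for the instance `(r, φ, ε)`. -/
def Oracle.Valid {F : Type*} [Field F] {n : ℕ} (O : Oracle n) (σ : Fin (n + 1) → F →+* ℝ)
    {a : 𝓞 F} (bF : Module.Basis (Fin (n + 1)) ℤ (𝓞 F))
    (bK : Module.Basis (Fin (2 * (n + 1))) ℤ (CMIntegers a)) (r : 𝓞 F) (φ ε : ℝ) : Prop :=
  (∀ q p, |(O.approx q p : ℝ) - 2 ^ p * q.value σ bF bK φ ε| ≤ 1) ∧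
  ∀ w, O.test w = true ↔ sigmaPlus (σ 0) a (ofCoords bK w) ∈ halfPlane σ r φ ε

/-- A configuration: what remains to be executed, the registers, and the time spent so far. -/
structure Config (n : ℕ) where
  todo : List (Prog n)
  reg : ℕ → ℤ
  time : ℕ

/-- The bit length of an integer. -/
def bits (m : ℤ) : ℕ := Nat.size m.natAbs

/-- One step of the machine. A configuration with nothing left to do has halted. -/
def step {n : ℕ} (O : Oracle n) : Config n → PMF (Config n)
  | ⟨[], g, t⟩ => PMF.pure ⟨[], g, t⟩
  | ⟨.skip :: l, g, t⟩ => PMF.pure ⟨l, g, t + 1⟩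
  | ⟨.const x c :: l, g, t⟩ => PMF.pure ⟨l, Function.update g x c, t + 1 + bits c⟩
  | ⟨.add x y z :: l, g, t⟩ =>
      PMF.pure ⟨l, Function.update g x (g y + g z), t + 1 + bits (g y) + bits (g z)⟩
  | ⟨.sub x y z :: l, g, t⟩ =>
      PMF.pure ⟨l, Function.update g x (g y - g z), t + 1 + bits (g y) + bits (g z)⟩
  | ⟨.mul x y z :: l, g, t⟩ =>
      PMF.pure ⟨l, Function.update g x (g y * g z), t + (1 + bits (g y)) * (1 + bits (g z))⟩
  | ⟨.div x y z :: l, g, t⟩ =>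
      PMF.pure ⟨l, Function.update g x ((g y).fdiv (g z)),
        t + (1 + bits (g y)) * (1 + bits (g z))⟩
  | ⟨.toss x :: l, g, t⟩ =>
      (PMF.uniformOfFintype Bool).map fun b =>
        ⟨l, Function.update g x (if b then 1 else 0), t + 1⟩
  | ⟨.approx x q y :: l, g, t⟩ =>
      PMF.pure ⟨l, Function.update g x (O.approx q (g y).toNat),
        t + 1 + (g y).natAbs + bits (O.approx q (g y).toNat)⟩
  | ⟨.test x w :: l, g, t⟩ =>
      PMF.pure ⟨l, Function.update g x (if O.test (fun j => g (w j)) then 1 else 0),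
        t + 1 + ∑ j, bits (g (w j))⟩
  | ⟨.seq P Q :: l, g, t⟩ => PMF.pure ⟨P :: Q :: l, g, t + 1⟩
  | ⟨.branch x P Q :: l, g, t⟩ =>
      PMF.pure ⟨(if 0 < g x then P else Q) :: l, g, t + 1 + bits (g x)⟩
  | ⟨.loop x P :: l, g, t⟩ =>
      PMF.pure ⟨if 0 < g x then P :: .loop x P :: l else l, g, t + 1 + bits (g x)⟩

/-- The distribution of the configuration after a number of steps. -/
def runFor {n : ℕ} (O : Oracle n) : ℕ → Config n → PMF (Config n)
  | 0, c => PMF.pure c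
  | k + 1, c => (step O c).bind (runFor O k)

/-- The initial configuration: the coordinates of `r` in the basis of `ℤ_F` are in the registers
`0, …, n`, the other registers are `0`. -/
def start {F : Type*} [Field F] {n : ℕ} (bF : Module.Basis (Fin (n + 1)) ℤ (𝓞 F)) (P : Prog n)
    (r : 𝓞 F) : Config n :=
  ⟨[P], fun i => if h : i < n + 1 then bF.repr r ⟨i, h⟩ else 0, 0⟩

/-- The output: the integer of `K` whose coordinates are in the registers `0, …, 2n + 1`. -/
def output {F : Type*} [Field F] {n : ℕ} {a : 𝓞 F}
    (bK : Module.Basis (Fin (2 * (n + 1))) ℤ (CMIntegers a)) (c : Config n) : CMIntegers a :=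
  ofCoords bK fun j => c.reg j

end RandomIntegerPoint

end

/-! Put `R = √σ₁(r)`. The hypotheses keep `R ε²` between two positive constants. After rotation by
`e^{iφ/2}` the first coordinate of a candidate lies in the cap cut off the disc of radius `R` by a
chord at depth `R ε²`. This cap has bounded thickness and length of order `R ε`, that is, of order
`1/ε`, and the other coordinates are bounded. So the region is a bounded neighbourhood of part of a
segment of length of order `1/ε`.

Lower bound on the candidates: if the cap is deep enough compared with the covering constant `H` of
the lattice, rounding targets spaced `3H` apart on a segment inside the cap gives at least `4/ε`
distinct candidates (`Admissible.le_ncard`). Upper bound and sampling: every candidate is within a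
bounded distance of one of `q = 2^d` targets (`Admissible.exists_near`), hence differs from the
rounded target by one of at most `2^K` coordinate offsets. A uniform integer `u` with `p = K + d`
bits therefore encodes a target and an offset, and the resulting map from `[0, 2^p)` hits every
candidate. Since `2^p ≤ 2^{K+2}/ε` while there are at least `4/ε` candidates, each one has
probability at least `2^{-p} ≥ 2^{-K}/|Cand|`. There is no rejection loop: if `u` does not lead to a
candidate, a fixed default candidate is returned, so the program always halts and never errs.

Everything has to be computed from dyadic approximations. The Gram matrix of the basis of `ℤ_K` is
rational (`exists_gram_inverse`), so coordinates of a target are obtained from inner products by an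
integer matrix and one division. The condition `|σ_{k,+}(z)|² ≤ σ_k(r)` is decided exactly: the
difference is the image of an integer of `F`, and a nonzero integer has norm at least `1` in
absolute value, so none of its conjugates is too small (`one_le_abs_mul`). A precision of `8p` bits
then separates the signs (`pos_add_iff_nonneg`). Only the half-plane condition is left to the
oracle. These facts are collected in `exists_sampling_constants`.

On the machine side, runs are made deterministic by fixing the coin sequence (`half_pow_le_runFor`,
`exists_coins_of_mem_support`). Fixed integer expressions compile to programs whose cost is
quadratic in the input bit length (`exists_ends_comp`). The two loops make `O(p)` rounds on numbers
of `O(p)` bits, so the total cost is `O((p+1)³)` with `p = O(1 + log(1/ε))` (`exists_ends_program`).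
-/

noncomputable section
namespace RandomIntegerPoint

/-! ### Runs with prescribed coin tosses -/

section Machine

variable {n : ℕ}

/-- One step of the machine that takes its `k`-th coin toss from the sequence `ω`; the second
component of the state counts the tosses. -/
def coinStep (O : Oracle n) (ω : ℕ → Bool) : Config n × ℕ → Config n × ℕ
  | (⟨[], g, t⟩, k) => (⟨[], g, t⟩, k)
  | (⟨.skip :: l, g, t⟩, k) => (⟨l, g, t + 1⟩, k)
  | (⟨.const x c :: l, g, t⟩, k) => (⟨l, Function.update g x c, t + 1 + bits c⟩, k)
  | (⟨.add x y z :: l, g, t⟩, k) =>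
      (⟨l, Function.update g x (g y + g z), t + 1 + bits (g y) + bits (g z)⟩, k)
  | (⟨.sub x y z :: l, g, t⟩, k) =>
      (⟨l, Function.update g x (g y - g z), t + 1 + bits (g y) + bits (g z)⟩, k)
  | (⟨.mul x y z :: l, g, t⟩, k) =>
      (⟨l, Function.update g x (g y * g z), t + (1 + bits (g y)) * (1 + bits (g z))⟩, k)
  | (⟨.div x y z :: l, g, t⟩, k) =>
      (⟨l, Function.update g x ((g y).fdiv (g z)),
        t + (1 + bits (g y)) * (1 + bits (g z))⟩, k)
  | (⟨.toss x :: l, g, t⟩, k) =>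
      (⟨l, Function.update g x (if ω k then 1 else 0), t + 1⟩, k + 1)
  | (⟨.approx x q y :: l, g, t⟩, k) =>
      (⟨l, Function.update g x (O.approx q (g y).toNat),
        t + 1 + (g y).natAbs + bits (O.approx q (g y).toNat)⟩, k)
  | (⟨.test x w :: l, g, t⟩, k) =>
      (⟨l, Function.update g x (if O.test (fun j => g (w j)) then 1 else 0),
        t + 1 + ∑ j, bits (g (w j))⟩, k)
  | (⟨.seq P Q :: l, g, t⟩, k) => (⟨P :: Q :: l, g, t + 1⟩, k)
  | (⟨.branch x P Q :: l, g, t⟩, k) =>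
      (⟨(if 0 < g x then P else Q) :: l, g, t + 1 + bits (g x)⟩, k)
  | (⟨.loop x P :: l, g, t⟩, k) =>
      (⟨if 0 < g x then P :: .loop x P :: l else l, g, t + 1 + bits (g x)⟩, k)

/-- Only a toss branches, and its prescribed outcome has probability at least one half; the toss
counter grows exactly then. -/
theorem half_pow_le_step (O : Oracle n) (ω : ℕ → Bool) (c : Config n) (k : ℕ) :
    (2⁻¹ : ENNReal) ^ (coinStep O ω (c, k)).2 ≤
      2⁻¹ ^ k * step O c (coinStep O ω (c, k)).1 := by
  rcases c with ⟨_ | ⟨P, l⟩, g, t⟩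
  · simp [coinStep, step]
  · cases P
    case toss x =>
      simp only [coinStep, step, pow_succ]
      gcongr
      rw [PMF.map_apply]
      refine le_trans ?_ (ENNReal.le_tsum (ω k))
      simp
    all_goals simp [coinStep, step]

/-- Following one coin sequence bounds from below the mass of the configuration it reaches. Other
sequences may lead to the same configuration, which only adds mass, so an inequality is all that is
needed. -/
theorem half_pow_le_runFor (O : Oracle n) (ω : ℕ → Bool) (T : ℕ) (c : Config n) (k : ℕ) :
    (2⁻¹ : ENNReal) ^ ((coinStep O ω)^[T] (c, k)).2 ≤
      2⁻¹ ^ k * runFor O T c ((coinStep O ω)^[T] (c, k)).1 := by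
  induction T generalizing c k with
  | zero => simp [runFor]
  | succ T ih =>
    rw [Function.iterate_succ_apply]
    rcases h : coinStep O ω (c, k) with ⟨c₁, k₁⟩
    have h1 := half_pow_le_step O ω c k
    rw [h] at h1
    refine (ih c₁ k₁).trans ?_
    simp only [runFor, PMF.bind_apply]
    calc (2⁻¹ : ENNReal) ^ k₁ * runFor O T c₁ ((coinStep O ω)^[T] (c₁, k₁)).1
        ≤ 2⁻¹ ^ k * step O c c₁ * runFor O T c₁ ((coinStep O ω)^[T] (c₁, k₁)).1 := by gcongr
      _ ≤ _ := by
          rw [mul_assoc]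
          gcongr
          exact ENNReal.le_tsum (f := fun a =>
            step O c a * runFor O T a ((coinStep O ω)^[T] (c₁, k₁)).1) c₁

theorem coinStep_of_mem_support (O : Oracle n) (c c₁ : Config n) (h : c₁ ∈ (step O c).support)
    (k : ℕ) : (∀ ω, coinStep O ω (c, k) = (c₁, k)) ∨
      ∃ b, ∀ ω : ℕ → Bool, ω k = b → coinStep O ω (c, k) = (c₁, k + 1) := by
  rcases c with ⟨_ | ⟨P, l⟩, g, t⟩
  · simp only [step, PMF.mem_support_pure_iff] at h
    simp [coinStep, h]
  · cases P
    case toss x =>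
      simp only [step, PMF.mem_support_map_iff] at h
      obtain ⟨b, -, rfl⟩ := h
      exact Or.inr ⟨b, fun ω hω => by simp [coinStep, hω]⟩
    all_goals
      simp only [step, PMF.mem_support_pure_iff] at h
      simp [coinStep, h]

/-- Statements about every possible outcome reduce to statements about every coin sequence. The
prescribed prefix `ω₀` makes the induction work: a toss that has been read must not be changed by
the choice of later ones. -/
theorem exists_coins_of_mem_support (O : Oracle n) (T : ℕ) (c c' : Config n)
    (h : c' ∈ (runFor O T c).support) (k : ℕ) (ω₀ : ℕ → Bool) :
    ∃ ω : ℕ → Bool, (∀ i < k, ω i = ω₀ i) ∧ ((coinStep O ω)^[T] (c, k)).1 = c' := by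
  induction T generalizing c k ω₀ with
  | zero =>
    simp only [runFor, PMF.mem_support_pure_iff] at h
    exact ⟨ω₀, fun _ _ => rfl, h.symm⟩
  | succ T ih =>
    simp only [runFor, PMF.mem_support_bind_iff] at h
    obtain ⟨c₁, hc₁, hc'⟩ := h
    rcases coinStep_of_mem_support O c c₁ hc₁ k with h | ⟨b, h⟩
    · obtain ⟨ω, h1, h2⟩ := ih c₁ hc' k ω₀
      exact ⟨ω, h1, by rw [Function.iterate_succ_apply, h, h2]⟩
    · obtain ⟨ω, h1, h2⟩ := ih c₁ hc' (k + 1) (Function.update ω₀ k b)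
      refine ⟨ω, fun i hi => ?_, ?_⟩
      · rw [h1 i (by omega), Function.update_of_ne (by omega)]
      · rw [Function.iterate_succ_apply, h ω, h2]
        rw [h1 k (by omega), Function.update_self]

/-- With the tosses `ω`, of which `k` have been used, the program `P` started with registers `g`
ends with registers `g'`, after `k'` tosses in all, at the cost `c`. -/
def Runs (O : Oracle n) (ω : ℕ → Bool) (P : Prog n) (g : ℕ → ℤ) (k : ℕ) (g' : ℕ → ℤ)
    (k' c : ℕ) : Prop :=
  ∀ l t, ∃ s ≤ c, (coinStep O ω)^[s] (⟨P :: l, g, t⟩, k) = (⟨l, g', t + c⟩, k')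

/-- With the tosses `ω` the program `P` ends, at a cost of at most `C`, in a state with the
property `Q`. -/
def Ends (O : Oracle n) (ω : ℕ → Bool) (P : Prog n) (g : ℕ → ℤ) (k C : ℕ)
    (Q : (ℕ → ℤ) → ℕ → Prop) : Prop :=
  ∃ g' k' c, Runs O ω P g k g' k' c ∧ c ≤ C ∧ Q g' k'

variable {O : Oracle n} {ω : ℕ → Bool}

theorem Runs.of_step {P : Prog n} {g g' : ℕ → ℤ} {k k' c : ℕ} (hc : 1 ≤ c)
    (h : ∀ l t, coinStep O ω (⟨P :: l, g, t⟩, k) = (⟨l, g', t + c⟩, k')) :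
    Runs O ω P g k g' k' c := fun l t => ⟨1, hc, h l t⟩

theorem Runs.seq {P Q : Prog n} {g g' g'' : ℕ → ℤ} {k k' k'' c c' : ℕ}
    (h : Runs O ω P g k g' k' c) (h' : Runs O ω Q g' k' g'' k'' c') :
    Runs O ω (.seq P Q) g k g'' k'' (1 + c + c') := by
  intro l t
  obtain ⟨s, hs, e⟩ := h (Q :: l) (t + 1)
  obtain ⟨s', hs', e'⟩ := h' l (t + 1 + c)
  refine ⟨s' + (s + 1), by omega, ?_⟩
  rw [Function.iterate_add_apply, Function.iterate_succ_apply]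
  simp only [coinStep]
  rw [e, e']
  simp [add_assoc]

theorem Ends.seq {P Q : Prog n} {g : ℕ → ℤ} {k C C' : ℕ} {A B : (ℕ → ℤ) → ℕ → Prop}
    (h : Ends O ω P g k C A) (h' : ∀ g' k', A g' k' → Ends O ω Q g' k' C' B) :
    Ends O ω (.seq P Q) g k (1 + C + C') B := by
  obtain ⟨g', k', c, hr, hc, ha⟩ := h
  obtain ⟨g'', k'', c', hr', hc', hb⟩ := h' g' k' ha
  exact ⟨g'', k'', _, hr.seq hr', by omega, hb⟩

theorem Ends.mono {P : Prog n} {g : ℕ → ℤ} {k C C' : ℕ} {A B : (ℕ → ℤ) → ℕ → Prop}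
    (h : Ends O ω P g k C A) (hC : C ≤ C') (hAB : ∀ g' k', A g' k' → B g' k') :
    Ends O ω P g k C' B := by
  obtain ⟨g', k', c, hr, hc, ha⟩ := h
  exact ⟨g', k', c, hr, hc.trans hC, hAB _ _ ha⟩

theorem Ends.branch {P Q : Prog n} {x : ℕ} {g : ℕ → ℤ} {k C : ℕ} {A : (ℕ → ℤ) → ℕ → Prop}
    (hP : 0 < g x → Ends O ω P g k C A) (hQ : ¬ 0 < g x → Ends O ω Q g k C A) :
    Ends O ω (.branch x P Q) g k (1 + bits (g x) + C) A := by
  have h : Ends O ω (if 0 < g x then P else Q) g k C A := by split_ifs with h <;> simp_all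
  obtain ⟨g', k', c, hr, hc, ha⟩ := h
  refine ⟨g', k', 1 + bits (g x) + c, fun l t => ?_, by omega, ha⟩
  obtain ⟨s, hs, e⟩ := hr l (t + 1 + bits (g x))
  refine ⟨s + 1, by omega, ?_⟩
  rw [Function.iterate_succ_apply]
  simp only [coinStep]
  rw [e]
  simp [add_assoc]

theorem Ends.toss (x : ℕ) (g : ℕ → ℤ) (k : ℕ) :
    Ends O ω (.toss x) g k 1
      fun g' k' => g' = Function.update g x (if ω k then 1 else 0) ∧ k' = k + 1 :=
  ⟨_, _, _, Runs.of_step le_rfl fun _ _ => rfl, le_rfl, rfl, rfl⟩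

/-- The invariant is indexed by the number of completed rounds, which fixes the total at `m`; the
extra `1` in the bound pays for the last, failing test of the loop register. -/
theorem Ends.loop {P : Prog n} {x : ℕ} {m C B : ℕ} (I : ℕ → (ℕ → ℤ) → ℕ → Prop)
    (hB : ∀ i ≤ m, ∀ g k, I i g k → bits (g x) ≤ B)
    (hstep : ∀ i < m, ∀ g k, I i g k → 0 < g x ∧ Ends O ω P g k C (I (i + 1)))
    (hend : ∀ g k, I m g k → ¬ 0 < g x) {i : ℕ} (hi : i ≤ m) {g : ℕ → ℤ} {k : ℕ}
    (h : I i g k) :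
    Ends O ω (.loop x P) g k ((m - i + 1) * (1 + B + C)) (I m) := by
  induction hj : m - i generalizing i g k with
  | zero =>
    obtain rfl : i = m := by omega
    refine ⟨g, k, 1 + bits (g x), fun l t => ⟨1, by omega, ?_⟩, ?_, h⟩
    · simp [coinStep, if_neg (hend g k h), add_assoc]
    · have := hB i hi g k h
      omega
  | succ j ih =>
    obtain ⟨hx, g', k', c, hr, hc, h'⟩ := hstep i (by omega) g k h
    obtain ⟨g'', k'', c', hr', hc', h''⟩ := ih (by omega) h' (by omega)
    refine ⟨g'', k'', 1 + bits (g x) + c + c', fun l t => ?_, ?_, h''⟩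
    · obtain ⟨s, hs, e⟩ := hr (.loop x P :: l) (t + 1 + bits (g x))
      obtain ⟨s', hs', e'⟩ := hr' l (t + 1 + bits (g x) + c)
      refine ⟨s' + (s + 1), by omega, ?_⟩
      rw [Function.iterate_add_apply, Function.iterate_succ_apply]
      simp only [coinStep, if_pos hx]
      rw [e, e']
      simp [add_assoc]
    · have := hB i hi g k h
      have e : (j + 1 + 1) * (1 + B + C) = (j + 1) * (1 + B + C) + (1 + B + C) := by ring
      omega

/-- Each instruction costs at least `1`, so a cost bound also bounds the number of steps, and halted
configurations are fixed points. Hence `C` serves as a number of steps common to all coin sequences.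
-/
theorem Ends.iterate_coinStep {P : Prog n} {g : ℕ → ℤ} {C : ℕ} {Q : (ℕ → ℤ) → ℕ → Prop}
    (h : Ends O ω P g 0 C Q) :
    ∃ g' k' c, (coinStep O ω)^[C] (⟨[P], g, 0⟩, 0) = (⟨[], g', c⟩, k') ∧ c ≤ C ∧ Q g' k' := by
  obtain ⟨g', k', c, hr, hc, hq⟩ := h
  obtain ⟨s, hs, e⟩ := hr [] 0
  refine ⟨g', k', c, ?_, hc, hq⟩
  obtain ⟨j, rfl⟩ := Nat.exists_eq_add_of_le (hs.trans hc)
  rw [add_comm s j, Function.iterate_add_apply, e, zero_add]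
  exact Function.iterate_fixed rfl j

end Machine

end RandomIntegerPoint
end

noncomputable section
namespace RandomIntegerPoint

/-! ### Integer expressions and their compilation -/

/-! ### Bit lengths of sums, products and quotients. -/

section Bits

theorem bits_le_iff {m : ℤ} {B : ℕ} : bits m ≤ B ↔ |m| < 2 ^ B := by
  rw [bits, Nat.size_le, Int.abs_eq_natAbs]
  exact_mod_cast Iff.rfl

theorem abs_lt_two_pow_bits (m : ℤ) : |m| < 2 ^ bits m := bits_le_iff.1 le_rfl

theorem bits_le_of_abs_le {a b : ℤ} (h : |a| ≤ |b|) : bits a ≤ bits b :=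
  bits_le_iff.2 (h.trans_lt (abs_lt_two_pow_bits b))

theorem bits_add_le (a b : ℤ) : bits (a + b) ≤ 1 + bits a + bits b := by
  rw [bits_le_iff]
  have h1 := abs_lt_two_pow_bits a
  have h2 := abs_lt_two_pow_bits b
  have h3 : (2 : ℤ) ^ bits a ≤ 2 ^ (bits a + bits b) := by gcongr <;> omega
  have h4 : (2 : ℤ) ^ bits b ≤ 2 ^ (bits a + bits b) := by gcongr <;> omega
  have h5 := abs_add_le a b
  have h6 : (2 : ℤ) ^ (1 + bits a + bits b) = 2 * 2 ^ (bits a + bits b) := by ring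
  omega

theorem bits_neg (a : ℤ) : bits (-a) = bits a := by simp [bits]

theorem bits_sub_le (a b : ℤ) : bits (a - b) ≤ 1 + bits a + bits b := by
  have := bits_add_le a (-b)
  rwa [bits_neg, ← sub_eq_add_neg] at this

theorem bits_mul_le (a b : ℤ) : bits (a * b) ≤ bits a + bits b := by
  rw [bits_le_iff, abs_mul, pow_add]
  exact mul_lt_mul'' (abs_lt_two_pow_bits a) (abs_lt_two_pow_bits b) (abs_nonneg _) (abs_nonneg _)

theorem abs_fdiv_le (a b : ℤ) : |a.fdiv b| ≤ |a| := by
  rcases lt_trichotomy b 0 with hb | rfl | hb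
  · rw [← Int.neg_fdiv_neg, Int.fdiv_eq_ediv_of_nonneg _ (by omega), ← abs_neg a]
    exact Int.abs_ediv_le_abs _ _
  · simp
  · rw [Int.fdiv_eq_ediv_of_nonneg _ hb.le]
    exact Int.abs_ediv_le_abs _ _

theorem bits_fdiv_le (a b : ℤ) : bits (a.fdiv b) ≤ bits a := bits_le_of_abs_le (abs_fdiv_le a b)

theorem bits_zero : bits 0 = 0 := by simp [bits]

theorem bits_one : bits 1 = 1 := by simp [bits]

end Bits

/-- Integer expressions in the registers of the machine. -/
inductive Expr (n : ℕ) : Type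
  | reg (i : ℕ)
  | const (c : ℤ)
  | add (a b : Expr n)
  | sub (a b : Expr n)
  | mul (a b : Expr n)
  | div (a b : Expr n)
  | approx (q : RealName n)
  | test (w : Fin (2 * (n + 1)) → ℕ)
  | ite (c a b : Expr n)

namespace Expr

variable {n : ℕ}

instance : Add (Expr n) := ⟨add⟩
instance : Sub (Expr n) := ⟨sub⟩
instance : Mul (Expr n) := ⟨mul⟩

/-- The value of an expression; approximations are taken with the precision in register `ρ`. -/
def eval (O : Oracle n) (ρ : ℕ) (g : ℕ → ℤ) : Expr n → ℤ
  | reg i => g i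
  | const c => c
  | add a b => a.eval O ρ g + b.eval O ρ g
  | sub a b => a.eval O ρ g - b.eval O ρ g
  | mul a b => a.eval O ρ g * b.eval O ρ g
  | div a b => (a.eval O ρ g).fdiv (b.eval O ρ g)
  | approx q => O.approx q (g ρ).toNat
  | test w => if O.test (fun j => g (w j)) then 1 else 0
  | ite c a b => if 0 < c.eval O ρ g then a.eval O ρ g else b.eval O ρ g

/-- The registers that occur in the expression belong to `S`. -/
def Uses (S : ℕ → Prop) : Expr n → Prop
  | reg i => S i
  | const _ => True
  | add a b => a.Uses S ∧ b.Uses S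
  | sub a b => a.Uses S ∧ b.Uses S
  | mul a b => a.Uses S ∧ b.Uses S
  | div a b => a.Uses S ∧ b.Uses S
  | approx _ => True
  | test w => ∀ j, S (w j)
  | ite c a b => c.Uses S ∧ a.Uses S ∧ b.Uses S

/-- A program that computes the expression into the register `x` and may overwrite the later
registers. -/
def comp (ρ : ℕ) : Expr n → ℕ → Prog n
  -- A register is copied by adding it to zero. This is correct only for `i ≠ x`, which holds
  -- because expressions read registers below `y ≤ x`.
  | reg i, x => .seq (.const x 0) (.add x x i)
  | const c, x => .const x c
  | add a b, x => .seq (a.comp ρ x) (.seq (b.comp ρ (x + 1)) (.add x x (x + 1)))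
  | sub a b, x => .seq (a.comp ρ x) (.seq (b.comp ρ (x + 1)) (.sub x x (x + 1)))
  | mul a b, x => .seq (a.comp ρ x) (.seq (b.comp ρ (x + 1)) (.mul x x (x + 1)))
  | div a b, x => .seq (a.comp ρ x) (.seq (b.comp ρ (x + 1)) (.div x x (x + 1)))
  | approx q, x => .approx x q ρ
  | test w, x => .test x w
  | ite c a b, x => .seq (c.comp ρ x) (.branch x (a.comp ρ x) (b.comp ρ x))

section Simp
variable (O : Oracle n) (ρ : ℕ) (g : ℕ → ℤ) (S : ℕ → Prop) (a b : Expr n)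

@[simp] theorem eval_add : (a + b).eval O ρ g = a.eval O ρ g + b.eval O ρ g := rfl
@[simp] theorem eval_sub : (a - b).eval O ρ g = a.eval O ρ g - b.eval O ρ g := rfl
@[simp] theorem eval_mul : (a * b).eval O ρ g = a.eval O ρ g * b.eval O ρ g := rfl
@[simp] theorem uses_sub : (a - b).Uses S ↔ a.Uses S ∧ b.Uses S := Iff.rfl

end Simp

/-- A finite sum of expressions. -/
def fsum {m : ℕ} (f : Fin m → Expr n) : Expr n :=
  ((List.finRange m).map f).foldr add (const 0)

@[simp] theorem eval_fsum {m : ℕ} (f : Fin m → Expr n) (O : Oracle n) (ρ : ℕ) (g : ℕ → ℤ) :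
    (fsum f).eval O ρ g = ∑ i, (f i).eval O ρ g := by
  rw [Fin.sum_univ_def, fsum]
  induction List.finRange m with
  | nil => rfl
  | cons i l ih => simp [eval, ih]

@[simp] theorem uses_fsum {m : ℕ} (f : Fin m → Expr n) (S : ℕ → Prop) :
    (fsum f).Uses S ↔ ∀ i, (f i).Uses S := by
  have : ∀ l : List (Fin m), ((l.map f).foldr add (const 0)).Uses S ↔ ∀ i ∈ l, (f i).Uses S := by
    intro l
    induction l with
    | nil => simp [Uses]
    | cons i l ih => simp [Uses, ih]
  simp [fsum, this]

theorem eval_congr {O : Oracle n} {ρ : ℕ} {g g' : ℕ → ℤ} {S : ℕ → Prop} (hg : ∀ i, S i → g i = g' i)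
    (hρ : S ρ) {e : Expr n} (h : e.Uses S) : e.eval O ρ g = e.eval O ρ g' := by
  induction e <;> simp_all [Uses, eval]

/-- The registers below `y` and the approximations have at most `L` bits, and `L` bounds the
precision. -/
structure SizeLE (O : Oracle n) (ρ y L : ℕ) (g : ℕ → ℤ) : Prop where
  lt : ρ < y
  one_le : 1 ≤ L
  reg : ∀ i < y, bits (g i) ≤ L
  prec : (g ρ).natAbs ≤ L
  approx : ∀ q, bits (O.approx q (g ρ).toNat) ≤ L

theorem SizeLE.congr {O : Oracle n} {ρ y L : ℕ} {g g' : ℕ → ℤ} (h : SizeLE O ρ y L g)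
    (hg : ∀ i < y, g' i = g i) : SizeLE O ρ y L g' where
  lt := h.lt
  one_le := h.one_le
  reg i hi := by rw [hg i hi]; exact h.reg i hi
  prec := by rw [hg ρ h.lt]; exact h.prec
  approx := by rw [hg ρ h.lt]; exact h.approx

theorem runs_copy (O : Oracle n) (ω : ℕ → Bool) {x i : ℕ} (hi : i ≠ x) (g : ℕ → ℤ) (k : ℕ) :
    Runs O ω (.seq (.const x 0) (.add x x i)) g k (Function.update g x (g i)) k
      (3 + bits (g i)) := by
  have h1 : Runs O ω (.const x 0) g k (Function.update g x 0) k 1 :=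
    Runs.of_step le_rfl fun l t => by simp [coinStep, bits_zero]
  have h2 : Runs O ω (.add x x i) (Function.update g x 0) k (Function.update g x (g i)) k
      (1 + bits (g i)) :=
    Runs.of_step (by omega) fun l t => by
      simp [coinStep, bits_zero, Function.update_of_ne hi, add_assoc]
  have := h1.seq h2
  rwa [show 1 + 1 + (1 + bits (g i)) = 3 + bits (g i) by omega] at this

/-- The common part of the four arithmetic cases. The second operand is evaluated after register `x`
has been overwritten, which is harmless since it reads only registers below `y ≤ x`. -/
theorem ends_binary {O : Oracle n} {ω : ℕ → Bool} {ρ : ℕ} {a b : Expr n} {A B C L x y k : ℕ}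
    {g : ℕ → ℤ} (hb : b.Uses (· < y)) (hy : y ≤ x) (hg : SizeLE O ρ y L g)
    (ha : Ends O ω (a.comp ρ x) g k (A * L ^ 2)
      fun g' k' => k' = k ∧ g' x = a.eval O ρ g ∧ ∀ i < x, g' i = g i)
    (hb' : ∀ g, SizeLE O ρ y L g → Ends O ω (b.comp ρ (x + 1)) g k (B * L ^ 2)
      fun g' k' => k' = k ∧ g' (x + 1) = b.eval O ρ g ∧ ∀ i < x + 1, g' i = g i)
    (op : Prog n) (v : ℤ)
    (hop : ∀ g' : ℕ → ℤ, g' x = a.eval O ρ g → g' (x + 1) = b.eval O ρ g →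
      Runs O ω op g' k (Function.update g' x v) k C) :
    Ends O ω (.seq (a.comp ρ x) (.seq (b.comp ρ (x + 1)) op)) g k
      (1 + A * L ^ 2 + (1 + B * L ^ 2 + C))
      fun g' k' => k' = k ∧ g' x = v ∧ ∀ i < x, g' i = g i := by
  refine ha.seq ?_
  rintro g₁ k₁ ⟨rfl, h1, h2⟩
  refine (hb' g₁ (hg.congr fun i hi => h2 i (by omega))).seq ?_
  rintro g₂ k₂ ⟨rfl, h3, h4⟩
  rw [eval_congr (S := (· < y)) (fun i hi => h2 i (by omega)) hg.lt hb] at h3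
  refine ⟨_, _, _, hop g₂ (by rw [h4 x (by omega), h1]) h3, le_rfl, rfl, by simp, fun i hi => ?_⟩
  rw [Function.update_of_ne (by omega), h4 i (by omega), h2 i hi]

/-- `A` depends on the expression alone. A fixed number of operations enlarges bit lengths by a
constant factor, because each result is at most about as long as its operands together, and one
multiplication or division of numbers of `O(L)` bits costs `O(L²)`. -/
theorem exists_ends_comp (e : Expr n) : ∃ A : ℕ, ∀ (O : Oracle n) (ω : ℕ → Bool) (ρ : ℕ)
    (g : ℕ → ℤ) (L x y k : ℕ), e.Uses (· < y) → y ≤ x → SizeLE O ρ y L g →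
    bits (e.eval O ρ g) ≤ A * L ∧
    Ends O ω (e.comp ρ x) g k (A * L ^ 2)
      fun g' k' => k' = k ∧ g' x = e.eval O ρ g ∧ ∀ i < x, g' i = g i := by
  induction e with
  | reg i =>
    refine ⟨4, fun O ω ρ g L x y k hu hy hg => ⟨(hg.reg i hu).trans (by omega), ?_⟩⟩
    have hi : i < y := hu
    have hL : L ≤ L ^ 2 := Nat.le_self_pow two_ne_zero L
    have h1 := hg.one_le
    refine ⟨_, _, _, runs_copy O ω (by omega) g k, ?_, rfl, by simp [eval], fun j hj => ?_⟩
    · have := hg.reg i hu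
      omega
    · rw [Function.update_of_ne (by omega)]
  | const c =>
    refine ⟨1 + bits c, fun O ω ρ g L x y k hu hy hg => ⟨?_, ?_⟩⟩
    · exact (Nat.le_add_left _ 1).trans (Nat.le_mul_of_pos_right _ hg.one_le)
    · refine ⟨Function.update g x c, k, 1 + bits c,
        Runs.of_step (by omega) fun l t => by simp [comp, coinStep, add_assoc],
        Nat.le_mul_of_pos_right _ (pow_pos hg.one_le 2), rfl, by simp [eval], fun j hj => ?_⟩
      rw [Function.update_of_ne (by omega)]
  | add a b iha ihb =>
    obtain ⟨A, hA⟩ := iha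
    obtain ⟨B, hB⟩ := ihb
    refine ⟨3 + 2 * A + 2 * B, fun O ω ρ g L x y k hu hy hg => ?_⟩
    have h1 := hg.one_le
    have hL : L ≤ L ^ 2 := Nat.le_self_pow two_ne_zero L
    obtain ⟨a1, a2⟩ := hA O ω ρ g L x y k hu.1 hy hg
    have b1 := (hB O ω ρ g L x y k hu.2 hy hg).1
    have hAL := Nat.mul_le_mul_left A hL
    have hBL := Nat.mul_le_mul_left B hL
    refine ⟨?_, (ends_binary hu.2 hy hg a2 (fun g hg => (hB O ω ρ g L (x + 1) y k hu.2
      (by omega) hg).2) (.add x x (x + 1)) (a.eval O ρ g + b.eval O ρ g)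
      (C := 1 + bits (a.eval O ρ g) + bits (b.eval O ρ g))
      fun g' e1 e2 => Runs.of_step (by omega) fun l t => ?_).mono ?_ fun _ _ => id⟩
    · have := bits_add_le (a.eval O ρ g) (b.eval O ρ g)
      simp only [eval]
      nlinarith
    · simp [coinStep, e1, e2, add_assoc]
    · nlinarith
  | sub a b iha ihb =>
    obtain ⟨A, hA⟩ := iha
    obtain ⟨B, hB⟩ := ihb
    refine ⟨3 + 2 * A + 2 * B, fun O ω ρ g L x y k hu hy hg => ?_⟩
    have h1 := hg.one_le
    have hL : L ≤ L ^ 2 := Nat.le_self_pow two_ne_zero L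
    obtain ⟨a1, a2⟩ := hA O ω ρ g L x y k hu.1 hy hg
    have b1 := (hB O ω ρ g L x y k hu.2 hy hg).1
    have hAL := Nat.mul_le_mul_left A hL
    have hBL := Nat.mul_le_mul_left B hL
    refine ⟨?_, (ends_binary hu.2 hy hg a2 (fun g hg => (hB O ω ρ g L (x + 1) y k hu.2
      (by omega) hg).2) (.sub x x (x + 1)) (a.eval O ρ g - b.eval O ρ g)
      (C := 1 + bits (a.eval O ρ g) + bits (b.eval O ρ g))
      fun g' e1 e2 => Runs.of_step (by omega) fun l t => ?_).mono ?_ fun _ _ => id⟩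
    · have := bits_sub_le (a.eval O ρ g) (b.eval O ρ g)
      simp only [eval]
      nlinarith
    · simp [coinStep, e1, e2, add_assoc]
    · nlinarith
  | mul a b iha ihb =>
    obtain ⟨A, hA⟩ := iha
    obtain ⟨B, hB⟩ := ihb
    refine ⟨2 + A + B + (1 + A) * (1 + B), fun O ω ρ g L x y k hu hy hg => ?_⟩
    have h1 := hg.one_le
    have hL : L ≤ L ^ 2 := Nat.le_self_pow two_ne_zero L
    obtain ⟨a1, a2⟩ := hA O ω ρ g L x y k hu.1 hy hg
    have b1 := (hB O ω ρ g L x y k hu.2 hy hg).1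
    have hprod : (1 + bits (a.eval O ρ g)) * (1 + bits (b.eval O ρ g)) ≤
        (1 + A) * (1 + B) * L ^ 2 := by
      calc _ ≤ (L + A * L) * (L + B * L) := by gcongr
        _ = _ := by ring
    refine ⟨?_, (ends_binary hu.2 hy hg a2 (fun g hg => (hB O ω ρ g L (x + 1) y k hu.2
      (by omega) hg).2) (.mul x x (x + 1)) (a.eval O ρ g * b.eval O ρ g)
      (C := (1 + bits (a.eval O ρ g)) * (1 + bits (b.eval O ρ g)))
      fun g' e1 e2 => Runs.of_step (by nlinarith) fun l t => ?_).mono ?_ fun _ _ => id⟩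
    · have := bits_mul_le (a.eval O ρ g) (b.eval O ρ g)
      simp only [eval]
      nlinarith [Nat.zero_le ((1 + A) * (1 + B) * L)]
    · simp [coinStep, e1, e2]
    · nlinarith
  | div a b iha ihb =>
    obtain ⟨A, hA⟩ := iha
    obtain ⟨B, hB⟩ := ihb
    refine ⟨2 + A + B + (1 + A) * (1 + B), fun O ω ρ g L x y k hu hy hg => ?_⟩
    have h1 := hg.one_le
    have hL : L ≤ L ^ 2 := Nat.le_self_pow two_ne_zero L
    obtain ⟨a1, a2⟩ := hA O ω ρ g L x y k hu.1 hy hg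
    have b1 := (hB O ω ρ g L x y k hu.2 hy hg).1
    have hprod : (1 + bits (a.eval O ρ g)) * (1 + bits (b.eval O ρ g)) ≤
        (1 + A) * (1 + B) * L ^ 2 := by
      calc _ ≤ (L + A * L) * (L + B * L) := by gcongr
        _ = _ := by ring
    refine ⟨?_, (ends_binary hu.2 hy hg a2 (fun g hg => (hB O ω ρ g L (x + 1) y k hu.2
      (by omega) hg).2) (.div x x (x + 1)) ((a.eval O ρ g).fdiv (b.eval O ρ g))
      (C := (1 + bits (a.eval O ρ g)) * (1 + bits (b.eval O ρ g)))
      fun g' e1 e2 => Runs.of_step (by nlinarith) fun l t => ?_).mono ?_ fun _ _ => id⟩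
    · have := bits_fdiv_le (a.eval O ρ g) (b.eval O ρ g)
      simp only [eval]
      nlinarith [Nat.zero_le ((1 + A) * (1 + B) * L)]
    · simp [coinStep, e1, e2]
    · nlinarith
  | approx q =>
    refine ⟨3, fun O ω ρ g L x y k hu hy hg => ⟨(hg.approx q).trans (by omega), ?_⟩⟩
    have hL : L ≤ L ^ 2 := Nat.le_self_pow two_ne_zero L
    have h1 := hg.one_le
    have h2 := hg.prec
    have h3 := hg.approx q
    refine ⟨_, _, 1 + (g ρ).natAbs + bits (O.approx q (g ρ).toNat), Runs.of_step (by omega)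
      fun l t => by simp only [coinStep, ← add_assoc]; rfl, by omega, rfl, by simp [eval],
      fun j hj => ?_⟩
    rw [Function.update_of_ne (by omega)]
  | test w =>
    refine ⟨1 + 2 * (n + 1), fun O ω ρ g L x y k hu hy hg => ?_⟩
    have hL : L ≤ L ^ 2 := Nat.le_self_pow two_ne_zero L
    have h1 := hg.one_le
    refine ⟨?_, _, _, 1 + ∑ j, bits (g (w j)), Runs.of_step (by omega)
      fun l t => by simp only [coinStep, ← add_assoc]; rfl, ?_, rfl, by simp [eval],
      fun j hj => ?_⟩
    · simp only [eval]
      split_ifs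
      · rw [bits_one]; nlinarith
      · rw [bits_zero]; omega
    · have : ∑ j, bits (g (w j)) ≤ ∑ _j : Fin (2 * (n + 1)), L :=
        Finset.sum_le_sum fun j _ => hg.reg _ (hu j)
      simp only [Finset.sum_const, Finset.card_univ, Fintype.card_fin, smul_eq_mul] at this
      nlinarith
    · rw [Function.update_of_ne (by omega)]
  | ite c a b ihc iha ihb =>
    obtain ⟨C, hC⟩ := ihc
    obtain ⟨A, hA⟩ := iha
    obtain ⟨B, hB⟩ := ihb
    refine ⟨2 + 2 * C + A + B, fun O ω ρ g L x y k hu hy hg => ?_⟩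
    have hL : L ≤ L ^ 2 := Nat.le_self_pow two_ne_zero L
    have h1 := hg.one_le
    obtain ⟨c1, c2⟩ := hC O ω ρ g L x y k hu.1 hy hg
    have a1 := (hA O ω ρ g L x y k hu.2.1 hy hg).1
    have b1 := (hB O ω ρ g L x y k hu.2.2 hy hg).1
    have hCL := Nat.mul_le_mul_left C hL
    constructor
    · simp only [eval]
      split_ifs <;> nlinarith
    · refine (c2.seq (C' := 1 + C * L + (A + B) * L ^ 2) ?_).mono (by nlinarith) fun _ _ => id
      rintro g₁ k₁ ⟨rfl, h3, h4⟩
      have hg₁ := hg.congr fun i hi => h4 i (by omega)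
      have ea := eval_congr (O := O) (S := (· < y)) (fun i hi => h4 i (by omega)) hg.lt hu.2.1
      have eb := eval_congr (O := O) (S := (· < y)) (fun i hi => h4 i (by omega)) hg.lt hu.2.2
      refine (Ends.branch (C := (A + B) * L ^ 2) (fun h => ?_) fun h => ?_).mono
        (by rw [h3]; omega) fun _ _ => id
      · rw [h3] at h
        refine ((hA O ω ρ g₁ L x y k₁ hu.2.1 hy hg₁).2).mono (by nlinarith) ?_
        rintro g₂ k₂ ⟨rfl, h5, h6⟩
        refine ⟨rfl, ?_, fun i hi => (h6 i hi).trans (h4 i hi)⟩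
        rw [h5, ea, eval, if_pos h]
      · rw [h3] at h
        refine ((hB O ω ρ g₁ L x y k₁ hu.2.2 hy hg₁).2).mono (by nlinarith) ?_
        rintro g₂ k₂ ⟨rfl, h5, h6⟩
        refine ⟨rfl, ?_, fun i hi => (h6 i hi).trans (h4 i hi)⟩
        rw [h5, eb, eval, if_neg h]

end Expr

/-! ### Blocks of assignments -/

section Block

variable {n : ℕ}

/-- The effect of a list of assignments `x := e`. -/
def evalBlock (O : Oracle n) (ρ : ℕ) : List (ℕ × Expr n) → (ℕ → ℤ) → ℕ → ℤ
  | [], g => g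
  | (x, e) :: l, g => evalBlock O ρ l (Function.update g x (e.eval O ρ g))

/-- A program for a list of assignments to registers below `y`, with the auxiliary registers
`y, y + 1, …`. -/
def block (ρ y : ℕ) : List (ℕ × Expr n) → Prog n
  | [] => .skip
  | (x, e) :: l => .seq (.seq (e.comp ρ y) (.seq (.const x 0) (.add x x y))) (block ρ y l)

theorem evalBlock_of_notMem {O : Oracle n} {ρ : ℕ} {l : List (ℕ × Expr n)} {g : ℕ → ℤ} {i : ℕ}
    (h : ∀ p ∈ l, p.1 ≠ i) : evalBlock O ρ l g i = g i := by
  induction l generalizing g with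
  | nil => rfl
  | cons p l ih =>
    obtain ⟨x, e⟩ := p
    rw [evalBlock, ih fun p hp => h p (List.mem_cons_of_mem _ hp),
      Function.update_of_ne (h (x, e) List.mem_cons_self).symm]

/-- No assigned register is read on any right-hand side, so successive assignments act like a
simultaneous one. -/
theorem evalBlock_of_mem {O : Oracle n} {ρ : ℕ} {l : List (ℕ × Expr n)} {g : ℕ → ℤ} {S : ℕ → Prop}
    (hρ : S ρ) (hl : ∀ p ∈ l, ¬ S p.1 ∧ p.2.Uses S) (hn : (l.map Prod.fst).Nodup)
    {x : ℕ} {e : Expr n} (h : (x, e) ∈ l) : evalBlock O ρ l g x = e.eval O ρ g := by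
  induction l generalizing g with
  | nil => simp at h
  | cons p l ih =>
    obtain ⟨x', e'⟩ := p
    rw [List.map_cons, List.nodup_cons] at hn
    rw [evalBlock]
    rcases List.mem_cons.1 h with h | h
    · obtain ⟨rfl, rfl⟩ := Prod.mk.inj h
      rw [evalBlock_of_notMem, Function.update_self]
      exact fun p hp hpx => hn.1 (List.mem_map.2 ⟨p, hp, hpx⟩)
    · rw [ih (fun p hp => hl p (List.mem_cons_of_mem _ hp)) hn.2 h]
      refine Expr.eval_congr (S := S) (fun i hi => Function.update_of_ne ?_ _ _) hρ
        (hl _ (List.mem_cons_of_mem _ h)).2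
      rintro rfl
      exact (hl _ List.mem_cons_self).1 hi

/-- The assignments `x₀ + j := e j`. -/
def family {m : ℕ} (x₀ : ℕ) (e : Fin m → Expr n) : List (ℕ × Expr n) :=
  List.ofFn fun j => (x₀ + j, e j)

theorem evalBlock_family {O : Oracle n} {ρ m x₀ : ℕ} {e : Fin m → Expr n} {g : ℕ → ℤ}
    {S : ℕ → Prop} (hρ : S ρ) (hS : ∀ j : Fin m, ¬ S (x₀ + j)) (he : ∀ j, (e j).Uses S)
    (j : Fin m) :
    evalBlock O ρ (family x₀ e) g (x₀ + j) = (e j).eval O ρ g := by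
  refine evalBlock_of_mem (S := S) hρ ?_ ?_ ?_
  · intro p hp
    obtain ⟨j, rfl⟩ := (List.mem_ofFn' _ _).1 hp
    exact ⟨hS j, he j⟩
  · rw [family, List.map_ofFn, List.nodup_ofFn]
    intro i j h
    simpa [Fin.ext_iff] using h
  · exact (List.mem_ofFn' _ _).2 ⟨j, rfl⟩

theorem evalBlock_family_of_notMem {O : Oracle n} {ρ m x₀ : ℕ} {e : Fin m → Expr n} {g : ℕ → ℤ}
    {i : ℕ} (hi : ∀ j : Fin m, x₀ + j ≠ i) : evalBlock O ρ (family x₀ e) g i = g i := by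
  refine evalBlock_of_notMem ?_
  intro p hp
  obtain ⟨j, rfl⟩ := (List.mem_ofFn' _ _).1 hp
  exact hi j

theorem evalBlock_congr {O : Oracle n} {ρ y : ℕ} (hρ : ρ < y) {l : List (ℕ × Expr n)}
    (hl : ∀ p ∈ l, p.2.Uses (· < y)) {g g' : ℕ → ℤ} (h : ∀ i < y, g i = g' i) :
    ∀ i < y, evalBlock O ρ l g i = evalBlock O ρ l g' i := by
  induction l generalizing g g' with
  | nil => exact h
  | cons p l ih =>
    refine ih (fun p hp => hl p (List.mem_cons_of_mem _ hp)) fun i hi => ?_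
    rw [Expr.eval_congr (S := (· < y)) h hρ (hl p List.mem_cons_self)]
    by_cases hip : i = p.1
    · subst hip; simp
    · rw [Function.update_of_ne hip, Function.update_of_ne hip, h i hi]

/-- Sizes grow by a constant factor for a fixed list, so blocks can be chained. The precision
register is never a target, which keeps the bounds on approximations valid throughout. -/
theorem exists_ends_block (ρ y : ℕ) (l : List (ℕ × Expr n))
    (hl : ∀ p ∈ l, p.1 < y ∧ p.1 ≠ ρ ∧ p.2.Uses (· < y)) : ∃ A : ℕ, 1 ≤ A ∧
    ∀ (O : Oracle n) (ω : ℕ → Bool) (g : ℕ → ℤ) (L k : ℕ), Expr.SizeLE O ρ y L g →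
    Ends O ω (block ρ y l) g k (A * L ^ 2) fun g' k' => k' = k ∧
      (∀ i < y, g' i = evalBlock O ρ l g i) ∧ Expr.SizeLE O ρ y (A * L) g' := by
  induction l with
  | nil =>
    refine ⟨1, le_rfl, fun O ω g L k hg => ⟨g, k, 1, Runs.of_step le_rfl fun l t => rfl, ?_, rfl,
      fun i _ => rfl, by rwa [one_mul]⟩⟩
    simpa using Nat.one_le_pow 2 L hg.one_le
  | cons p l ih =>
    obtain ⟨x, e⟩ := p
    obtain ⟨A, hA1, hA⟩ := ih fun p hp => hl p (List.mem_cons_of_mem _ hp)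
    obtain ⟨B, hB⟩ := e.exists_ends_comp
    obtain ⟨hx, hxρ, he⟩ := hl (x, e) List.mem_cons_self
    -- The remaining assignments start from sizes up to `(1 + B) * L`; this is the source of the
    -- factor `(1 + B) ^ 2`. The rest pays for evaluating and copying the first one.
    refine ⟨5 + B + B + A * (1 + B) ^ 2, by omega, fun O ω g L k hg => ?_⟩
    have hL := hg.one_le
    have hL2 : L ≤ L ^ 2 := Nat.le_self_pow two_ne_zero L
    obtain ⟨hbits, hcomp⟩ := hB O ω ρ g L y y k he le_rfl hg
    have h1 : Ends O ω (.seq (e.comp ρ y) (.seq (.const x 0) (.add x x y))) g k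
        (1 + B * L ^ 2 + (3 + B * L)) fun g' k' => k' = k ∧
          ∀ i < y, g' i = Function.update g x (e.eval O ρ g) i := by
      refine hcomp.seq ?_
      rintro g₁ k₁ ⟨rfl, h3, h4⟩
      refine ⟨_, _, _, Expr.runs_copy O ω (by omega) g₁ k₁, by rw [h3]; omega, rfl,
        fun i hi => ?_⟩
      · rw [h3]
        by_cases hix : i = x
        · subst hix; simp
        · rw [Function.update_of_ne hix, Function.update_of_ne hix, h4 i hi]
    have hBL := Nat.mul_le_mul_left B hL2
    refine (h1.seq (C' := A * ((1 + B) * L) ^ 2) ?_).mono ?_ fun _ _ => id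
    · rintro g₁ k₁ ⟨rfl, h3⟩
      have hρ₁ : g₁ ρ = g ρ := by rw [h3 ρ hg.lt, Function.update_of_ne hxρ.symm]
      have hLL : L ≤ (1 + B) * L := Nat.le_mul_of_pos_left _ (by omega)
      have hg₁ : Expr.SizeLE O ρ y ((1 + B) * L) g₁ := by
        refine ⟨hg.lt, hL.trans hLL, fun i hi => ?_, ?_, fun q => ?_⟩
        · rw [h3 i hi]
          by_cases hix : i = x
          · subst hix
            rw [Function.update_self]
            exact hbits.trans (Nat.mul_le_mul_right _ (by omega))
          · rw [Function.update_of_ne hix]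
            exact (hg.reg i hi).trans hLL
        · rw [hρ₁]; exact hg.prec.trans hLL
        · rw [hρ₁]; exact (hg.approx q).trans hLL
      refine (hA O ω g₁ _ k₁ hg₁).mono le_rfl ?_
      rintro g₂ k₂ ⟨rfl, h5, h6⟩
      refine ⟨rfl, fun i hi => ?_, ?_⟩
      · rw [h5 i hi, evalBlock]
        exact evalBlock_congr hg.lt (fun p hp => (hl p (List.mem_cons_of_mem _ hp)).2.2) h3 i hi
      · have hle : A * ((1 + B) * L) ≤ (5 + B + B + A * (1 + B) ^ 2) * L := by
          have h7 : A * (1 + B) ≤ A * (1 + B) ^ 2 :=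
            Nat.mul_le_mul_left _ (Nat.le_self_pow two_ne_zero _)
          rw [← mul_assoc]
          exact Nat.mul_le_mul_right _ (by omega)
        exact ⟨h6.lt, h6.one_le.trans hle, fun i hi => (h6.reg i hi).trans hle,
          h6.prec.trans hle, fun q => (h6.approx q).trans hle⟩
    · have : A * ((1 + B) * L) ^ 2 = A * (1 + B) ^ 2 * L ^ 2 := by ring
      nlinarith

end Block

end RandomIntegerPoint
end

noncomputable section
namespace RandomIntegerPoint

/-! ### The lattices of the integers of `F` and of `K` -/

section Lattice

variable {F : Type*} [Field F] {n : ℕ}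

theorem sigmaPlus_re (s : F →+* ℝ) (a : 𝓞 F) (x : CMField a) : (sigmaPlus s a x).re = s x.re := by
  simp [sigmaPlus]

theorem sigmaPlus_im (s : F →+* ℝ) (a : 𝓞 F) (x : CMField a) :
    (sigmaPlus s a x).im = s x.im * Real.sqrt |s a| := by
  simp [sigmaPlus]

/-- The embedding `σ_{k,+}` as a homomorphism of additive groups. -/
def sigmaPlusHom (s : F →+* ℝ) (a : 𝓞 F) : CMField a →+ ℂ :=
  AddMonoidHom.mk' (sigmaPlus s a) fun x y => by
    apply Complex.ext
    · simp [sigmaPlus_re]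
    · simp [sigmaPlus_im, add_mul]

/-- The point of `ℂ^d` with the real coordinates `w` in the basis of `ℤ_K`. -/
def realPoint (σ : Fin (n + 1) → F →+* ℝ) {a : 𝓞 F}
    (bK : Module.Basis (Fin (2 * (n + 1))) ℤ (CMIntegers a)) (w : Fin (2 * (n + 1)) → ℝ)
    (k : Fin (n + 1)) : ℂ :=
  ∑ j, (w j : ℂ) * sigmaPlus (σ k) a (bK j)

theorem sigmaPlus_ofCoords (σ : Fin (n + 1) → F →+* ℝ) {a : 𝓞 F}
    (bK : Module.Basis (Fin (2 * (n + 1))) ℤ (CMIntegers a)) (w : Fin (2 * (n + 1)) → ℤ)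
    (k : Fin (n + 1)) :
    sigmaPlus (σ k) a (ofCoords bK w) = realPoint σ bK (fun j => w j) k := by
  let f : CMIntegers a →+ ℂ := (sigmaPlusHom (σ k) a).comp (CMIntegers a).val.toAddMonoidHom
  change f (ofCoords bK w) = _
  simp only [ofCoords, realPoint, map_sum, Complex.ofReal_intCast]
  refine Finset.sum_congr rfl fun j _ => ?_
  rw [← zsmul_eq_mul]
  exact map_zsmul f (w j) (bK j)

theorem ofCoords_repr {a : 𝓞 F} (bK : Module.Basis (Fin (2 * (n + 1))) ℤ (CMIntegers a))
    (z : CMIntegers a) : ofCoords bK (bK.repr z) = z := bK.sum_repr z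

/-- The Euclidean inner product in one complex coordinate comes from an element of `F`, the part in
`F` of `x` times the conjugate of `y`. Summed over all embeddings it becomes a trace, hence
rational. -/
theorem sigmaPlus_re_mul_add_im_mul {s : F →+* ℝ} {a : 𝓞 F} (ha : s a < 0) (x y : CMField a) :
    (sigmaPlus s a x).re * (sigmaPlus s a y).re + (sigmaPlus s a x).im * (sigmaPlus s a y).im =
      s (x.re * y.re - a * (x.im * y.im)) := by
  have h := Real.mul_self_sqrt (abs_nonneg (s a))
  rw [abs_of_neg ha] at h
  simp only [sigmaPlus_re, sigmaPlus_im, map_sub, map_mul, abs_of_neg ha]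
  linear_combination s x.im * s y.im * h

/-- The relative norm `z z̄` is integral and lies in `F`. One integer `y` serves all embeddings, so
the ball conditions become sign conditions on the conjugates of a single integer of `F`. -/
theorem exists_norm_eq (a : 𝓞 F) (z : CMIntegers a) :
    ∃ y : 𝓞 F, ∀ s : F →+* ℝ, s a < 0 → s y = ‖sigmaPlus s a z‖ ^ 2 := by
  let c : CMField a →+* CMField a := starRingEnd (CMField a)
  have hz : IsIntegral ℤ (z : CMField a) := z.2
  have hc : IsIntegral ℤ (star (z : CMField a)) := hz.map c.toIntAlgHom
  have h : IsIntegral ℤ (algebraMap F (CMField a) (QuadraticAlgebra.norm (z : CMField a))) := by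
    rw [QuadraticAlgebra.algebraMap_norm_eq_mul_star]
    exact hz.mul hc
  have h' : IsIntegral ℤ (QuadraticAlgebra.norm (z : CMField a)) :=
    (isIntegral_algHom_iff (algebraMap F (CMField a)).toIntAlgHom
      (FaithfulSMul.algebraMap_injective F (CMField a))).1 h
  refine ⟨⟨_, h'⟩, fun s hs => ?_⟩
  have := sigmaPlus_re_mul_add_im_mul hs (z : CMField a) z
  rw [← Complex.normSq_eq_norm_sq, Complex.normSq_apply, this]
  simp [QuadraticAlgebra.norm_def, mul_assoc]

theorem realPoint_eq_sum_smul (σ : Fin (n + 1) → F →+* ℝ) {a : 𝓞 F}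
    (bK : Module.Basis (Fin (2 * (n + 1))) ℤ (CMIntegers a)) (w : Fin (2 * (n + 1)) → ℝ) :
    realPoint σ bK w = ∑ j, w j • vecSigma σ a (bK j) := by
  funext k
  simp [realPoint, vecSigma]

/-- A spanning family of the right size is a basis, and its coordinate map is continuous because the
dimension is finite. -/
theorem exists_coeff_bound {E : Type*} [NormedAddCommGroup E] [NormedSpace ℝ E] {m : ℕ}
    {v : Fin m → E} (hv : Submodule.span ℝ (Set.range v) = ⊤) (hm : Module.finrank ℝ E = m) :
    ∃ H : ℝ, 0 < H ∧ ∀ w : Fin m → ℝ, ∀ j, |w j| ≤ H * ‖∑ i, w i • v i‖ := by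
  have hli : LinearIndependent ℝ v :=
    linearIndependent_of_top_le_span_of_card_eq_finrank hv.ge (by rw [hm, Fintype.card_fin])
  let b := Module.Basis.mk hli hv.ge
  have : FiniteDimensional ℝ E := b.finiteDimensional_of_finite
  let f : E →L[ℝ] (Fin m → ℝ) := LinearMap.toContinuousLinearMap b.equivFun.toLinearMap
  refine ⟨‖f‖ + 1, by positivity, fun w j => ?_⟩
  have h1 : f (∑ i, w i • v i) = w := by
    have : ∑ i, w i • v i = b.equivFun.symm w := by simp [Module.Basis.equivFun_symm_apply, b]
    rw [this]
    exact b.equivFun.apply_symm_apply w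
  calc |w j| ≤ ‖w‖ := norm_le_pi_norm w j
    _ = ‖f (∑ i, w i • v i)‖ := by rw [h1]
    _ ≤ ‖f‖ * ‖∑ i, w i • v i‖ := f.le_opNorm _
    _ ≤ _ := by gcongr; linarith

/-! ### Traces, norms, and the real spans of the two lattices. -/

variable [NumberField F]

theorem exists_equiv_complex_embeddings (σ : Fin (n + 1) ≃ (F →+* ℝ))
    (bF : Module.Basis (Fin (n + 1)) ℤ (𝓞 F)) :
    ∃ e : Fin (n + 1) ≃ (F →ₐ[ℚ] ℂ), ∀ k x, e k x = (σ k x : ℂ) := by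
  let f : Fin (n + 1) → (F →ₐ[ℚ] ℂ) := fun k => (Complex.ofRealHom.comp (σ k)).toRatAlgHom
  have hf : ∀ k x, f k x = (σ k x : ℂ) := fun k x => rfl
  have h1 : Module.finrank ℚ F = n + 1 := by
    rw [← NumberField.RingOfIntegers.rank, Module.finrank_eq_card_basis bF, Fintype.card_fin]
  have hinj : Function.Injective f := by
    intro k l h
    refine σ.injective (RingHom.ext fun x => ?_)
    have := DFunLike.congr_fun h x
    rwa [hf, hf, Complex.ofReal_inj] at this
  refine ⟨Equiv.ofBijective f ((Fintype.bijective_iff_injective_and_card f).2 ⟨hinj, ?_⟩), hf⟩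
  rw [AlgHom.card, h1, Fintype.card_fin]

/-- The sum of the conjugates is the trace. -/
theorem exists_rat_eq_sum (σ : Fin (n + 1) ≃ (F →+* ℝ))
    (bF : Module.Basis (Fin (n + 1)) ℤ (𝓞 F)) (x : F) : ∃ q : ℚ, ∑ k, σ k x = q := by
  obtain ⟨e, he⟩ := exists_equiv_complex_embeddings σ bF
  refine ⟨Algebra.trace ℚ F x, ?_⟩
  have := trace_eq_sum_embeddings ℂ (K := ℚ) (x := x)
  rw [← e.sum_comp] at this
  simp only [he, eq_ratCast] at this
  exact_mod_cast this.symm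

/-- The product of the conjugates is the norm, a nonzero rational integer. -/
theorem one_le_prod_abs (σ : Fin (n + 1) ≃ (F →+* ℝ))
    (bF : Module.Basis (Fin (n + 1)) ℤ (𝓞 F)) {x : 𝓞 F} (hx : x ≠ 0) : 1 ≤ ∏ k, |σ k x| := by
  obtain ⟨e, he⟩ := exists_equiv_complex_embeddings σ bF
  have h := Algebra.norm_eq_prod_embeddings ℚ ℂ (x : F)
  rw [← e.prod_comp] at h
  simp only [he, eq_ratCast] at h
  have h2 : ((Algebra.norm ℚ (x : F) : ℚ) : ℝ) = ∏ k, σ k x := by exact_mod_cast h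
  rw [← Finset.abs_prod, ← h2]
  have h3 := Algebra.isIntegral_norm (R := ℤ) ℚ (x := (x : F)) x.2
  obtain ⟨m, hm⟩ := IsIntegrallyClosed.isIntegral_iff.1 h3
  have hm0 : m ≠ 0 := by
    rintro rfl
    rw [map_zero, eq_comm, Algebra.norm_eq_zero_iff] at hm
    exact hx (by exact_mod_cast hm)
  rw [← hm]
  simp only [eq_intCast, Rat.cast_intCast]
  exact_mod_cast Int.one_le_abs hm0

/-- A functional vanishing on all these vectors is a linear relation between the distinct characters
`σ k` of the monoid `𝓞 F`, and distinct characters are linearly independent. -/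
theorem span_real_embeddings (σ : Fin (n + 1) ≃ (F →+* ℝ)) :
    Submodule.span ℝ (Set.range fun (x : 𝓞 F) (k : Fin (n + 1)) => σ k x) = ⊤ := by
  by_contra h
  obtain ⟨f, hf, hS⟩ := Submodule.exists_le_ker_of_lt_top _ (lt_top_iff_ne_top.2 h)
  apply hf
  let χ : Fin (n + 1) → (𝓞 F →* ℝ) := fun k => ((σ k).comp (algebraMap (𝓞 F) F) : 𝓞 F →+* ℝ)
  have hχ : Function.Injective χ := by
    intro k l hkl
    refine σ.injective (IsLocalization.ringHom_ext (nonZeroDivisors (𝓞 F)) ?_)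
    exact RingHom.ext fun x => DFunLike.congr_fun hkl x
  have hli := (linearIndependent_monoidHom (𝓞 F) ℝ).comp χ hχ
  rw [Fintype.linearIndependent_iff] at hli
  have h0 := hli (fun k => f (Pi.single k 1)) <| by
    funext x
    have hx : f (fun k => σ k x) = 0 := hS (Submodule.subset_span ⟨x, rfl⟩)
    rw [f.pi_apply_eq_sum_univ] at hx
    simp only [Finset.sum_apply, Pi.smul_apply, smul_eq_mul, Function.comp_apply, Pi.zero_apply]
    rw [← hx]
    refine Finset.sum_congr rfl fun k _ => ?_
    have hk : (Pi.single k 1 : Fin (n + 1) → ℝ) = fun j => if k = j then 1 else 0 := by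
      funext j
      simp [Pi.single_apply, eq_comm]
    rw [smul_eq_mul, mul_comm, hk]
    rfl
  refine LinearMap.pi_ext' fun k => LinearMap.ext_ring ?_
  simpa using h0 k

/-- `ℤ_K` contains `ℤ_F` and `β ℤ_F`. By the previous span the first gives all real vectors and the
second all purely imaginary ones, the scaling by `√|σ_k(a)|` being invertible. -/
theorem span_vecSigma (σ : Fin (n + 1) ≃ (F →+* ℝ)) {a : 𝓞 F} (ha : ∀ k, σ k a < 0) :
    Submodule.span ℝ (Set.range (vecSigma σ a)) = ⊤ := by
  have hmem : ∀ z : CMField a, IsIntegral ℤ z →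
      (fun k => sigmaPlus (σ k) a z) ∈ Submodule.span ℝ (Set.range (vecSigma σ a)) :=
    fun z hz => Submodule.subset_span ⟨⟨z, hz⟩, rfl⟩
  have hint : ∀ x : 𝓞 F, IsIntegral ℤ (algebraMap F (CMField a) x) := fun x =>
    x.2.map (algebraMap F (CMField a)).toIntAlgHom
  have hβ : IsIntegral ℤ (⟨0, 1⟩ : CMField a) := by
    refine IsIntegral.of_pow two_pos ?_
    have : (⟨0, 1⟩ : CMField a) ^ 2 = algebraMap F (CMField a) a := by
      rw [pow_two]
      ext <;> simp
    rw [this]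
    exact hint a
  let L₁ : (Fin (n + 1) → ℝ) →ₗ[ℝ] (Fin (n + 1) → ℂ) :=
    LinearMap.pi fun k => LinearMap.toSpanSingleton ℝ ℂ 1 ∘ₗ LinearMap.proj k
  let L₂ : (Fin (n + 1) → ℝ) →ₗ[ℝ] (Fin (n + 1) → ℂ) := LinearMap.pi fun k =>
    LinearMap.toSpanSingleton ℝ ℂ (Complex.I * Real.sqrt |σ k a|) ∘ₗ LinearMap.proj k
  have hL₁ : ∀ v, L₁ v ∈ Submodule.span ℝ (Set.range (vecSigma σ a)) := by
    have : (⊤ : Submodule ℝ (Fin (n + 1) → ℝ)) ≤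
        (Submodule.span ℝ (Set.range (vecSigma σ a))).comap L₁ := by
      rw [← span_real_embeddings σ, Submodule.span_le]
      rintro _ ⟨x, rfl⟩
      have e : L₁ (fun k => σ k x) = fun k => sigmaPlus (σ k) a (algebraMap F (CMField a) x) := by
        funext k
        simp [L₁, sigmaPlus]
      change L₁ (fun k => σ k x) ∈ Submodule.span ℝ (Set.range (vecSigma σ a))
      rw [e]
      exact hmem _ (hint x)
    exact fun v => this Submodule.mem_top
  have hL₂ : ∀ v, L₂ v ∈ Submodule.span ℝ (Set.range (vecSigma σ a)) := by
    have : (⊤ : Submodule ℝ (Fin (n + 1) → ℝ)) ≤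
        (Submodule.span ℝ (Set.range (vecSigma σ a))).comap L₂ := by
      rw [← span_real_embeddings σ, Submodule.span_le]
      rintro _ ⟨x, rfl⟩
      have e : L₂ (fun k => σ k x) =
          fun k => sigmaPlus (σ k) a (algebraMap F (CMField a) x * ⟨0, 1⟩) := by
        funext k
        simp [L₂, sigmaPlus]
        ring
      change L₂ (fun k => σ k x) ∈ Submodule.span ℝ (Set.range (vecSigma σ a))
      rw [e]
      exact hmem _ ((hint x).mul hβ)
    exact fun v => this Submodule.mem_top
  rw [eq_top_iff]
  intro x _
  have hx : x = L₁ (fun k => (x k).re) + L₂ (fun k => (x k).im / Real.sqrt |σ k a|) := by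
    funext k
    have h : Real.sqrt |σ k a| ≠ 0 := (Real.sqrt_pos.2 (abs_pos.2 (ha k).ne)).ne'
    have h' : (Real.sqrt |σ k a| : ℂ) ≠ 0 := by exact_mod_cast h
    have : (((x k).im / Real.sqrt |σ k a| : ℝ) : ℂ) * (Complex.I * Real.sqrt |σ k a|) =
        (x k).im * Complex.I := by
      push_cast
      field_simp
    simp only [L₁, L₂, LinearMap.pi_apply, LinearMap.comp_apply, LinearMap.proj_apply,
      LinearMap.toSpanSingleton_apply, Pi.add_apply, Complex.real_smul, mul_one]
    rw [this, Complex.re_add_im]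
  rw [hx]
  exact add_mem (hL₁ _) (hL₂ _)

/-- One constant for both directions: the forward bound is the triangle inequality, the backward one
is `exists_coeff_bound`. -/
theorem exists_bound_realPoint (σ : Fin (n + 1) ≃ (F →+* ℝ)) {a : 𝓞 F} (ha : ∀ k, σ k a < 0)
    (bK : Module.Basis (Fin (2 * (n + 1))) ℤ (CMIntegers a)) :
    ∃ H : ℝ, 0 < H ∧ (∀ w B, (∀ j, |w j| ≤ B) → ∀ k, ‖realPoint σ bK w k‖ ≤ H * B) ∧
      (∀ w B, (∀ k, ‖realPoint σ bK w k‖ ≤ B) → ∀ j, |w j| ≤ H * B) ∧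
      ∀ x, ∃ w, realPoint σ bK w = x := by
  have hspan : Submodule.span ℝ (Set.range fun j => vecSigma σ a (bK j)) = ⊤ := by
    rw [eq_top_iff, ← span_vecSigma σ ha, Submodule.span_le]
    rintro _ ⟨z, rfl⟩
    have : vecSigma σ a z = ∑ j, (bK.repr z j : ℝ) • vecSigma σ a (bK j) := by
      rw [← realPoint_eq_sum_smul]
      funext k
      rw [← sigmaPlus_ofCoords, ofCoords_repr]
      rfl
    rw [this]
    exact sum_mem fun j _ => Submodule.smul_mem _ _ (Submodule.subset_span ⟨j, rfl⟩)
  obtain ⟨H, hH, h⟩ := exists_coeff_bound hspan (by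
    rw [Module.finrank_pi_fintype]
    simp [Complex.finrank_real_complex, mul_comm])
  refine ⟨H + ∑ k, ∑ j, ‖sigmaPlus (σ k) a (bK j)‖, by positivity, fun w B hw k => ?_,
    fun w B hw j => ?_, fun x => ?_⟩
  · have hB : 0 ≤ B := (abs_nonneg (w 0)).trans (hw 0)
    calc ‖realPoint σ bK w k‖ ≤ ∑ j, ‖(w j : ℂ) * sigmaPlus (σ k) a (bK j)‖ := norm_sum_le _ _
      _ ≤ ∑ j, ‖sigmaPlus (σ k) a (bK j)‖ * B := by
          refine Finset.sum_le_sum fun j _ => ?_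
          rw [norm_mul, mul_comm, Complex.norm_real]
          gcongr
          exact hw j
      _ = (∑ j, ‖sigmaPlus (σ k) a (bK j)‖) * B := by rw [Finset.sum_mul]
      _ ≤ _ := by
          gcongr
          have := Finset.single_le_sum (f := fun k => ∑ j, ‖sigmaPlus (σ k) a (bK j)‖)
            (fun k _ => by positivity) (Finset.mem_univ k)
          linarith
  · have hB : 0 ≤ B := (norm_nonneg _).trans (hw 0)
    refine (h w j).trans ?_
    rw [← realPoint_eq_sum_smul]
    have h1 : ‖realPoint σ bK w‖ ≤ B := (pi_norm_le_iff_of_nonneg hB).2 hw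
    have h2 : 0 ≤ ∑ k, ∑ j, ‖sigmaPlus (σ k) a (bK j)‖ := by positivity
    gcongr
    linarith
  · simp only [realPoint_eq_sum_smul]
    exact (Submodule.mem_span_range_iff_exists_fun ℝ).1 (hspan ▸ Submodule.mem_top)

theorem exists_bound_repr (σ : Fin (n + 1) ≃ (F →+* ℝ))
    (bF : Module.Basis (Fin (n + 1)) ℤ (𝓞 F)) :
    ∃ H : ℝ, 0 < H ∧ ∀ (r : 𝓞 F) B, (∀ k, |σ k r| ≤ B) → ∀ j, |(bF.repr r j : ℝ)| ≤ H * B := by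
  have hr : ∀ (r : 𝓞 F), (fun k => σ k r) = ∑ j, (bF.repr r j : ℝ) • fun k => σ k (bF j) := by
    intro r
    funext k
    let f : 𝓞 F →+* ℝ := (σ k).comp (algebraMap (𝓞 F) F)
    have h := congrArg f (bF.sum_repr r)
    rw [map_sum] at h
    simp only [zsmul_eq_mul, map_mul, map_intCast] at h
    simp only [Finset.sum_apply, Pi.smul_apply, smul_eq_mul]
    exact h.symm
  have hspan : Submodule.span ℝ (Set.range fun j (k : Fin (n + 1)) => σ k (bF j)) = ⊤ := by
    rw [eq_top_iff, ← span_real_embeddings σ, Submodule.span_le]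
    rintro _ ⟨r, rfl⟩
    change (fun k => σ k r) ∈ Submodule.span ℝ (Set.range fun j (k : Fin (n + 1)) => σ k (bF j))
    rw [hr]
    exact sum_mem fun j _ => Submodule.smul_mem _ _ (Submodule.subset_span ⟨j, rfl⟩)
  obtain ⟨H, hH, h⟩ := exists_coeff_bound hspan (by simp)
  refine ⟨H, hH, fun r B hB j => (h (fun j => (bF.repr r j : ℝ)) j).trans ?_⟩
  rw [← hr]
  gcongr
  exact (pi_norm_le_iff_of_nonneg ((abs_nonneg _).trans (hB 0))).2 hB

/-- The coordinates of a point of `ℂ^d` in the basis of `ℤ_K` are rational combinations of its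
inner products with the basis. -/
theorem exists_gram_inverse (σ : Fin (n + 1) ≃ (F →+* ℝ)) {a : 𝓞 F} (ha : ∀ k, σ k a < 0)
    (bF : Module.Basis (Fin (n + 1)) ℤ (𝓞 F))
    (bK : Module.Basis (Fin (2 * (n + 1))) ℤ (CMIntegers a)) :
    ∃ (N : ℤ) (G : Fin (2 * (n + 1)) → Fin (2 * (n + 1)) → ℤ), 0 < N ∧ ∀ w j, (N : ℝ) * w j =
      ∑ i, (G j i : ℝ) * ∑ k, ((sigmaPlus (σ k) a (bK i)).re * (realPoint σ bK w k).re +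
        (sigmaPlus (σ k) a (bK i)).im * (realPoint σ bK w k).im) := by
  have hq : ∀ i l : Fin (2 * (n + 1)), ∃ q : ℚ, ∑ k, ((sigmaPlus (σ k) a (bK i)).re *
      (sigmaPlus (σ k) a (bK l)).re + (sigmaPlus (σ k) a (bK i)).im *
      (sigmaPlus (σ k) a (bK l)).im) = q := by
    intro i l
    simp only [sigmaPlus_re_mul_add_im_mul (ha _)]
    exact exists_rat_eq_sum σ bF _
  choose Q hQ using hq
  have hre : ∀ w k, (realPoint σ bK w k).re = ∑ l, w l * (sigmaPlus (σ k) a (bK l)).re := by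
    intro w k
    simp [realPoint]
  have him : ∀ w k, (realPoint σ bK w k).im = ∑ l, w l * (sigmaPlus (σ k) a (bK l)).im := by
    intro w k
    simp [realPoint]
  have hmul : ∀ (w : Fin (2 * (n + 1)) → ℝ) i, ∑ k, ((sigmaPlus (σ k) a (bK i)).re *
      (realPoint σ bK w k).re + (sigmaPlus (σ k) a (bK i)).im * (realPoint σ bK w k).im) =
      ((Matrix.of Q).map ((↑) : ℚ → ℝ)).mulVec w i := by
    intro w i
    simp only [Matrix.mulVec, dotProduct, Matrix.map_apply, Matrix.of_apply, ← hQ, hre, him,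
      Finset.mul_sum, Finset.sum_mul, ← Finset.sum_add_distrib]
    rw [Finset.sum_comm]
    refine Finset.sum_congr rfl fun l _ => Finset.sum_congr rfl fun k _ => ?_
    ring
  obtain ⟨H, hH, -, hb, -⟩ := exists_bound_realPoint σ ha bK
  -- The Gram matrix is positive definite: a kernel vector `w` gives a point of length zero, so `w =
  -- 0` by the coordinate bound.
  have hdet : (Matrix.of Q).det ≠ 0 := by
    intro h0
    have h1 : ((Matrix.of Q).map ((↑) : ℚ → ℝ)).det = 0 := by
      have := RingHom.map_det (Rat.castHom ℝ) (Matrix.of Q)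
      rw [h0, map_zero] at this
      exact this.symm
    obtain ⟨w, hw, hw0⟩ := Matrix.exists_mulVec_eq_zero_iff.2 h1
    have h2 : ∑ k, ((realPoint σ bK w k).re ^ 2 + (realPoint σ bK w k).im ^ 2) = 0 := by
      calc _ = ∑ i, w i * ∑ k, ((sigmaPlus (σ k) a (bK i)).re *
            (realPoint σ bK w k).re + (sigmaPlus (σ k) a (bK i)).im * (realPoint σ bK w k).im) := by
            simp only [Finset.mul_sum]
            rw [Finset.sum_comm]
            refine Finset.sum_congr rfl fun k _ => ?_
            calc _ = (∑ l, w l * (sigmaPlus (σ k) a (bK l)).re) * (realPoint σ bK w k).re +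
                  (∑ l, w l * (sigmaPlus (σ k) a (bK l)).im) * (realPoint σ bK w k).im := by
                  rw [← hre, ← him, pow_two, pow_two]
              _ = _ := ?_
            rw [Finset.sum_mul, Finset.sum_mul, ← Finset.sum_add_distrib]
            refine Finset.sum_congr rfl fun l _ => ?_
            ring
        _ = 0 := by simp [hmul, hw0]
    rw [Finset.sum_eq_zero_iff_of_nonneg fun k _ => by positivity] at h2
    refine hw (funext fun j => ?_)
    have h3 : ∀ k, ‖realPoint σ bK w k‖ ≤ 0 := by
      intro k
      have h4 := h2 k (Finset.mem_univ k)
      have h5 : (realPoint σ bK w k).re = 0 := by nlinarith [sq_nonneg (realPoint σ bK w k).im]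
      have h6 : (realPoint σ bK w k).im = 0 := by nlinarith [sq_nonneg (realPoint σ bK w k).re]
      rw [Complex.ext (z := realPoint σ bK w k) (w := 0) h5 h6, norm_zero]
    have := hb w 0 h3 j
    rw [mul_zero] at this
    simpa using this
  have hunit : IsUnit (Matrix.of Q).det := isUnit_iff_ne_zero.2 hdet
  obtain ⟨⟨N, hN⟩, hNG⟩ := IsLocalization.exist_integer_multiples_of_finite (nonZeroDivisors ℤ)
    fun p : Fin (2 * (n + 1)) × Fin (2 * (n + 1)) => (Matrix.of Q)⁻¹ p.1 p.2
  choose G hG using hNG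
  have hN0 : N ≠ 0 := nonZeroDivisors.ne_zero hN
  -- The common denominator of the inverse may be negative; its sign is moved into the matrix.
  refine ⟨|N|, fun j i => N.sign * G (j, i), abs_pos.2 hN0, fun w j => ?_⟩
  have hG' : ∀ j i, ((|N| : ℤ) : ℝ) * (((Matrix.of Q)⁻¹ j i : ℚ) : ℝ) =
      ((N.sign * G (j, i) : ℤ) : ℝ) := by
    intro j i
    have h := hG (j, i)
    simp only [eq_intCast, zsmul_eq_mul] at h
    have h' : ((G (j, i) : ℤ) : ℝ) = (N : ℝ) * (((Matrix.of Q)⁻¹ j i : ℚ) : ℝ) := by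
      exact_mod_cast h
    rw [← Int.sign_mul_self_eq_abs]
    push_cast
    rw [h']
    ring
  simp only [hmul, ← hG']
  have h8 : ((Matrix.of Q)⁻¹.map ((↑) : ℚ → ℝ)).mulVec
      (((Matrix.of Q).map ((↑) : ℚ → ℝ)).mulVec w) = w := by
    have h9 : ((Matrix.of Q)⁻¹.map ((↑) : ℚ → ℝ)) * ((Matrix.of Q).map ((↑) : ℚ → ℝ)) = 1 := by
      have := congrArg (fun M : Matrix _ _ ℚ => M.map (Rat.castHom ℝ))
        (Matrix.nonsing_inv_mul (Matrix.of Q) hunit)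
      simp only [Matrix.map_mul] at this
      rw [Matrix.map_one _ (map_zero _) (map_one _)] at this
      exact this
    rw [Matrix.mulVec_mulVec, h9, Matrix.one_mulVec]
  conv_lhs => rw [← h8]
  rw [Matrix.mulVec, dotProduct, Finset.mul_sum]
  refine Finset.sum_congr rfl fun i _ => ?_
  rw [Matrix.map_apply, mul_assoc]

end Lattice
end RandomIntegerPoint
end

noncomputable section
namespace RandomIntegerPoint

/-! ### Error estimates -/

section Approximation

variable {F : Type*} [Field F] {n : ℕ}

theorem abs_fdiv_sub_div_le {b : ℤ} (hb : 0 < b) (a : ℤ) : |(a.fdiv b : ℝ) - a / b| ≤ 1 := by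
  rw [Int.fdiv_eq_ediv_of_nonneg _ hb.le]
  have hb' : (0 : ℝ) < b := by exact_mod_cast hb
  have h1 : ((b * (a / b) : ℤ) : ℝ) ≤ a := by exact_mod_cast Int.mul_ediv_self_le hb.ne'
  have h2 : (a : ℝ) < ((b * (a / b) + b : ℤ) : ℝ) := by
    exact_mod_cast Int.lt_mul_ediv_self_add hb
  push_cast at h1 h2
  rw [abs_le]
  constructor
  · rw [neg_le_sub_iff_le_add, div_le_iff₀ hb']
    linarith
  · rw [tsub_le_iff_right, ← sub_le_iff_le_add', le_div_iff₀ hb']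
    linarith

/-- `e` gives approximations of the real numbers on offer with the scaling factor `P ^ 8`. -/
def IsApprox (σ : Fin (n + 1) → F →+* ℝ) {a : 𝓞 F} (bF : Module.Basis (Fin (n + 1)) ℤ (𝓞 F))
    (bK : Module.Basis (Fin (2 * (n + 1))) ℤ (CMIntegers a)) (φ ε : ℝ) (e : RealName n → ℤ)
    (P : ℤ) : Prop :=
  ∀ q, |(e q : ℝ) - P ^ 8 * q.value σ bF bK φ ε| ≤ 1

/-- The integer coordinates of a lattice point near `(X + i y) e^{-iφ/2}` in the first complex
coordinate and near `0` in the others, computed from approximations `e`. -/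
def coord (N : ℤ) (G : Fin (2 * (n + 1)) → Fin (2 * (n + 1)) → ℤ) (e : RealName n → ℤ)
    (P X y : ℤ) (j : Fin (2 * (n + 1))) : ℤ :=
  (∑ i, G j i * (e (.embRe 0 i) * (X * e .cosHalf + y * e .sinHalf) +
    e (.embIm 0 i) * (y * e .cosHalf - X * e .sinHalf))).fdiv (N * P ^ 16)

/-- An approximation of `σ_k(r) - |σ_{k,+}(z)|²`, scaled by `P ^ 16`, for `r` and `z` with the
coordinates `c` and `w`. -/
def slack (e : RealName n → ℤ) (P : ℤ) (c : Fin (n + 1) → ℤ) (w : Fin (2 * (n + 1)) → ℤ)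
    (k : Fin (n + 1)) : ℤ :=
  P ^ 8 * ∑ j, c j * e (.embF k j) -
    ((∑ j, w j * e (.embRe k j)) * (∑ j, w j * e (.embRe k j)) +
      (∑ j, w j * e (.embIm k j)) * (∑ j, w j * e (.embIm k j)))

/-- An approximation of `σ₁(r)`. -/
def normApprox (e : RealName n → ℤ) (P : ℤ) (c : Fin (n + 1) → ℤ) : ℤ :=
  (∑ j, c j * e (.embF 0 j)).fdiv (P ^ 8)

/-- The point `(X + i y) e^{-iφ/2}` in the first complex coordinate. -/
def target (φ X y : ℝ) (k : Fin (n + 1)) : ℂ :=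
  if k = 0 then (X + y * Complex.I) * Complex.exp (-(Complex.I * φ / 2)) else 0

theorem exp_eq_cos_sub_sin (φ : ℝ) : Complex.exp (-(Complex.I * φ / 2)) =
    (Real.cos (φ / 2) : ℂ) - (Real.sin (φ / 2) : ℂ) * Complex.I := by
  rw [show -(Complex.I * φ / 2) = ((-(φ / 2) : ℝ) : ℂ) * Complex.I by push_cast; ring,
    Complex.exp_mul_I, ← Complex.ofReal_cos, ← Complex.ofReal_sin, Real.cos_neg, Real.sin_neg]
  push_cast
  ring

theorem target_zero_re (φ X y : ℝ) : (target (n := n) φ X y 0).re =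
    X * Real.cos (φ / 2) + y * Real.sin (φ / 2) := by
  rw [target, if_pos rfl, exp_eq_cos_sub_sin]
  generalize Real.cos (φ / 2) = c
  generalize Real.sin (φ / 2) = s
  simp

theorem target_zero_im (φ X y : ℝ) : (target (n := n) φ X y 0).im =
    y * Real.cos (φ / 2) - X * Real.sin (φ / 2) := by
  rw [target, if_pos rfl, exp_eq_cos_sub_sin]
  generalize Real.cos (φ / 2) = c
  generalize Real.sin (φ / 2) = s
  simp
  ring

theorem exists_bound_basis (σ : Fin (n + 1) → F →+* ℝ) {a : 𝓞 F}
    (bK : Module.Basis (Fin (2 * (n + 1))) ℤ (CMIntegers a)) : ∃ H : ℝ, 0 ≤ H ∧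
    ∀ k j, |(sigmaPlus (σ k) a (bK j)).re| ≤ H ∧ |(sigmaPlus (σ k) a (bK j)).im| ≤ H := by
  obtain ⟨H, hH⟩ := (Set.finite_range fun p : Fin (n + 1) × Fin (2 * (n + 1)) =>
    ‖sigmaPlus (σ p.1) a (bK p.2)‖).bddAbove
  have hH' : ∀ k j, ‖sigmaPlus (σ k) a (bK j)‖ ≤ H := fun k j => hH ⟨(k, j), rfl⟩
  exact ⟨H, (norm_nonneg _).trans (hH' 0 0), fun k j =>
    ⟨(Complex.abs_re_le_norm _).trans (hH' k j), (Complex.abs_im_le_norm _).trans (hH' k j)⟩⟩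

/-- The product is scaled by `Q ^ 2` but its error only by `Q`; dividing by `Q ^ 2` therefore leaves
an error of order `Y / Q`. -/
theorem abs_mul_sub_mul_le {x x' y y' Q H Y : ℝ} (hQ : 1 ≤ Q) (hH : 0 ≤ H)
    (hx : |x - Q * x'| ≤ 1) (hx' : |x'| ≤ H) (hy : |y - Q * y'| ≤ Y) (hy' : |y'| ≤ Y) :
    |x * y - Q ^ 2 * (x' * y')| ≤ Q * ((H + 2) * Y) := by
  have hY : 0 ≤ Y := (abs_nonneg _).trans hy'
  have hQ0 : 0 ≤ Q := by linarith
  have h1 : |x| ≤ Q * H + 1 := by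
    have h2 : |Q * x'| ≤ Q * H := by
      rw [abs_mul, abs_of_nonneg hQ0]
      gcongr
    have := abs_add_le (x - Q * x') (Q * x')
    rw [sub_add_cancel] at this
    linarith
  calc |x * y - Q ^ 2 * (x' * y')| = |x * (y - Q * y') + (x - Q * x') * (Q * y')| := by ring_nf
    _ ≤ |x| * |y - Q * y'| + |x - Q * x'| * (|Q| * |y'|) := by
        rw [← abs_mul, ← abs_mul, ← abs_mul]
        exact abs_add_le _ _
    _ ≤ (Q * H + 1) * Y + 1 * (Q * Y) := by
        rw [abs_of_nonneg hQ0]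
        gcongr
    _ ≤ _ := by nlinarith

/-- Of the error `2`, one unit comes from rounding the quotient down and one from the
approximations, whose effect is of order `(|X| + |y|) / P ^ 8`. -/
theorem exists_abs_coord_sub_le (σ : Fin (n + 1) → F →+* ℝ) {a : 𝓞 F}
    (bF : Module.Basis (Fin (n + 1)) ℤ (𝓞 F))
    (bK : Module.Basis (Fin (2 * (n + 1))) ℤ (CMIntegers a)) {N : ℤ} (hN : 0 < N)
    {G : Fin (2 * (n + 1)) → Fin (2 * (n + 1)) → ℤ}
    (hG : ∀ w j, (N : ℝ) * w j =
      ∑ i, (G j i : ℝ) * ∑ k, ((sigmaPlus (σ k) a (bK i)).re * (realPoint σ bK w k).re +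
        (sigmaPlus (σ k) a (bK i)).im * (realPoint σ bK w k).im)) :
    ∃ Γ : ℝ, 0 < Γ ∧ ∀ (φ ε : ℝ) (e : RealName n → ℤ) (P X y : ℤ) (w : Fin (2 * (n + 1)) → ℝ),
      1 ≤ P → IsApprox σ bF bK φ ε e P → realPoint σ bK w = target φ X y →
      Γ * (|(X : ℝ)| + |(y : ℝ)|) ≤ P ^ 8 → ∀ j, |(coord N G e P X y j : ℝ) - w j| ≤ 2 := by
  obtain ⟨H, hH, hb⟩ := exists_bound_basis σ bK
  refine ⟨1 + ∑ j, ∑ i, |(G j i : ℝ)| * (2 * (H + 2)), by positivity, ?_⟩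
  intro φ ε e P X y w hP he hw hΓ j
  have hP' : (1 : ℝ) ≤ P := by exact_mod_cast hP
  have hN' : (1 : ℝ) ≤ N := by exact_mod_cast hN
  have hQ : (1 : ℝ) ≤ (P : ℝ) ^ 8 := one_le_pow₀ hP'
  set Q : ℝ := (P : ℝ) ^ 8 with hQdef
  set Y : ℝ := |(X : ℝ)| + |(y : ℝ)| with hY
  have hc : |(e .cosHalf : ℝ) - Q * Real.cos (φ / 2)| ≤ 1 := he .cosHalf
  have hs : |(e .sinHalf : ℝ) - Q * Real.sin (φ / 2)| ≤ 1 := he .sinHalf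
  set U := X * Real.cos (φ / 2) + y * Real.sin (φ / 2) with hU
  set V := y * Real.cos (φ / 2) - X * Real.sin (φ / 2) with hV
  have hlin : ∀ s t x y' : ℝ, |s| ≤ 1 → |t| ≤ 1 → |x * s + y' * t| ≤ |x| + |y'| := by
    intro s t x y' hs ht
    refine (abs_add_le _ _).trans ?_
    rw [abs_mul, abs_mul]
    gcongr
    · exact mul_le_of_le_one_right (abs_nonneg _) hs
    · exact mul_le_of_le_one_right (abs_nonneg _) ht
  have hU' : |U| ≤ Y := hlin _ _ _ _ (Real.abs_cos_le_one _) (Real.abs_sin_le_one _)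
  have hV' : |V| ≤ Y := by
    have := hlin (Real.cos (φ / 2)) (Real.sin (φ / 2)) y (-X) (Real.abs_cos_le_one _)
      (Real.abs_sin_le_one _)
    rw [abs_neg] at this
    rw [hV, hY, add_comm |(X : ℝ)|]
    convert this using 2
    ring
  have hA : |((X * e .cosHalf + y * e .sinHalf : ℤ) : ℝ) - Q * U| ≤ Y := by
    have := hlin _ _ (X : ℝ) (y : ℝ) hc hs
    convert this using 2
    push_cast
    rw [hU]
    ring
  have hB : |((y * e .cosHalf - X * e .sinHalf : ℤ) : ℝ) - Q * V| ≤ Y := by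
    have := hlin _ _ (y : ℝ) (-X : ℝ) hc hs
    rw [abs_neg] at this
    rw [hY, add_comm |(X : ℝ)|]
    convert this using 2
    push_cast
    rw [hV]
    ring
  -- The target vanishes outside the first complex coordinate, so only `k = 0` contributes to the
  -- inner products; this is why `coord` uses only the first embedding.
  have hNw : (N : ℝ) * w j = ∑ i, (G j i : ℝ) * ((sigmaPlus (σ 0) a (bK i)).re * U +
      (sigmaPlus (σ 0) a (bK i)).im * V) := by
    rw [hG w j]
    refine Finset.sum_congr rfl fun i _ => ?_
    congr 1
    rw [Finset.sum_eq_single 0, hw, target_zero_re, target_zero_im]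
    · intro k _ hk
      rw [hw, target, if_neg hk]
      simp
    · simp
  set S : ℤ := ∑ i, G j i * (e (.embRe 0 i) * (X * e .cosHalf + y * e .sinHalf) +
    e (.embIm 0 i) * (y * e .cosHalf - X * e .sinHalf)) with hS
  have hSw : |(S : ℝ) - Q ^ 2 * (N * w j)| ≤ Q * (∑ i, |(G j i : ℝ)| * (2 * (H + 2))) * Y := by
    rw [hNw, hS, Finset.mul_sum]
    push_cast
    rw [← Finset.sum_sub_distrib, Finset.mul_sum, Finset.sum_mul]
    refine (Finset.abs_sum_le_sum_abs _ _).trans (Finset.sum_le_sum fun i _ => ?_)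
    have h1 := abs_mul_sub_mul_le hQ hH (he (.embRe 0 i)) (hb 0 i).1 hA hU'
    have h2 := abs_mul_sub_mul_le hQ hH (he (.embIm 0 i)) (hb 0 i).2 hB hV'
    push_cast at h1 h2
    have h3 := abs_add_le _ _ |>.trans (add_le_add h1 h2)
    rw [show ∀ g x y x' y' : ℝ, g * (x + y) - Q ^ 2 * (g * (x' + y')) =
      g * ((x - Q ^ 2 * x') + (y - Q ^ 2 * y')) from fun g x y x' y' => by ring, abs_mul]
    calc _ ≤ |(G j i : ℝ)| * (Q * ((H + 2) * Y) + Q * ((H + 2) * Y)) := by gcongr; exact h3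
      _ = _ := by ring
  have hle : (∑ i, |(G j i : ℝ)| * (2 * (H + 2))) * Y ≤ Q := by
    refine le_trans ?_ hΓ
    gcongr
    have := Finset.single_le_sum (f := fun j => ∑ i, |(G j i : ℝ)| * (2 * (H + 2)))
      (fun j _ => by positivity) (Finset.mem_univ j)
    linarith
  have hd := abs_fdiv_sub_div_le (b := N * P ^ 16) (by positivity) S
  have hd2 : |(S : ℝ) / ((N * P ^ 16 : ℤ) : ℝ) - w j| ≤ 1 := by
    have hpos : (0 : ℝ) < ((N * P ^ 16 : ℤ) : ℝ) := by push_cast; positivity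
    have hQ16 : ((N * P ^ 16 : ℤ) : ℝ) = N * Q ^ 2 := by rw [hQdef]; push_cast; ring
    rw [div_sub' hpos.ne', abs_div, abs_of_pos hpos, div_le_one hpos, hQ16]
    calc |(S : ℝ) - N * Q ^ 2 * w j| = |(S : ℝ) - Q ^ 2 * (N * w j)| := by ring_nf
      _ ≤ Q * (∑ i, |(G j i : ℝ)| * (2 * (H + 2))) * Y := hSw
      _ = Q * ((∑ i, |(G j i : ℝ)| * (2 * (H + 2))) * Y) := by ring
      _ ≤ Q * Q := by gcongr
      _ ≤ _ := by nlinarith [sq_nonneg Q]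
  have := abs_add_le _ _ |>.trans (add_le_add hd hd2)
  rw [sub_add_sub_cancel] at this
  refine le_trans this (by norm_num)

/-- The hypotheses allow `r` coordinates of size `Y ^ 2` because `r` is compared with the square of
the size of `z`. Relative to the scale `P ^ 16` the error is of order `Y ^ 2 / P ^ 8`. -/
theorem exists_abs_slack_sub_le (σ : Fin (n + 1) → F →+* ℝ) {a : 𝓞 F}
    (bF : Module.Basis (Fin (n + 1)) ℤ (𝓞 F))
    (bK : Module.Basis (Fin (2 * (n + 1))) ℤ (CMIntegers a)) :
    ∃ Λ : ℝ, 0 < Λ ∧ ∀ (φ ε : ℝ) (r : 𝓞 F) (e : RealName n → ℤ) (P : ℤ)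
      (w : Fin (2 * (n + 1)) → ℤ) (Y : ℝ), 1 ≤ P → IsApprox σ bF bK φ ε e P →
      (∀ j, |(bF.repr r j : ℝ)| ≤ Y ^ 2) → (∀ j, |(w j : ℝ)| ≤ Y) → ∀ k,
      |(slack e P (bF.repr r) w k : ℝ) -
        P ^ 16 * (σ k r - ‖sigmaPlus (σ k) a (ofCoords bK w)‖ ^ 2)| ≤ P ^ 8 * (Λ * Y ^ 2) := by
  obtain ⟨H, hH, hb⟩ := exists_bound_basis σ bK
  set m : ℝ := 2 * (n + 1) with hm
  refine ⟨(n + 1) + 2 * (m ^ 2 * (1 + 2 * H)), by positivity, ?_⟩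
  intro φ ε r e P w Y hP he hr hw k
  have hP' : (1 : ℝ) ≤ P := by exact_mod_cast hP
  have hQ : (1 : ℝ) ≤ (P : ℝ) ^ 8 := one_le_pow₀ hP'
  rw [show (P : ℝ) ^ 16 = ((P : ℝ) ^ 8) ^ 2 by ring]
  have hval : ∀ q : RealName n, |(e q : ℝ) - (P : ℝ) ^ 8 * q.value σ bF bK φ ε| ≤ 1 := he
  set Q : ℝ := (P : ℝ) ^ 8 with hQdef
  have hY : 0 ≤ Y := (abs_nonneg _).trans (hw 0)
  have hsq : ∀ x x' : ℝ, |x - Q * x'| ≤ m * Y → |x'| ≤ m * H * Y →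
      |x * x - Q ^ 2 * (x' * x')| ≤ Q * (m ^ 2 * (1 + 2 * H)) * Y ^ 2 := by
    intro x x' h1 h2
    have hm0 : 0 ≤ m := by positivity
    have h3 : |x + Q * x'| ≤ m * Y + 2 * (Q * (m * H * Y)) := by
      have h4 : |2 * (Q * x')| ≤ 2 * (Q * (m * H * Y)) := by
        rw [abs_mul, abs_mul, abs_of_pos (by linarith : 0 < Q), abs_two]
        gcongr
      have := (abs_add_le (x - Q * x') (2 * (Q * x'))).trans (add_le_add h1 h4)
      rwa [show x - Q * x' + 2 * (Q * x') = x + Q * x' by ring] at this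
    calc |x * x - Q ^ 2 * (x' * x')| = |x - Q * x'| * |x + Q * x'| := by
          rw [← abs_mul]; congr 1; ring
      _ ≤ (m * Y) * (m * Y + 2 * (Q * (m * H * Y))) := by gcongr
      _ = m ^ 2 * Y ^ 2 * 1 + Q * (m ^ 2 * (2 * H)) * Y ^ 2 := by ring
      _ ≤ m ^ 2 * Y ^ 2 * Q + Q * (m ^ 2 * (2 * H)) * Y ^ 2 := by gcongr
      _ = _ := by ring
  have hsum : ∀ (x : Fin (2 * (n + 1)) → ℤ) (x' : Fin (2 * (n + 1)) → ℝ),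
      (∀ j, |(x j : ℝ) - Q * x' j| ≤ 1) → (∀ j, |x' j| ≤ H) →
      |((∑ j, w j * x j : ℤ) : ℝ) * ((∑ j, w j * x j : ℤ) : ℝ) -
        Q ^ 2 * ((∑ j, (w j : ℝ) * x' j) * (∑ j, (w j : ℝ) * x' j))| ≤
        Q * (m ^ 2 * (1 + 2 * H)) * Y ^ 2 := by
    intro x x' h1 h2
    apply hsq
    · push_cast
      rw [Finset.mul_sum, ← Finset.sum_sub_distrib]
      calc _ ≤ ∑ j, |(w j : ℝ) * x j - Q * (w j * x' j)| := Finset.abs_sum_le_sum_abs _ _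
        _ ≤ ∑ _j : Fin (2 * (n + 1)), Y := by
            refine Finset.sum_le_sum fun j _ => ?_
            rw [show (w j : ℝ) * x j - Q * (w j * x' j) = w j * (x j - Q * x' j) by ring, abs_mul]
            calc |(w j : ℝ)| * |(x j : ℝ) - Q * x' j| ≤ Y * 1 := by
                  gcongr
                  · exact hw j
                  · exact h1 j
              _ = Y := mul_one Y
        _ = m * Y := by simp [hm]
    · calc _ ≤ ∑ j, |(w j : ℝ) * x' j| := Finset.abs_sum_le_sum_abs _ _
        _ ≤ ∑ _j : Fin (2 * (n + 1)), Y * H := by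
            refine Finset.sum_le_sum fun j _ => ?_
            rw [abs_mul]
            gcongr
            · exact hw j
            · exact h2 j
        _ = m * H * Y := by
            simp only [Finset.sum_const, Finset.card_univ, Fintype.card_fin, nsmul_eq_mul, hm]
            push_cast
            ring
  have h1 := hsum _ _ (fun j => hval (.embRe k j)) fun j => (hb k j).1
  have h2 := hsum _ _ (fun j => hval (.embIm k j)) fun j => (hb k j).2
  have h3 : |Q * ((∑ j, bF.repr r j * e (.embF k j) : ℤ) : ℝ) - Q ^ 2 * σ k r| ≤
      Q * ((n + 1) * Y ^ 2) := by
    have hr' : σ k r = ∑ j, (bF.repr r j : ℝ) * σ k (bF j) := by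
      let f : 𝓞 F →+* ℝ := (σ k).comp (algebraMap (𝓞 F) F)
      have h := congrArg f (bF.sum_repr r)
      rw [map_sum] at h
      simp only [zsmul_eq_mul, map_mul, map_intCast] at h
      exact h.symm
    rw [hr', pow_two, mul_assoc, ← mul_sub, abs_mul, abs_of_pos (by linarith : 0 < Q)]
    gcongr
    push_cast
    rw [Finset.mul_sum, ← Finset.sum_sub_distrib]
    calc _ ≤ ∑ j, |(bF.repr r j : ℝ) * e (.embF k j) - Q * (bF.repr r j * σ k (bF j))| :=
          Finset.abs_sum_le_sum_abs _ _
      _ ≤ ∑ _j : Fin (n + 1), Y ^ 2 := by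
          refine Finset.sum_le_sum fun j _ => ?_
          rw [show (bF.repr r j : ℝ) * e (.embF k j) - Q * (bF.repr r j * σ k (bF j)) =
            bF.repr r j * (e (.embF k j) - Q * σ k (bF j)) by ring, abs_mul]
          calc |(bF.repr r j : ℝ)| * |(e (.embF k j) : ℝ) - Q * σ k (bF j)| ≤ Y ^ 2 * 1 := by
                gcongr
                · exact hr j
                · exact hval (.embF k j)
            _ = Y ^ 2 := mul_one _
      _ = _ := by simp
  have hz : ‖sigmaPlus (σ k) a (ofCoords bK w)‖ ^ 2 =
      (∑ j, (w j : ℝ) * (sigmaPlus (σ k) a (bK j)).re) *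
        (∑ j, (w j : ℝ) * (sigmaPlus (σ k) a (bK j)).re) +
      (∑ j, (w j : ℝ) * (sigmaPlus (σ k) a (bK j)).im) *
        (∑ j, (w j : ℝ) * (sigmaPlus (σ k) a (bK j)).im) := by
    rw [← Complex.normSq_eq_norm_sq, Complex.normSq_apply, sigmaPlus_ofCoords]
    simp [realPoint]
  have hsl : (slack e P (bF.repr r) w k : ℝ) = Q * ((∑ j, bF.repr r j * e (.embF k j) : ℤ) : ℝ) -
      (((∑ j, w j * e (.embRe k j) : ℤ) : ℝ) * ((∑ j, w j * e (.embRe k j) : ℤ) : ℝ) +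
      ((∑ j, w j * e (.embIm k j) : ℤ) : ℝ) * ((∑ j, w j * e (.embIm k j) : ℤ) : ℝ)) := by
    rw [slack, hQdef]
    push_cast
    ring
  rw [hz, hsl]
  simp only [RealName.value] at h1 h2
  rw [abs_le] at h1 h2 h3 ⊢
  constructor <;> nlinarith [h1.1, h1.2, h2.1, h2.2, h3.1, h3.2]

end Approximation

/-! ### A nonzero integer of `F` has no very small conjugate. -/

section Separation

variable {F : Type*} [Field F] [NumberField F] {n : ℕ}

/-- The product of all conjugates is at least `1` in absolute value, so one of them is at least the
inverse of the product of the bounds on the others. All bounds are at least `1`, so the bound on the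
`k`-th conjugate may be kept in the product. -/
theorem one_le_abs_mul (σ : Fin (n + 1) ≃ (F →+* ℝ)) (bF : Module.Basis (Fin (n + 1)) ℤ (𝓞 F))
    {y : 𝓞 F} (hy : y ≠ 0) {c Y : ℝ} (hc : 1 ≤ c) (hY : 1 ≤ Y) (h0 : |σ 0 y| ≤ Y)
    (h : ∀ k, k ≠ 0 → |σ k y| ≤ c) (k : Fin (n + 1)) : 1 ≤ |σ k y| * (c ^ n * Y) := by
  let b : Fin (n + 1) → ℝ := fun j => if j = 0 then Y else c
  have hb1 : ∀ j, 1 ≤ b j := fun j => by dsimp only [b]; split_ifs <;> assumption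
  have hb : ∀ j, |σ j y| ≤ b j := fun j => by
    by_cases hj : j = 0
    · simp [b, hj, h0]
    · simp [b, hj, h j hj]
  have hprod : ∏ j, b j = c ^ n * Y := by
    rw [Fin.prod_univ_succ]
    simp [b, Fin.succ_ne_zero, mul_comm]
  calc 1 ≤ ∏ j, |σ j y| := one_le_prod_abs σ bF hy
    _ = |σ k y| * ∏ j ∈ Finset.univ.erase k, |σ j y| :=
        (Finset.mul_prod_erase _ _ (Finset.mem_univ k)).symm
    _ ≤ |σ k y| * ∏ j ∈ Finset.univ.erase k, b j := by
        gcongr with j hj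
        exact hb j
    _ ≤ |σ k y| * ∏ j, b j := by
        rw [← Finset.mul_prod_erase _ b (Finset.mem_univ k)]
        refine mul_le_mul_of_nonneg_left (le_mul_of_one_le_left ?_ (hb1 k)) (abs_nonneg _)
        exact Finset.prod_nonneg fun j _ => zero_le_one.trans (hb1 j)
    _ = _ := by rw [hprod]

end Separation

end RandomIntegerPoint
end

noncomputable section
namespace RandomIntegerPoint

/-! ### The region and its lattice points -/

section Region

/-- For `R ≥ 2` an error of `2` in the square moves the root by less than `1`, and rounding down
loses at most `1` more. -/
theorem abs_sub_le_two_of_sq_le {s N : ℤ} {R : ℝ} (hs : 0 ≤ s) (h1 : s * s ≤ N)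
    (h2 : N < (s + 1) * (s + 1)) (hR : 2 ≤ R) (hN : |(N : ℝ) - R ^ 2| ≤ 2) : |(s : ℝ) - R| ≤ 2 := by
  have hs' : (0 : ℝ) ≤ s := by exact_mod_cast hs
  have h1' : (s : ℝ) * s ≤ N := by exact_mod_cast h1
  have h2' : (N : ℝ) < (s + 1) * (s + 1) := by exact_mod_cast h2
  rw [abs_le] at hN ⊢
  constructor
  · by_contra h
    push Not at h
    nlinarith
  · by_contra h
    push Not at h
    nlinarith

/-- The cap has depth `R * ε ^ 2 ≥ 4 * L` and the targets lie about `2 * L` below its top, with room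
on both sides. Moving sideways by `L / ε` is harmless: the same inequality gives `y ^ 2 ≤ L * R /
4`, which changes the norm by less than `L`. -/
theorem near_target_mem_segment {R ε L δ X y : ℝ} (hε : 0 < ε) (hε' : ε < 1 / 2) (hL : 2 ≤ L)
    (hδ : 2 * δ ≤ L) (hR : 4 * L ≤ R * ε ^ 2) (hX : |X - (R - 2 * L)| ≤ 2)
    (hy : |y| ≤ L / ε) {u : ℂ} (hu : ‖u - (X + y * Complex.I)‖ ≤ δ) :
    R * (1 - ε ^ 2) ≤ u.re ∧ ‖u‖ ≤ R := by
  have hδ0 : 0 ≤ δ := (norm_nonneg _).trans hu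
  rw [abs_le] at hX
  have hε2 : ε ^ 2 ≤ 1 / 4 := by nlinarith
  have hRL : 16 * L ≤ R := by
    by_contra h
    push Not at h
    nlinarith [sq_nonneg ε, mul_pos hε hε]
  constructor
  · have h1 : |(u - (X + y * Complex.I)).re| ≤ δ := (Complex.abs_re_le_norm _).trans hu
    have h2 : (u - (X + y * Complex.I)).re = u.re - X := by simp
    rw [h2, abs_le] at h1
    linarith
  · have h1 : ‖(X + y * Complex.I : ℂ)‖ ≤ R - δ := by
      rw [← abs_of_nonneg (show 0 ≤ R - δ by linarith), ← abs_of_nonneg (norm_nonneg (_ : ℂ)),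
        ← sq_le_sq, ← Complex.normSq_eq_norm_sq, Complex.normSq_add_mul_I]
      have h2 : y ^ 2 ≤ (L / ε) ^ 2 := sq_le_sq' (by linarith [(abs_le.1 hy).1]) (abs_le.1 hy).2
      have h3 : (L / ε) ^ 2 ≤ L * R / 4 := by
        rw [div_pow, div_le_iff₀ (by positivity)]
        nlinarith
      nlinarith
    calc ‖u‖ = ‖(u - (X + y * Complex.I)) + (X + y * Complex.I)‖ := by rw [sub_add_cancel]
      _ ≤ δ + (R - δ) := (norm_add_le _ _).trans (add_le_add hu h1)
      _ = R := by ring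

/-- The points `κ * (2 * m - q)` run from `-κ * q` in steps of `2 * κ`, so they cover the interval
up to one step. -/
theorem exists_abs_sub_le_two_mul {u : ℝ} {κ q : ℤ} (hκ : 1 ≤ κ) (hq : 1 ≤ q)
    (hu : |u| ≤ κ * q) : ∃ m : ℤ, 0 ≤ m ∧ m < q ∧ |u - (κ * (2 * m - q) : ℤ)| ≤ 2 * κ := by
  have hκ' : (1 : ℝ) ≤ κ := by exact_mod_cast hκ
  have hq' : (1 : ℝ) ≤ q := by exact_mod_cast hq
  obtain ⟨h1, h2⟩ := abs_le.1 hu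
  set t : ℝ := (u / κ + q) / 2 with ht
  have hut : u = κ * (2 * t - q) := by
    rw [ht]
    field_simp
    ring
  have ht0 : 0 ≤ t := by
    by_contra h
    push Not at h
    nlinarith
  have htq : t ≤ q := by
    by_contra h
    push Not at h
    nlinarith
  have key : ∀ m : ℤ, |t - m| ≤ 1 → |u - (κ * (2 * m - q) : ℤ)| ≤ 2 * κ := by
    intro m hm
    rw [hut]
    push_cast
    rw [show (κ : ℝ) * (2 * t - q) - κ * (2 * m - q) = 2 * κ * (t - m) by ring, abs_mul,
      abs_of_pos (by linarith)]
    nlinarith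
  by_cases hf : ⌊t⌋ < q
  · refine ⟨⌊t⌋, Int.floor_nonneg.2 ht0, hf, key _ ?_⟩
    rw [abs_le]
    constructor <;> linarith [Int.floor_le t, Int.lt_floor_add_one t]
  -- The right end of the interval would need the excluded value `m = q`; the last admissible point
  -- is one step away.
  · refine ⟨q - 1, by omega, by omega, key _ ?_⟩
    have h3 : (q : ℝ) ≤ t := Int.le_floor.1 (not_lt.1 hf)
    push_cast
    rw [abs_le]
    constructor <;> linarith

/-- A negative `v` is at most `-1 / W`, hence at most `-3 * P ^ 12` after scaling. An error of `P ^
12` leaves a gap between the two cases, and the shift by `P ^ 12 + 1` places the threshold inside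
it. -/
theorem pos_add_iff_nonneg {P s : ℤ} {v W : ℝ} (hP : 1 ≤ P) (hs : |(s : ℝ) - P ^ 16 * v| ≤ P ^ 12)
    (hW : 3 * W ≤ P ^ 4) (hv : v ≠ 0 → 1 ≤ |v| * W) : 0 < s + P ^ 12 + 1 ↔ 0 ≤ v := by
  have hP' : (1 : ℝ) ≤ P := by exact_mod_cast hP
  have h12 : (1 : ℝ) ≤ (P : ℝ) ^ 12 := one_le_pow₀ hP'
  have h16 : (0 : ℝ) < (P : ℝ) ^ 16 := by positivity
  have e : (0 < s + P ^ 12 + 1) ↔ (0 : ℝ) < s + P ^ 12 + 1 := by exact_mod_cast Iff.rfl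
  rw [e]
  rw [abs_le] at hs
  constructor
  · intro h
    by_contra hneg
    push Not at hneg
    have h1 := hv hneg.ne
    rw [abs_of_neg hneg] at h1
    have h2 : 3 * (P : ℝ) ^ 12 ≤ P ^ 16 * (-v) := by
      calc 3 * (P : ℝ) ^ 12 ≤ 3 * (P : ℝ) ^ 12 * (-v * W) := by nlinarith
        _ = P ^ 12 * (-v) * (3 * W) := by ring
        _ ≤ P ^ 12 * (-v) * P ^ 4 := by
            gcongr
            have : 0 ≤ -v := by linarith
            positivity
        _ = _ := by ring
    linarith [hs.2]
  · intro h
    have : 0 ≤ (P : ℝ) ^ 16 * v := by positivity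
    linarith [hs.1]

variable {F : Type*} [Field F] {n : ℕ}

theorem exp_neg_mul_exp (φ : ℝ) :
    Complex.exp (-(Complex.I * φ / 2)) * Complex.exp (Complex.I * φ / 2) = 1 := by
  rw [← Complex.exp_add, neg_add_cancel, Complex.exp_zero]

theorem norm_mul_exp (φ : ℝ) (x : ℂ) : ‖x * Complex.exp (Complex.I * φ / 2)‖ = ‖x‖ := by
  rw [show Complex.I * φ / 2 = ((φ / 2 : ℝ) : ℂ) * Complex.I by push_cast; ring, norm_mul,
    Complex.norm_exp_ofReal_mul_I, mul_one]

theorem mem_halfPlane_iff (σ : Fin (n + 1) → F →+* ℝ) (r : 𝓞 F) (φ ε : ℝ) (x : ℂ) :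
    x ∈ halfPlane σ r φ ε ↔
      Real.sqrt (σ 0 r) * (1 - ε ^ 2) ≤ (x * Complex.exp (Complex.I * φ / 2)).re := by
  rw [halfPlane, Set.mem_ofPred_eq, zZero, sub_mul, mul_assoc, exp_neg_mul_exp, mul_one,
    Complex.sub_re, Complex.ofReal_re, sub_nonneg]

theorem target_zero_mul_exp (φ X y : ℝ) :
    target (n := n) φ X y 0 * Complex.exp (Complex.I * φ / 2) = X + y * Complex.I := by
  rw [target, if_pos rfl, mul_assoc, exp_neg_mul_exp, mul_one]

theorem norm_target_le (φ X y : ℝ) : ‖target (n := n) φ X y 0‖ ≤ |X| + |y| := by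
  rw [← norm_mul_exp φ, target_zero_mul_exp]
  refine (norm_add_le _ _).trans (le_of_eq ?_)
  simp

/-- The conditions on `r` and `ε` in the theorem. -/
structure Admissible (σ : Fin (n + 1) → F →+* ℝ) (r : 𝓞 F) (ε L : ℝ) (Rmax : Fin (n + 1) → ℝ) :
    Prop where
  pos : 0 < ε
  lt : ε < 1 / 2
  totally_pos : ∀ k, 0 < σ k r
  lower_zero : 4 * L ≤ Real.sqrt (σ 0 r) * ε ^ 2
  upper_zero : Real.sqrt (σ 0 r) * ε ^ 2 ≤ 4 * Rmax 0
  lower : ∀ k, k ≠ 0 → L ≤ Real.sqrt (σ k r)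
  upper : ∀ k, k ≠ 0 → Real.sqrt (σ k r) ≤ Rmax k

/-- `H` bounds the transition between coordinates in the basis of `ℤ_K` and points of `ℂ^d`. -/
structure IsLatticeBound (σ : Fin (n + 1) → F →+* ℝ) {a : 𝓞 F}
    (bK : Module.Basis (Fin (2 * (n + 1))) ℤ (CMIntegers a)) (H : ℝ) : Prop where
  pos : 0 < H
  norm_le : ∀ w B, (∀ j, |w j| ≤ B) → ∀ k, ‖realPoint σ bK w k‖ ≤ H * B
  coord_le : ∀ w B, (∀ k, ‖realPoint σ bK w k‖ ≤ B) → ∀ j, |w j| ≤ H * B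
  exists_eq : ∀ x, ∃ w, realPoint σ bK w = x

theorem realPoint_sub (σ : Fin (n + 1) → F →+* ℝ) {a : 𝓞 F}
    (bK : Module.Basis (Fin (2 * (n + 1))) ℤ (CMIntegers a)) (v w : Fin (2 * (n + 1)) → ℝ)
    (k : Fin (n + 1)) :
    realPoint σ bK v k - realPoint σ bK w k = realPoint σ bK (fun j => v j - w j) k := by
  simp only [realPoint, ← Finset.sum_sub_distrib]
  refine Finset.sum_congr rfl fun j _ => ?_
  push_cast
  ring

variable {σ : Fin (n + 1) → F →+* ℝ} {a : 𝓞 F}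
  {bK : Module.Basis (Fin (2 * (n + 1))) ℤ (CMIntegers a)} {H : ℝ}

theorem IsLatticeBound.norm_sub_le (h : IsLatticeBound σ bK H) {z : Fin (2 * (n + 1)) → ℤ}
    {w : Fin (2 * (n + 1)) → ℝ} {x : Fin (n + 1) → ℂ} (hw : realPoint σ bK w = x) {B : ℝ}
    (hz : ∀ j, |(z j : ℝ) - w j| ≤ B) (k : Fin (n + 1)) :
    ‖sigmaPlus (σ k) a (ofCoords bK z) - x k‖ ≤ H * B := by
  rw [sigmaPlus_ofCoords, ← hw, realPoint_sub]
  exact h.norm_le _ _ hz k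

theorem IsLatticeBound.abs_sub_le (h : IsLatticeBound σ bK H) {z : Fin (2 * (n + 1)) → ℤ}
    {w : Fin (2 * (n + 1)) → ℝ} {x : Fin (n + 1) → ℂ} (hw : realPoint σ bK w = x) {B : ℝ}
    (hz : ∀ k, ‖sigmaPlus (σ k) a (ofCoords bK z) - x k‖ ≤ B) (j : Fin (2 * (n + 1))) :
    |(z j : ℝ) - w j| ≤ H * B := by
  refine h.coord_le (fun j => (z j : ℝ) - w j) B (fun k => ?_) j
  have := hz k
  rwa [sigmaPlus_ofCoords, ← hw, realPoint_sub] at this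

theorem mem_Cand_iff {r : 𝓞 F} (hr : ∀ k, 0 < σ k r) (φ ε : ℝ) (z : CMIntegers a) :
    z ∈ Cand σ a r φ ε ↔ sigmaPlus (σ 0) a z ∈ halfPlane σ r φ ε ∧
      ∀ k, ‖sigmaPlus (σ k) a z‖ ≤ Real.sqrt (σ k r) := by
  simp only [Cand, region, vecSigma, Set.mem_ofPred_eq]
  refine and_congr Iff.rfl (forall_congr' fun k => ?_)
  rw [Real.le_sqrt (norm_nonneg _) (hr k).le]

/-- Rotation by `e^{iφ/2}` turns the first coordinate into the cap of `near_target_mem_segment`; in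
the others the target is `0` and the balls have radius at least `L ≥ δ`. -/
theorem Admissible.mem_Cand_of_near {r : 𝓞 F} {ε L δ X y φ : ℝ} {Rmax : Fin (n + 1) → ℝ}
    (h : Admissible σ r ε L Rmax) (hL : 2 ≤ L) (hδ : 2 * δ ≤ L)
    (hX : |X - (Real.sqrt (σ 0 r) - 2 * L)| ≤ 2) (hy : |y| ≤ L / ε) {z : CMIntegers a}
    (hz : ∀ k, ‖sigmaPlus (σ k) a z - target φ X y k‖ ≤ δ) : z ∈ Cand σ a r φ ε := by
  rw [mem_Cand_iff h.totally_pos, mem_halfPlane_iff]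
  have h0 := hz 0
  rw [← norm_mul_exp φ, sub_mul, target_zero_mul_exp] at h0
  obtain ⟨h1, h2⟩ := near_target_mem_segment h.pos h.lt hL hδ h.lower_zero hX hy h0
  refine ⟨h1, fun k => ?_⟩
  by_cases hk : k = 0
  · rw [hk]
    rwa [norm_mul_exp] at h2
  · have h3 := hz k
    have h4 := h.lower k hk
    have h5 := (norm_nonneg _).trans h3
    rw [target, if_neg hk, sub_zero] at h3
    linarith

/-- The number of candidates is at least a multiple of `1 / ε`. -/
theorem Admissible.le_ncard (hH : IsLatticeBound σ bK H) {r : 𝓞 F} {ε L φ : ℝ}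
    {Rmax : Fin (n + 1) → ℝ} (h : Admissible σ r ε L Rmax) (hL : 2 ≤ L) (hLH : 12 * H ≤ L)
    (hfin : (Cand σ a r φ ε).Finite) : 4 / ε ≤ (Cand σ a r φ ε).ncard := by
  have hε := h.pos
  have hH0 := hH.pos
  set X : ℝ := Real.sqrt (σ 0 r) - 2 * L with hX
  -- Targets are `3 * H` apart and rounding coordinates down moves a point by at most `H`, so the
  -- rounded points are distinct. The targets with `0 ≤ y ≤ L / ε` number at least `L / (3 * H *
  -- ε)`, which is at least `4 / ε` because `12 * H ≤ L`.
  set M : ℕ := ⌊L / (3 * H * ε)⌋₊ + 1 with hM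
  choose w hw using fun i : ℕ => hH.exists_eq (target φ X (3 * H * i))
  let f : ℕ → CMIntegers a := fun i => ofCoords bK fun j => ⌊w i j⌋
  have hf : ∀ i k, ‖sigmaPlus (σ k) a (f i) - target φ X (3 * H * i) k‖ ≤ H := by
    intro i k
    have := hH.norm_sub_le (z := fun j => ⌊w i j⌋) (hw i) (B := 1) (fun j => ?_) k
    · rwa [mul_one] at this
    · rw [abs_le]
      constructor <;> linarith [Int.floor_le (w i j), Int.lt_floor_add_one (w i j)]
  have hmem : ∀ i ∈ Finset.range M, f i ∈ Cand σ a r φ ε := by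
    intro i hi
    have hi' : i ≤ ⌊L / (3 * H * ε)⌋₊ := by
      have := Finset.mem_range.1 hi
      omega
    have hi2 : (i : ℝ) ≤ L / (3 * H * ε) := by
      refine le_trans (by exact_mod_cast hi') (Nat.floor_le ?_)
      have : 0 ≤ L := by linarith
      positivity
    refine h.mem_Cand_of_near hL (δ := H) (by linarith) (by rw [sub_self, abs_zero]; norm_num) ?_
      (hf i)
    rw [abs_of_nonneg (by positivity), le_div_iff₀ hε]
    rw [le_div_iff₀ (by positivity)] at hi2
    linarith
  have hinj : ∀ i j : ℕ, i < j → f i ≠ f j := by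
    intro i j hij he
    have h1 := hf i 0
    have h2 := hf j 0
    rw [he, norm_sub_rev] at h1
    have h3 : ‖target (n := n) φ X (3 * H * i) 0 - target (n := n) φ X (3 * H * j) 0‖ ≤ 2 * H := by
      calc _ = ‖(target (n := n) φ X (3 * H * i) 0 - sigmaPlus (σ 0) a (f j)) +
            (sigmaPlus (σ 0) a (f j) - target (n := n) φ X (3 * H * j) 0)‖ := by
            rw [sub_add_sub_cancel]
        _ ≤ _ := (norm_add_le _ _).trans (by linarith)
    rw [← norm_mul_exp φ, sub_mul, target_zero_mul_exp, target_zero_mul_exp] at h3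
    have h4 : |(3 * H * i - 3 * H * j : ℝ)| ≤ 2 * H := by
      refine le_trans ?_ h3
      refine le_trans (le_of_eq ?_) (Complex.abs_im_le_norm _)
      simp
    have h5 : (i : ℝ) + 1 ≤ j := by exact_mod_cast hij
    have h6 := (abs_le.1 h4).1
    nlinarith
  have hinj' : Set.InjOn f (Finset.range M : Set ℕ) := by
    intro i _ j _ he
    rcases lt_trichotomy i j with hij | hij | hij
    · exact absurd he (hinj i j hij)
    · exact hij
    · exact absurd he.symm (hinj j i hij)
  have hcard : M ≤ (Cand σ a r φ ε).ncard := by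
    have h1 := Set.ncard_le_ncard (s := f '' (Finset.range M : Set ℕ)) (t := Cand σ a r φ ε)
      (by rintro _ ⟨i, hi, rfl⟩; exact hmem i hi) hfin
    rwa [hinj'.ncard_image, Set.ncard_coe_finset, Finset.card_range] at h1
  calc 4 / ε ≤ L / (3 * H * ε) := by
        rw [div_le_div_iff₀ hε (by positivity)]
        nlinarith
    _ ≤ M := by
        rw [hM]
        push_cast
        exact (Nat.lt_floor_add_one _).le
    _ ≤ _ := by exact_mod_cast hcard

end Region

end RandomIntegerPoint
end

noncomputable section
namespace RandomIntegerPoint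

/-! ### The constants of the sampling procedure -/

section Constants

section

variable {F : Type*} [Field F] {n : ℕ} {σ : Fin (n + 1) → F →+* ℝ} {a : 𝓞 F}
  {bF : Module.Basis (Fin (n + 1)) ℤ (𝓞 F)}
  {bK : Module.Basis (Fin (2 * (n + 1))) ℤ (CMIntegers a)} {H : ℝ}

theorem abs_normApprox_sub_le {φ ε Y : ℝ} {e : RealName n → ℤ} {P : ℤ} (hP : 1 ≤ P)
    (he : IsApprox σ bF bK φ ε e P) {r : 𝓞 F} (hr : ∀ j, |(bF.repr r j : ℝ)| ≤ Y)
    (hY : (n + 1) * Y ≤ P ^ 8) : |(normApprox e P (bF.repr r) : ℝ) - σ 0 r| ≤ 2 := by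
  have hP' : (1 : ℝ) ≤ P := by exact_mod_cast hP
  have hQ : (0 : ℝ) < (P : ℝ) ^ 8 := by positivity
  have h1 := abs_fdiv_sub_div_le (b := P ^ 8) (by positivity)
    (∑ j, bF.repr r j * e (.embF 0 j))
  have hr' : σ 0 r = ∑ j, (bF.repr r j : ℝ) * σ 0 (bF j) := by
    let f : 𝓞 F →+* ℝ := (σ 0).comp (algebraMap (𝓞 F) F)
    have h := congrArg f (bF.sum_repr r)
    rw [map_sum] at h
    simp only [zsmul_eq_mul, map_mul, map_intCast] at h
    exact h.symm
  have h2 : |((∑ j, bF.repr r j * e (.embF 0 j) : ℤ) : ℝ) / ((P ^ 8 : ℤ) : ℝ) - σ 0 r| ≤ 1 := by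
    push_cast
    rw [div_sub' hQ.ne', abs_div, abs_of_pos hQ, div_le_one hQ, hr', Finset.mul_sum,
      ← Finset.sum_sub_distrib]
    calc _ ≤ ∑ j, |(bF.repr r j : ℝ) * e (.embF 0 j) - (P : ℝ) ^ 8 *
          (bF.repr r j * σ 0 (bF j))| := Finset.abs_sum_le_sum_abs _ _
      _ ≤ ∑ _j : Fin (n + 1), Y := by
          refine Finset.sum_le_sum fun j _ => ?_
          rw [show (bF.repr r j : ℝ) * e (.embF 0 j) - (P : ℝ) ^ 8 * (bF.repr r j * σ 0 (bF j)) =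
            bF.repr r j * (e (.embF 0 j) - (P : ℝ) ^ 8 * σ 0 (bF j)) by ring, abs_mul]
          calc |(bF.repr r j : ℝ)| * |(e (.embF 0 j) : ℝ) - (P : ℝ) ^ 8 * σ 0 (bF j)| ≤ Y * 1 := by
                gcongr
                · exact (abs_nonneg _).trans (hr j)
                · exact hr j
                · exact he (.embF 0 j)
            _ = Y := mul_one _
      _ = (n + 1) * Y := by simp
      _ ≤ _ := hY
  have := abs_add_le _ _ |>.trans (add_le_add h1 h2)
  rw [sub_add_sub_cancel] at this
  exact this.trans (by norm_num)

/-- Since `R * ε ^ 2` is bounded and `1 / ε ≤ q`, all lengths are measured in powers of `q`: the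
radius is `O(q ^ 2)` and the length of the cap `O(q)`. -/
theorem Admissible.sqrt_le {r : 𝓞 F} {ε L q : ℝ} {Rmax : Fin (n + 1) → ℝ}
    (h : Admissible σ r ε L Rmax) (hq : 1 / ε ≤ q) :
    Real.sqrt (σ 0 r) ≤ 4 * Rmax 0 * q ^ 2 ∧ Real.sqrt (σ 0 r) * ε ≤ 4 * Rmax 0 * q := by
  have hε := h.pos
  have hR := Real.sqrt_nonneg (σ 0 r)
  have h1 : 1 ≤ ε * q := by rwa [div_le_iff₀' hε] at hq
  have hq0 : 0 < q := lt_of_lt_of_le (by positivity) hq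
  have h2 := h.upper_zero
  constructor
  · calc Real.sqrt (σ 0 r) ≤ Real.sqrt (σ 0 r) * (ε * q) ^ 2 :=
          le_mul_of_one_le_right hR (one_le_pow₀ h1)
      _ = Real.sqrt (σ 0 r) * ε ^ 2 * q ^ 2 := by ring
      _ ≤ _ := by gcongr
  · calc Real.sqrt (σ 0 r) * ε ≤ Real.sqrt (σ 0 r) * ε * (ε * q) :=
          le_mul_of_one_le_right (by positivity) h1
      _ = Real.sqrt (σ 0 r) * ε ^ 2 * q := by ring
      _ ≤ _ := by gcongr

theorem Admissible.le_sqrt {r : 𝓞 F} {ε L : ℝ} {Rmax : Fin (n + 1) → ℝ}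
    (h : Admissible σ r ε L Rmax) (_hL : 0 ≤ L) : 16 * L ≤ Real.sqrt (σ 0 r) := by
  have h1 := h.pos
  have h2 := h.lt
  have h3 := h.lower_zero
  have h4 := Real.sqrt_nonneg (σ 0 r)
  have h5 : ε ^ 2 ≤ 1 / 4 := by nlinarith
  nlinarith

/-- In the cap the real part varies by at most `R * ε ^ 2 ≤ 4 * Rmax 0`, and the square of the
imaginary part is at most `R ^ 2 - R ^ 2 * (1 - ε ^ 2) ^ 2 ≤ (2 * R * ε) ^ 2`. So `q` targets
suffice, at a distance that does not depend on `ε`; this makes the number of offsets constant. -/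
theorem Admissible.exists_near {r : 𝓞 F} {φ ε L S X : ℝ} {Rmax : Fin (n + 1) → ℝ}
    (h : Admissible σ r ε L Rmax) (hL : 0 ≤ L) (hS : ∀ k, Rmax k ≤ S) {κ q : ℤ} (hκ : 1 ≤ κ)
    (hκ' : 8 * Rmax 0 ≤ κ) (hq : 1 ≤ q) (hq' : 1 / ε ≤ q)
    (hX : |X - (Real.sqrt (σ 0 r) - 2 * L)| ≤ 2) {z : CMIntegers a} (hz : z ∈ Cand σ a r φ ε) :
    ∃ m : ℤ, 0 ≤ m ∧ m < q ∧ ∀ k, ‖sigmaPlus (σ k) a z - target φ X (κ * (2 * m - q) : ℤ) k‖ ≤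
      4 * Rmax 0 + 2 + 2 * L + 2 * κ + S := by
  rw [mem_Cand_iff h.totally_pos, mem_halfPlane_iff] at hz
  obtain ⟨h1, h2⟩ := hz
  have hε := h.pos
  have hε' := h.lt
  have hR := Real.sqrt_nonneg (σ 0 r)
  have hup := h.upper_zero
  have hR0 : 0 ≤ Rmax 0 := by
    have : 0 ≤ Real.sqrt (σ 0 r) * ε ^ 2 := by positivity
    linarith
  have hS0 : 0 ≤ S := hR0.trans (hS 0)
  have hRε := (h.sqrt_le hq').2
  have h20 := h2 0
  set R := Real.sqrt (σ 0 r) with hRdef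
  set u := sigmaPlus (σ 0) a z * Complex.exp (Complex.I * φ / 2) with hu
  have hκ1 : (1 : ℝ) ≤ κ := by exact_mod_cast hκ
  have hq1 : (1 : ℝ) ≤ q := by exact_mod_cast hq
  have hun : ‖u‖ ≤ R := by rwa [hu, norm_mul_exp]
  have hre : u.re ≤ R := (Complex.re_le_norm u).trans hun
  have hε2 : ε ^ 2 ≤ 1 / 4 := by nlinarith
  have him : |u.im| ≤ κ * q := by
    have h3 : u.re * u.re + u.im * u.im ≤ R ^ 2 := by
      rw [← Complex.normSq_apply, Complex.normSq_eq_norm_sq]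
      gcongr
    have h5 : (R * (1 - ε ^ 2)) * (R * (1 - ε ^ 2)) ≤ u.re * u.re := by
      have : 0 ≤ R * (1 - ε ^ 2) := mul_nonneg hR (by linarith)
      exact mul_self_le_mul_self this h1
    have h4 : u.im ^ 2 ≤ (2 * (R * ε)) ^ 2 := by
      nlinarith [mul_nonneg (sq_nonneg R) (sq_nonneg ε),
        mul_nonneg (sq_nonneg (R * ε)) (sq_nonneg ε)]
    have h6 : |u.im| ≤ 2 * (R * ε) := abs_le_of_sq_le_sq h4 (by positivity)
    calc |u.im| ≤ 2 * (R * ε) := h6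
      _ ≤ 8 * Rmax 0 * q := by linarith
      _ ≤ κ * q := by gcongr
  obtain ⟨m, hm0, hmq, hm⟩ := exists_abs_sub_le_two_mul hκ hq him
  refine ⟨m, hm0, hmq, fun k => ?_⟩
  by_cases hk : k = 0
  · subst hk
    rw [← norm_mul_exp φ, sub_mul, target_zero_mul_exp, ← hu]
    refine (Complex.norm_le_abs_re_add_abs_im _).trans ?_
    have e1 : (u - (X + ((κ * (2 * m - q) : ℤ) : ℝ) * Complex.I)).re = u.re - X := by simp
    have e2 : (u - (X + ((κ * (2 * m - q) : ℤ) : ℝ) * Complex.I)).im =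
        u.im - ((κ * (2 * m - q) : ℤ) : ℝ) := by simp
    rw [e1, e2]
    have h7 : |u.re - X| ≤ 4 * Rmax 0 + 2 + 2 * L := by
      rw [abs_le] at hX ⊢
      constructor <;> nlinarith
    linarith
  · rw [target, if_neg hk, sub_zero]
    have h8 := (h2 k).trans (h.upper k hk)
    have h9 := hS k
    linarith

theorem Admissible.abs_add_abs_le {r : 𝓞 F} {ε L X y κ q : ℝ} {Rmax : Fin (n + 1) → ℝ}
    (h : Admissible σ r ε L Rmax) (hL : 0 ≤ L) (hκ : 0 ≤ κ) (hq : 1 ≤ q) (hq' : 1 / ε ≤ q)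
    (hX : |X - (Real.sqrt (σ 0 r) - 2 * L)| ≤ 2) (hy : |y| ≤ κ * q) :
    |X| + |y| ≤ (4 * Rmax 0 + 2 * L + 2 + κ) * q ^ 2 := by
  have hR := Real.sqrt_nonneg (σ 0 r)
  have hRq := (h.sqrt_le hq').1
  have hq2 : 1 ≤ q ^ 2 := one_le_pow₀ hq
  have h2 : |X| ≤ Real.sqrt (σ 0 r) + 2 * L + 2 := by
    rw [abs_le] at hX ⊢
    constructor <;> linarith
  have h3 : κ * q ≤ κ * q ^ 2 := by
    gcongr
    nlinarith
  nlinarith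

/-- Only the first coordinate grows with `q`. Consequently the separation bound loses just `q ^ 4`,
whatever the degree of `F`. -/
theorem norm_le_of_near {φ X y D c q : ℝ} (hq : 1 ≤ q) (hc : |X| + |y| ≤ c * q ^ 2)
    {z : CMIntegers a} (hz : ∀ k, ‖sigmaPlus (σ k) a z - target φ X y k‖ ≤ D) :
    (∀ k, ‖sigmaPlus (σ k) a z‖ ≤ (c + D) * q ^ 2) ∧
    ∀ k, k ≠ 0 → ‖sigmaPlus (σ k) a z‖ ≤ D := by
  have hq2 : 1 ≤ q ^ 2 := one_le_pow₀ hq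
  have hD : 0 ≤ D := (norm_nonneg _).trans (hz 0)
  have h4 : ∀ k, k ≠ 0 → ‖sigmaPlus (σ k) a z‖ ≤ D := by
    intro k hk
    have := hz k
    rwa [target, if_neg hk, sub_zero] at this
  refine ⟨fun k => ?_, h4⟩
  have hDq : D ≤ D * q ^ 2 := le_mul_of_one_le_right hD hq2
  have h5 := (abs_nonneg X).trans (le_add_of_nonneg_right (abs_nonneg y)) |>.trans hc
  by_cases hk : k = 0
  · subst hk
    have h6 := norm_add_le (sigmaPlus (σ 0) a z - target (n := n) φ X y 0) (target (n := n) φ X y 0)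
    rw [sub_add_cancel] at h6
    have h7 := hz 0
    have h8 := norm_target_le (n := n) φ X y
    linarith
  · have := h4 k hk
    linarith

end

variable {F : Type*} [Field F] [NumberField F] {n : ℕ}

set_option maxHeartbeats 1600000 in
-- This is all that the program needs to know about the geometry: sizes for the square root, a
-- default candidate, an exact membership test, and a target with an offset for every candidate.
-- `N`, `G` and `L` are chosen before `Rmax`, since `L` becomes `Rmin`.
theorem exists_sampling_constants (σ : Fin (n + 1) ≃ (F →+* ℝ)) {a : 𝓞 F} (ha : ∀ k, σ k a < 0)
    (bF : Module.Basis (Fin (n + 1)) ℤ (𝓞 F))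
    (bK : Module.Basis (Fin (2 * (n + 1))) ℤ (CMIntegers a)) :
    ∃ (N : ℤ) (G : Fin (2 * (n + 1)) → Fin (2 * (n + 1)) → ℤ) (L : ℕ), 0 < L ∧
    (∀ φ ε r Rmax, Admissible σ r ε L Rmax → (Cand σ a r φ ε).Finite →
      4 / ε ≤ (Cand σ a r φ ε).ncard) ∧
    ∀ Rmax : Fin (n + 1) → ℝ, (∀ k, 0 < Rmax k) → ∃ (κ : ℤ) (B Ω : ℕ), 1 ≤ Ω ∧
    ∀ φ ε r (e : RealName n → ℤ) (P q : ℤ), Admissible σ r ε L Rmax →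
      IsApprox σ bF bK φ ε e P → Ω * q ≤ P → 1 ≤ q → 1 / ε ≤ q →
      (0 ≤ normApprox e P (bF.repr r) ∧ normApprox e P (bF.repr r) < 4 * P ^ 4 ∧
        ∀ j, |bF.repr r j| ≤ P ^ 4) ∧
      ∀ s, 0 ≤ s → s * s ≤ normApprox e P (bF.repr r) →
        normApprox e P (bF.repr r) < (s + 1) * (s + 1) →
        ofCoords bK (coord N G e P (s - 2 * L) 0) ∈ Cand σ a r φ ε ∧
        (∀ m (o : Fin (2 * (n + 1)) → ℤ), 0 ≤ m → m < q → (∀ j, |o j| ≤ B) →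
          (((∀ k, 0 < slack e P (bF.repr r)
              (fun j => coord N G e P (s - 2 * L) (κ * (2 * m - q)) j + o j) k + P ^ 12 + 1) ∧
            sigmaPlus (σ 0) a (ofCoords bK
              fun j => coord N G e P (s - 2 * L) (κ * (2 * m - q)) j + o j) ∈
                halfPlane σ r φ ε) ↔
            ofCoords bK (fun j => coord N G e P (s - 2 * L) (κ * (2 * m - q)) j + o j) ∈
              Cand σ a r φ ε)) ∧
        ∀ z ∈ Cand σ a r φ ε, ∃ m, ∃ o : Fin (2 * (n + 1)) → ℤ, 0 ≤ m ∧ m < q ∧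
          (∀ j, |o j| ≤ B) ∧
          z = ofCoords bK fun j => coord N G e P (s - 2 * L) (κ * (2 * m - q)) j + o j := by
  obtain ⟨N, G, hN, hG⟩ := exists_gram_inverse σ ha bF bK
  obtain ⟨H, hH0, hH1, hH2, hH3⟩ := exists_bound_realPoint σ ha bK
  have hH : IsLatticeBound σ bK H := ⟨hH0, hH1, hH2, hH3⟩
  obtain ⟨H', hH'0, hH'⟩ := exists_bound_repr σ bF
  obtain ⟨Γ, hΓ0, hΓ⟩ := exists_abs_coord_sub_le σ bF bK hN hG
  obtain ⟨Λ, hΛ0, hΛ⟩ := exists_abs_slack_sub_le σ bF bK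
  -- `12 * H` is needed for the count of candidates and makes the rounding error `2 * H` of the
  -- default point at most `L / 2`; the `2` absorbs the error in `√σ₁(r)`.
  obtain ⟨L, hL⟩ := exists_nat_ge (12 * H + 2)
  have hL2 : (2 : ℝ) ≤ L := by linarith
  refine ⟨N, G, L, by have : (0 : ℝ) < L := by linarith
                      exact_mod_cast this,
    fun φ ε r Rmax h hf => h.le_ncard hH hL2 (by linarith) hf, ?_⟩
  intro Rmax hRmax
  obtain ⟨S, hS⟩ : ∃ x : ℝ, x = ∑ k, Rmax k := ⟨_, rfl⟩
  have hSle : ∀ k, Rmax k ≤ S := fun k =>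
    hS ▸ Finset.single_le_sum (fun k _ => (hRmax k).le) (Finset.mem_univ k)
  have hS0 : 0 < S := (hRmax 0).trans_le (hSle 0)
  have hρ := hRmax 0
  obtain ⟨κ₀, hκ₀⟩ := exists_nat_ge (8 * Rmax 0 + 1)
  obtain ⟨κ, hκdef⟩ : ∃ κ : ℤ, κ = κ₀ := ⟨κ₀, rfl⟩
  have hκR : 8 * Rmax 0 + 1 ≤ (κ : ℝ) := by
    rw [hκdef]
    exact_mod_cast hκ₀
  have hκ1 : 1 ≤ κ := by
    have : (1 : ℝ) ≤ κ := by linarith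
    exact_mod_cast this
  have hκ1' : (1 : ℝ) ≤ κ := by linarith
  -- The distance in `exists_near`, converted to coordinates by `H`, plus the error `2` of `coord`.
  obtain ⟨B, hB⟩ := exists_nat_ge (H * (4 * Rmax 0 + 2 + 2 * L + 2 * κ + S) + 2)
  -- The distance from its target of a point that is tested: offset `B` and coordinate error `2`,
  -- converted back by `H`.
  obtain ⟨D, hD⟩ : ∃ x : ℝ, x = H * (B + 2) := ⟨_, rfl⟩
  obtain ⟨cT, hcT⟩ : ∃ x : ℝ, x = 4 * Rmax 0 + 2 * L + 2 + κ := ⟨_, rfl⟩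
  obtain ⟨c₁, hc₁⟩ : ∃ x : ℝ, x = 16 * Rmax 0 ^ 2 + S ^ 2 := ⟨_, rfl⟩
  obtain ⟨Ω₀, hΩ₀⟩ : ∃ x : ℝ, x = 1 + H * (cT + D) + H' * c₁ + c₁ + (cT + D) ^ 2 := ⟨_, rfl⟩
  have hD0 : 0 ≤ D := by rw [hD]; positivity
  have hcT0 : 0 ≤ cT := by rw [hcT]; positivity
  have hc₁0 : 0 ≤ c₁ := by rw [hc₁]; positivity
  have hp1 : 0 ≤ H * (cT + D) := by positivity
  have hp2 : 0 ≤ H' * c₁ := by positivity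
  have hp3 : 0 ≤ (cT + D) ^ 2 := by positivity
  have hΩ₀1 : 1 ≤ Ω₀ := by linarith
  -- All precision requirements have the form `c * q ^ 4 ≤ P ^ 4` or `≤ P ^ 8`; each summand is one
  -- such `c`, so `Ω * q ≤ P` meets them all.
  obtain ⟨Ω, hΩ⟩ := exists_nat_ge
    (1 + Γ * cT + (n + 1) * Ω₀ + Λ * Ω₀ ^ 2 + 3 * Ω₀ ^ (n + 1) + c₁ + 2)
  have hq1 : 0 ≤ Γ * cT := by positivity
  have hq2 : 0 ≤ (n + 1) * Ω₀ := by positivity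
  have hq3 : 0 ≤ Λ * Ω₀ ^ 2 := by positivity
  have hq4 : 0 ≤ 3 * Ω₀ ^ (n + 1) := by positivity
  have hΩ1 : (1 : ℝ) ≤ Ω := by linarith
  have hΩΩ : Ω₀ ≤ Ω := by
    have : 1 * Ω₀ ≤ (n + 1) * Ω₀ := by
      gcongr
      exact le_add_of_nonneg_left (Nat.cast_nonneg n)
    linarith
  refine ⟨κ, B, Ω, by exact_mod_cast hΩ1, ?_⟩
  intro φ ε r e P q h he hPq hq hqε
  have hq' : (1 : ℝ) ≤ q := by exact_mod_cast hq
  have hq2' : (1 : ℝ) ≤ (q : ℝ) ^ 2 := one_le_pow₀ hq'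
  have hq4' : (1 : ℝ) ≤ (q : ℝ) ^ 4 := one_le_pow₀ hq'
  have hPq' : (Ω : ℝ) * q ≤ P := by exact_mod_cast hPq
  have hP1' : (1 : ℝ) ≤ P := (one_le_mul_of_one_le_of_one_le hΩ1 hq').trans hPq'
  have hP1 : 1 ≤ P := by exact_mod_cast hP1'
  have hP4 : Ω * (q : ℝ) ^ 4 ≤ (P : ℝ) ^ 4 := by
    calc Ω * (q : ℝ) ^ 4 ≤ (Ω : ℝ) ^ 4 * (q : ℝ) ^ 4 := by
          gcongr
          exact le_self_pow₀ hΩ1 (by norm_num)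
      _ = (Ω * q : ℝ) ^ 4 := by ring
      _ ≤ _ := by gcongr
  have hP8 : Ω * (q : ℝ) ^ 4 ≤ (P : ℝ) ^ 8 :=
    hP4.trans (pow_le_pow_right₀ hP1' (by norm_num))
  have hΩq : ∀ c : ℝ, c ≤ Ω → c * (q : ℝ) ^ 4 ≤ (P : ℝ) ^ 4 := fun c hc =>
    (mul_le_mul_of_nonneg_right hc (by positivity)).trans hP4
  have hR := Real.sqrt_nonneg (σ 0 r)
  have hRsq : Real.sqrt (σ 0 r) ^ 2 = σ 0 r := Real.sq_sqrt (h.totally_pos 0).le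
  have hRq := (h.sqrt_le hqε).1
  have hR16 := h.le_sqrt (by linarith)
  have hσ : ∀ k, |σ k r| ≤ c₁ * (q : ℝ) ^ 4 := by
    intro k
    rw [abs_of_pos (h.totally_pos k)]
    by_cases hk : k = 0
    · subst hk
      rw [← hRsq]
      calc Real.sqrt (σ 0 r) ^ 2 ≤ (4 * Rmax 0 * q ^ 2) ^ 2 := by gcongr
        _ = 16 * Rmax 0 ^ 2 * q ^ 4 := by ring
        _ ≤ c₁ * q ^ 4 := by
            gcongr
            rw [hc₁]
            exact le_add_of_nonneg_right (sq_nonneg S)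
    · rw [← Real.sq_sqrt (h.totally_pos k).le]
      calc Real.sqrt (σ k r) ^ 2 ≤ S ^ 2 := by
            gcongr
            exact (h.upper k hk).trans (hSle k)
        _ ≤ c₁ := hc₁ ▸ le_add_of_nonneg_left (by positivity)
        _ ≤ _ := le_mul_of_one_le_right hc₁0 hq4'
  have hσ' : ∀ k, k ≠ 0 → |σ k r| ≤ c₁ := by
    intro k hk
    rw [abs_of_pos (h.totally_pos k), ← Real.sq_sqrt (h.totally_pos k).le]
    calc Real.sqrt (σ k r) ^ 2 ≤ S ^ 2 := by
          gcongr
          exact (h.upper k hk).trans (hSle k)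
      _ ≤ c₁ := hc₁ ▸ le_add_of_nonneg_left (by positivity)
  have hrepr : ∀ j, |(bF.repr r j : ℝ)| ≤ Ω₀ * (q : ℝ) ^ 4 := by
    intro j
    refine (hH' r _ hσ j).trans ?_
    rw [← mul_assoc]
    gcongr
    linarith
  have hNA := abs_normApprox_sub_le hP1 he hrepr (by
    rw [← mul_assoc]
    refine le_trans ?_ hP8
    gcongr
    linarith)
  rw [← hRsq] at hNA
  refine ⟨⟨?_, ?_, fun j => ?_⟩, ?_⟩
  · have h1 := (abs_le.1 hNA).1
    have h3 : (2 : ℝ) ^ 2 ≤ Real.sqrt (σ 0 r) ^ 2 := by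
      gcongr
      linarith
    have h2 : (0 : ℝ) ≤ normApprox e P (bF.repr r) := by linarith
    exact_mod_cast h2
  · have h1 := (abs_le.1 hNA).2
    have h2 := hσ 0
    rw [abs_of_pos (h.totally_pos 0), ← hRsq] at h2
    have h3 := hΩq (c₁ + 2) (by linarith)
    rw [add_mul] at h3
    have h5 : (0 : ℝ) < (P : ℝ) ^ 4 := pow_pos (by linarith) 4
    have h4 : (normApprox e P (bF.repr r) : ℝ) < 4 * P ^ 4 := by linarith
    exact_mod_cast h4
  · have h1 := (hrepr j).trans (hΩq Ω₀ hΩΩ)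
    exact_mod_cast h1
  intro s hs0 hs1 hs2
  have hsR := abs_sub_le_two_of_sq_le hs0 hs1 hs2 (by linarith) hNA
  have hX : |((s - 2 * L : ℤ) : ℝ) - (Real.sqrt (σ 0 r) - 2 * L)| ≤ 2 := by
    push_cast
    rwa [show (s : ℝ) - 2 * L - (Real.sqrt (σ 0 r) - 2 * L) = s - Real.sqrt (σ 0 r) by ring]
  have hcoord : ∀ (y : ℤ) w, |(y : ℝ)| ≤ κ * q → realPoint σ bK w = target φ (s - 2 * L : ℤ) y →
      ∀ j, |(coord N G e P (s - 2 * L) y j : ℝ) - w j| ≤ 2 := by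
    intro y w hy hw
    refine hΓ φ ε e P _ y w hP1 he hw ?_
    have h1 := h.abs_add_abs_le (by linarith) (by linarith) hq' hqε hX hy
    rw [← hcT] at h1
    calc Γ * (|((s - 2 * L : ℤ) : ℝ)| + |(y : ℝ)|) ≤ Γ * (cT * (q : ℝ) ^ 2) := by gcongr
      _ ≤ Γ * cT * (q : ℝ) ^ 4 := by
          rw [← mul_assoc]
          gcongr
          norm_num
      _ ≤ Ω * (q : ℝ) ^ 4 := by
          gcongr
          linarith
      _ ≤ _ := hP8
  have hy : ∀ m : ℤ, 0 ≤ m → m < q → |((κ * (2 * m - q) : ℤ) : ℝ)| ≤ κ * q := by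
    intro m hm0 hmq
    have h1 : |κ * (2 * m - q)| ≤ κ * q := by
      rw [abs_mul, abs_of_pos (by omega)]
      gcongr
      rw [abs_le]
      constructor <;> omega
    exact_mod_cast h1
  refine ⟨?_, fun m o hm0 hmq ho => ?_, fun z hz => ?_⟩
  -- The default point belongs to the target in the middle of the cap.
  · obtain ⟨w, hw⟩ := hH3 (target φ (s - 2 * L : ℤ) (0 : ℤ))
    refine h.mem_Cand_of_near (δ := H * 2) (y := (0 : ℤ)) hL2 (by linarith) hX ?_
      (hH.norm_sub_le hw (hcoord 0 w ?_ hw))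
    · rw [Int.cast_zero, abs_zero]
      exact div_nonneg (by linarith) h.pos.le
    · rw [Int.cast_zero, abs_zero]
      positivity
  · set y : ℤ := κ * (2 * m - q) with hydef
    set zc : Fin (2 * (n + 1)) → ℤ := fun j => coord N G e P (s - 2 * L) y j + o j with hzc
    obtain ⟨w, hw⟩ := hH3 (target φ (s - 2 * L : ℤ) y)
    have hyq := hy m hm0 hmq
    have h1 : ∀ j, |(zc j : ℝ) - w j| ≤ B + 2 := by
      intro j
      have h2 := hcoord y w hyq hw j
      have h3 : |(o j : ℝ)| ≤ B := by exact_mod_cast ho j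
      have h4 := abs_add_le _ _ |>.trans (add_le_add h2 h3)
      rw [hzc]
      push_cast
      rwa [show (coord N G e P (s - 2 * L) y j : ℝ) + o j - w j =
        coord N G e P (s - 2 * L) y j - w j + o j by ring, add_comm (B : ℝ)]
    have h2 : ∀ k, ‖sigmaPlus (σ k) a (ofCoords bK zc) - target φ (s - 2 * L : ℤ) y k‖ ≤ D :=
      hD ▸ hH.norm_sub_le hw h1
    obtain ⟨h3, h4⟩ := norm_le_of_near hq'
      (h.abs_add_abs_le (by linarith) (by linarith) hq' hqε hX hyq) h2
    rw [← hcT] at h3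
    have h5 : ∀ j, |(zc j : ℝ)| ≤ Ω₀ * (q : ℝ) ^ 2 := by
      intro j
      refine (hH2 (fun j => zc j) _ (fun k => ?_) j).trans (?_ : H * ((cT + D) * q ^ 2) ≤ _)
      · rw [← sigmaPlus_ofCoords]
        exact h3 k
      · rw [← mul_assoc]
        gcongr
        linarith
    have h6 := hΛ φ ε r e P zc (Ω₀ * (q : ℝ) ^ 2) hP1 he (fun j => (hrepr j).trans (by
      rw [mul_pow, ← pow_mul]
      gcongr
      exact le_self_pow₀ hΩ₀1 two_ne_zero)) h5
    -- The conjugates of the integer `r - t` are exactly the quantities whose signs are tested.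
    obtain ⟨t, ht⟩ := exists_norm_eq a (ofCoords bK zc)
    have hrt : ∀ k, σ k ((r - t : 𝓞 F) : F) =
        σ k r - ‖sigmaPlus (σ k) a (ofCoords bK zc)‖ ^ 2 := by
      intro k
      rw [← ht (σ k) (ha k), ← map_sub]
      rfl
    have h7 : ∀ k, 0 < slack e P (bF.repr r) zc k + P ^ 12 + 1 ↔
        0 ≤ σ k r - ‖sigmaPlus (σ k) a (ofCoords bK zc)‖ ^ 2 := by
      intro k
      refine pos_add_iff_nonneg (W := Ω₀ ^ n * (Ω₀ * (q : ℝ) ^ 4)) hP1 ((h6 k).trans ?_) ?_ ?_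
      · calc (P : ℝ) ^ 8 * (Λ * (Ω₀ * (q : ℝ) ^ 2) ^ 2)
            = (P : ℝ) ^ 8 * (Λ * Ω₀ ^ 2 * (q : ℝ) ^ 4) := by ring
          _ ≤ (P : ℝ) ^ 8 * (P : ℝ) ^ 4 := by
              gcongr
              exact hΩq _ (by linarith)
          _ = _ := by ring
      · have := hΩq (3 * Ω₀ ^ (n + 1)) (by linarith)
        calc _ = 3 * Ω₀ ^ (n + 1) * (q : ℝ) ^ 4 := by ring
          _ ≤ _ := this
      · intro hv
        rw [← hrt] at hv ⊢
        -- The first conjugate of `r - t` is at most `Ω₀ * q ^ 4` and the others at most `Ω₀`, which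
        -- is where `W` comes from.
        refine one_le_abs_mul σ bF (fun h0 => hv (by rw [h0]; simp)) hΩ₀1
          (one_le_mul_of_one_le_of_one_le hΩ₀1 hq4') ?_ (fun k hk => ?_) k
        · rw [hrt]
          have h8 : ‖sigmaPlus (σ 0) a (ofCoords bK zc)‖ ^ 2 ≤ ((cT + D) * q ^ 2) ^ 2 := by
            gcongr
            exact h3 0
          have h9 := hσ 0
          rw [abs_le] at h9 ⊢
          have h10 : (c₁ + (cT + D) ^ 2) * (q : ℝ) ^ 4 ≤ Ω₀ * (q : ℝ) ^ 4 := by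
            gcongr
            linarith
          have h11 : 0 ≤ (cT + D) ^ 2 * (q : ℝ) ^ 4 := by positivity
          have h12 := sq_nonneg ‖sigmaPlus (σ 0) a (ofCoords bK zc)‖
          rw [add_mul] at h10
          rw [mul_pow, ← pow_mul, show 2 * 2 = 4 from rfl] at h8
          constructor <;> linarith
        · rw [hrt]
          have h8 : ‖sigmaPlus (σ k) a (ofCoords bK zc)‖ ^ 2 ≤ (cT + D) ^ 2 := by
            gcongr
            exact (h4 k hk).trans (by linarith)
          have h9 := hσ' k hk
          rw [abs_le] at h9 ⊢
          have h12 := sq_nonneg ‖sigmaPlus (σ k) a (ofCoords bK zc)‖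
          constructor <;> linarith
    rw [mem_Cand_iff h.totally_pos, and_comm]
    refine and_congr Iff.rfl (forall_congr' fun k => ?_)
    rw [h7, sub_nonneg, Real.le_sqrt (norm_nonneg _) (h.totally_pos k).le]
  · obtain ⟨m, hm0, hmq, hm⟩ := h.exists_near (by linarith) hSle hκ1 (by linarith) hq hqε hX hz
    obtain ⟨w, hw⟩ := hH3 (target φ (s - 2 * L : ℤ) (κ * (2 * m - q) : ℤ))
    -- The offset is defined as the difference; only its bound by `B` has content.
    refine ⟨m, fun j => bK.repr z j - coord N G e P (s - 2 * L) (κ * (2 * m - q)) j, hm0, hmq,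
      fun j => ?_, ?_⟩
    · have h1 := hH.abs_sub_le (z := bK.repr z) hw (by rw [ofCoords_repr]; exact hm) j
      have h2 := hcoord _ w (hy m hm0 hmq) hw j
      rw [abs_sub_comm] at h2
      have h3 := abs_add_le _ _ |>.trans (add_le_add h1 h2)
      rw [sub_add_sub_cancel] at h3
      have h4 := h3.trans hB
      exact_mod_cast h4
    · simp only [add_sub_cancel]
      exact (ofCoords_repr bK z).symm

end Constants

end RandomIntegerPoint
end

noncomputable section
namespace RandomIntegerPoint

/-! ### The program

With `b = 2 (n + 1)`, the registers from `b` on hold: the precision (`b`), a power `P` of two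
(`b + 1`), the random integer `u` (`b + 2`), a loop flag (`b + 3`), the last coin toss (`b + 4`),
the square root `s` with the increment in its computation and the radicand
(`b + 5`, `b + 6`, `b + 7`), the constant `1` (`b + 8`), and two vectors of coordinates. -/

section Program

variable {n : ℕ}

/-! ### Expressions for powers, table lookup, coordinates and slacks. -/

namespace Expr

/-- Powers of expressions. -/
def npow (e : Expr n) : ℕ → Expr n
  | 0 => const 1
  | k + 1 => npow e k * e

@[simp] theorem eval_npow (e : Expr n) (k : ℕ) (O : Oracle n) (ρ : ℕ) (g : ℕ → ℤ) :
    (e.npow k).eval O ρ g = e.eval O ρ g ^ k := by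
  induction k with
  | zero => simp [npow, eval]
  | succ k ih => simp [npow, ih, pow_succ]

@[simp] theorem uses_npow {e : Expr n} {k : ℕ} {S : ℕ → Prop} (h : e.Uses S) :
    (e.npow k).Uses S := by
  induction k with
  | zero => trivial
  | succ k ih => exact ⟨ih, h⟩

/-- The entry of a table at a position in `[0, m)`. -/
def table (m : ℕ) (tab : ℕ → ℤ) (v : Expr n) : Expr n :=
  fsum fun t : Fin m => ite (const 1 - (v - const t) * (v - const t)) (const (tab t)) (const 0)

/-- For integers, `1 - (v - t) ^ 2` is positive only if `v = t`, so exactly one summand survives. -/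
theorem eval_table {m : ℕ} {tab : ℕ → ℤ} {v : Expr n} {O : Oracle n} {ρ : ℕ} {g : ℕ → ℤ}
    (h0 : 0 ≤ v.eval O ρ g) (h1 : v.eval O ρ g < m) :
    (table m tab v).eval O ρ g = tab (v.eval O ρ g).toNat := by
  simp only [table, eval_fsum, eval, eval_sub]
  rw [Finset.sum_eq_single ⟨(v.eval O ρ g).toNat, by omega⟩]
  · simp [h0]
  · intro t _ ht
    refine if_neg fun h => ht ?_
    have h2 : v.eval O ρ g - t = 0 := by
      by_contra h3
      have : 0 < (v.eval O ρ g - t) * (v.eval O ρ g - t) := mul_self_pos.2 h3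
      omega
    ext
    simp only
    omega
  · simp

theorem uses_table {m : ℕ} {tab : ℕ → ℤ} {v : Expr n} {S : ℕ → Prop} (h : v.Uses S) :
    (table m tab v).Uses S := by
  simp [table, Uses, h]

/-- The expression for `coord`. -/
def coord (N : ℤ) (G : Fin (2 * (n + 1)) → Fin (2 * (n + 1)) → ℤ) (P X y : Expr n)
    (j : Fin (2 * (n + 1))) : Expr n :=
  div (fsum fun i => const (G j i) *
    (approx (.embRe 0 i) * (X * approx .cosHalf + y * approx .sinHalf) +
      approx (.embIm 0 i) * (y * approx .cosHalf - X * approx .sinHalf)))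
    (const N * P.npow 16)

theorem eval_coord (N : ℤ) (G : Fin (2 * (n + 1)) → Fin (2 * (n + 1)) → ℤ) (P X y : Expr n)
    (j : Fin (2 * (n + 1))) (O : Oracle n) (ρ : ℕ) (g : ℕ → ℤ) :
    (coord N G P X y j).eval O ρ g = RandomIntegerPoint.coord N G
      (fun q => O.approx q (g ρ).toNat) (P.eval O ρ g) (X.eval O ρ g) (y.eval O ρ g) j := by
  simp [coord, RandomIntegerPoint.coord, eval]

theorem uses_coord {N : ℤ} {G : Fin (2 * (n + 1)) → Fin (2 * (n + 1)) → ℤ} {P X y : Expr n}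
    {j : Fin (2 * (n + 1))} {S : ℕ → Prop} (hP : P.Uses S) (hX : X.Uses S) (hy : y.Uses S) :
    (coord N G P X y j).Uses S := by
  simp [coord, Uses, hX, hy, uses_npow hP]

/-- The expression for `slack`. -/
def slack (P : Expr n) (c : Fin (n + 1) → Expr n) (w : Fin (2 * (n + 1)) → Expr n)
    (k : Fin (n + 1)) : Expr n :=
  P.npow 8 * fsum (fun j => c j * approx (.embF k j)) -
    (fsum (fun j => w j * approx (.embRe k j)) * fsum (fun j => w j * approx (.embRe k j)) +
      fsum (fun j => w j * approx (.embIm k j)) * fsum (fun j => w j * approx (.embIm k j)))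

theorem eval_slack (P : Expr n) (c : Fin (n + 1) → Expr n) (w : Fin (2 * (n + 1)) → Expr n)
    (k : Fin (n + 1)) (O : Oracle n) (ρ : ℕ) (g : ℕ → ℤ) :
    (slack P c w k).eval O ρ g = RandomIntegerPoint.slack (fun q => O.approx q (g ρ).toNat)
      (P.eval O ρ g) (fun j => (c j).eval O ρ g) (fun j => (w j).eval O ρ g) k := by
  simp [slack, RandomIntegerPoint.slack, eval]

theorem uses_slack {P : Expr n} {c : Fin (n + 1) → Expr n} {w : Fin (2 * (n + 1)) → Expr n}
    {k : Fin (n + 1)} {S : ℕ → Prop} (hP : P.Uses S) (hc : ∀ j, (c j).Uses S)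
    (hw : ∀ j, (w j).Uses S) : (slack P c w k).Uses S := by
  simp [slack, Uses, hc, hw, uses_npow hP]

end Expr

/-- The integer with the binary digits `ω 0, …, ω (k - 1)`. -/
def binValue (ω : ℕ → Bool) : ℕ → ℤ
  | 0 => 0
  | k + 1 => binValue ω k + binValue ω k + if ω k then 1 else 0

theorem binValue_nonneg_and_lt (ω : ℕ → Bool) (k : ℕ) :
    0 ≤ binValue ω k ∧ binValue ω k < 2 ^ k := by
  induction k with
  | zero => simp [binValue]
  | succ k ih =>
    rw [binValue, pow_succ]
    split_ifs <;> omega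

/-- Every value of the random integer is produced by some coin sequence. The last toss is the lowest
digit, so the induction removes it by halving `u`. -/
theorem exists_binValue_eq (k : ℕ) (u : ℤ) (h0 : 0 ≤ u) (h1 : u < 2 ^ k) :
    ∃ ω, binValue ω k = u := by
  induction k generalizing u with
  | zero => exact ⟨fun _ => false, by simp at h1; simp [binValue]; omega⟩
  | succ k ih =>
    rw [pow_succ] at h1
    obtain ⟨ω, hω⟩ := ih (u / 2) (by omega) (by omega)
    have key : ∀ (β : Bool) m, m ≤ k → binValue (Function.update ω k β) m = binValue ω m := by
      intro β m
      induction m with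
      | zero => exact fun _ => rfl
      | succ m ihm =>
        intro hm
        rw [binValue, binValue, ihm (by omega), Function.update_of_ne (by omega)]
    refine ⟨Function.update ω k (decide (u % 2 = 1)), ?_⟩
    rw [binValue, key _ k le_rfl, hω, Function.update_self]
    by_cases h : u % 2 = 1
    · simp only [h, decide_true, if_true]
      omega
    · simp only [h, decide_false]
      simp
      omega

/-- The first loop: toss coins until the precision exceeds `2 ^ K / ε`. -/
def tossBody (b K : ℕ) : Prog n :=
  -- Register `b` counts the tosses and is at the same time the precision at which `ε` is requested.
  -- The loop flag `2 ^ K + 1 - approx` is positive as long as the approximation is at most `2 ^ K`.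
  .seq (.toss (b + 4)) (.seq (.add b b (b + 8)) (block b (3 * b + 9)
    [(b + 2, .reg (b + 2) + .reg (b + 2) + .reg (b + 4)), (b + 1, .reg (b + 1) + .reg (b + 1)),
      (b + 3, .const (2 ^ K + 1) - .approx .eps)]))

/-- The invariant of the first loop. -/
structure TossInv (ω : ℕ → Bool) (b p L : ℕ) (g₀ : ℕ → ℤ) (i : ℕ) (g : ℕ → ℤ) (k : ℕ) :
    Prop where
  count : k = i
  prec : g b = i
  pow : g (b + 1) = 2 ^ i
  val : g (b + 2) = binValue ω i
  one : g (b + 8) = 1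
  flag : 0 < g (b + 3) ↔ i < p
  frame : ∀ j < b, g j = g₀ j
  size : ∀ j < 3 * b + 9, bits (g j) ≤ L

theorem bits_two_pow_le (i : ℕ) : bits (2 ^ i) ≤ i + 1 := by
  rw [bits_le_iff, abs_of_pos (by positivity), pow_succ]
  have : (0 : ℤ) < 2 ^ i := by positivity
  omega

theorem natAbs_le_of_eq_natCast {x : ℤ} {i L : ℕ} (h : x = i) (hi : i ≤ L) : x.natAbs ≤ L := by
  omega

theorem bits_natCast_le (i : ℕ) : bits (i : ℤ) ≤ i := by
  rw [bits, Int.natAbs_natCast, Nat.size_le]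
  exact Nat.lt_two_pow_self

/-- The loop flag depends on the oracle but not on the tosses, so the number `p` of tosses is the
same for all coin sequences; the random integer is then uniform on `[0, 2^p)`. -/
theorem exists_ends_tossLoop (b K : ℕ) : ∃ A : ℕ, ∀ (O : Oracle n) (ω : ℕ → Bool) (p L : ℕ)
    (g₀ g : ℕ → ℤ), (∀ i, 1 ≤ i → i < p → O.approx .eps i ≤ 2 ^ K) →
    2 ^ K < O.approx .eps p → (∀ i ≤ p, ∀ q, bits (O.approx q i) + K + 4 ≤ L) → p + 4 ≤ L →
    TossInv ω b p L g₀ 0 g 0 →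
    Ends O ω (.loop (b + 3) (tossBody b K)) g 0 ((p + 1) * (A * L ^ 2)) (TossInv ω b p L g₀ p) := by
  obtain ⟨A, -, hA⟩ := exists_ends_block (n := n) b (3 * b + 9)
    [(b + 2, .reg (b + 2) + .reg (b + 2) + .reg (b + 4)), (b + 1, .reg (b + 1) + .reg (b + 1)),
      (b + 3, .const (2 ^ K + 1) - .approx .eps)] (by
        simp [Expr.Uses]
        omega)
  refine ⟨7 + A, fun O ω p L g₀ g hlt hp hL hpL h0 => ?_⟩
  have hL1 : 1 ≤ L := by omega
  have hL2 : L ≤ L ^ 2 := Nat.le_self_pow two_ne_zero L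
  refine (Ends.loop (m := p) (C := 5 + 2 * L + A * L ^ 2) (B := L) (TossInv ω b p L g₀) ?_ ?_ ?_
    (Nat.zero_le p) h0).mono ?_ fun _ _ => id
  · exact fun i _ g k h => h.size _ (by omega)
  · intro i hi g k h
    refine ⟨h.flag.2 hi, ?_⟩
    refine ((Ends.toss (b + 4) g k).seq (C' := 4 + 2 * L + A * L ^ 2 - 1) ?_).mono (by omega)
      fun _ _ => id
    rintro g₁ k₁ ⟨rfl, rfl⟩
    set t : ℤ := if ω k then 1 else 0 with ht
    have hg₁ : ∀ j, j ≠ b + 4 → Function.update g (b + 4) t j = g j := fun j hj =>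
      Function.update_of_ne hj _ _
    have hadd : Ends O ω (.add b b (b + 8)) (Function.update g (b + 4) t) (k + 1) (1 + 2 * L)
        fun g' k' => g' = Function.update (Function.update g (b + 4) t) b ((i + 1 : ℕ) : ℤ) ∧
          k' = k + 1 := by
      refine ⟨_, _, 1 + bits (g b) + bits (g (b + 8)), Runs.of_step (by omega) fun l t => ?_, ?_,
        rfl, rfl⟩
      · simp only [coinStep, hg₁ b (by omega), hg₁ (b + 8) (by omega), h.prec, h.one]
        simp [add_assoc]
      · have h1 := h.size b (by omega)
        have h2 := h.size (b + 8) (by omega)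
        omega
    refine (hadd.seq (C' := A * L ^ 2) ?_).mono (by omega) fun _ _ => id
    rintro g₂ k₂ ⟨rfl, rfl⟩
    set g₂ := Function.update (Function.update g (b + 4) t) b ((i + 1 : ℕ) : ℤ) with hg₂
    have e0 : g₂ b = ((i + 1 : ℕ) : ℤ) := by simp [hg₂]
    have e4 : g₂ (b + 4) = t := by simp [hg₂]
    have e' : ∀ j, j ≠ b → j ≠ b + 4 → g₂ j = g j := fun j h1 h2 => by
      rw [hg₂, Function.update_of_ne h1, Function.update_of_ne h2]
    have htb : bits t ≤ L := by
      rw [ht]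
      split_ifs
      · rw [bits_one]; omega
      · rw [bits_zero]; omega
    have hsize : Expr.SizeLE O b (3 * b + 9) L g₂ := by
      refine ⟨by omega, hL1, fun j hj => ?_, natAbs_le_of_eq_natCast e0 (by omega), fun q => ?_⟩
      · by_cases h1 : j = b
        · rw [h1, e0]
          exact (bits_natCast_le _).trans (by omega)
        by_cases h2 : j = b + 4
        · rw [h2, e4]
          exact htb
        · rw [e' j h1 h2]
          exact h.size j hj
      · rw [e0, Int.toNat_natCast]
        have := hL (i + 1) (by omega) q
        omega
    refine (hA O ω g₂ L (k + 1) hsize).mono le_rfl ?_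
    rintro g₃ k₃ ⟨rfl, h3, -⟩
    have hval : binValue ω (i + 1) = g (b + 2) + g (b + 2) + t := by
      rw [binValue, h.val, ht, h.count]
    have f0 : g₃ b = ((i + 1 : ℕ) : ℤ) := by
      rw [h3 b (by omega)]
      simp [evalBlock, e0]
    have f1 : g₃ (b + 1) = 2 ^ (i + 1) := by
      rw [h3 _ (by omega)]
      simp [evalBlock, Expr.eval, e', h.pow]
      ring
    have f2 : g₃ (b + 2) = binValue ω (i + 1) := by
      rw [h3 _ (by omega)]
      simp [evalBlock, Expr.eval, e', e4, hval]
    have f3 : g₃ (b + 3) = 2 ^ K + 1 - O.approx .eps (i + 1) := by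
      rw [h3 _ (by omega)]
      simp [evalBlock, Expr.eval, e0]
    have f' : ∀ j < 3 * b + 9, j ≠ b + 1 → j ≠ b + 2 → j ≠ b + 3 → g₃ j = g₂ j := by
      intro j hj h1 h2 h4
      rw [h3 j hj]
      simp [evalBlock, h1, h2, h4]
    refine ⟨by rw [h.count], f0, f1, f2, ?_, ?_, fun j hj => ?_, fun j hj => ?_⟩
    · rw [f' _ (by omega) (by omega) (by omega) (by omega), e' _ (by omega) (by omega), h.one]
    · rw [f3]
      constructor
      · intro h4
        by_contra h5
        obtain rfl : i + 1 = p := by omega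
        omega
      · intro h4
        have := hlt (i + 1) (by omega) h4
        omega
    · rw [f' _ (by omega) (by omega) (by omega) (by omega), e' _ (by omega) (by omega),
        h.frame j hj]
    · by_cases h1 : j = b + 1
      · rw [h1, f1]
        exact (bits_two_pow_le _).trans (by omega)
      by_cases h2 : j = b + 2
      · rw [h2, f2]
        obtain ⟨h4, h5⟩ := binValue_nonneg_and_lt ω (i + 1)
        have : bits (binValue ω (i + 1)) ≤ i + 1 := by
          rwa [bits_le_iff, abs_of_nonneg h4]
        omega
      by_cases h4 : j = b + 3
      · rw [h4, f3]
        have h5 := bits_sub_le (2 ^ K + 1) (O.approx .eps (i + 1))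
        have h6 := bits_add_le (2 ^ K) 1
        have h7 := bits_two_pow_le K
        have h8 := hL (i + 1) (by omega) .eps
        rw [bits_one] at h6
        omega
      · rw [f' j hj h1 h2 h4]
        exact hsize.reg j hj
  · intro g k h
    rw [h.flag]
    omega
  · rw [Nat.sub_zero]
    refine Nat.mul_le_mul_left _ ?_
    nlinarith

/-- The body of the second loop, which computes the digits of a square root. -/
def sqrtBody (b : ℕ) : List (ℕ × Expr n) :=
  [(b + 5, .ite (.reg (b + 7) - (.reg (b + 5) + .reg (b + 6)) * (.reg (b + 5) + .reg (b + 6)) +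
      .const 1) (.reg (b + 5) + .reg (b + 6)) (.reg (b + 5))),
    (b + 6, .div (.reg (b + 6)) (.const 2))]

/-- The invariant of the second loop. -/
structure SqrtInv (b m L : ℕ) (g₀ : ℕ → ℤ) (k₀ i : ℕ) (g : ℕ → ℤ) (k : ℕ) : Prop where
  count : k = k₀
  nonneg : 0 ≤ g (b + 5)
  le : g (b + 5) * g (b + 5) ≤ g₀ (b + 7)
  lt : g₀ (b + 7) < (g (b + 5) + 2 ^ (m - i)) * (g (b + 5) + 2 ^ (m - i))
  incr : g (b + 6) = 2 ^ (m - i) / 2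
  frame : ∀ j < 3 * b + 9, j ≠ b + 5 → j ≠ b + 6 → g j = g₀ j
  size : ∀ j < 3 * b + 9, bits (g j) ≤ L

/-- The root is found digit by digit: each round halves the width of the interval that contains it.
The increment register doubles as the loop flag, because `2 ^ 0 / 2 = 0` ends the loop when the
width is `1`. -/
theorem exists_ends_sqrtLoop (b : ℕ) : ∃ A : ℕ, ∀ (O : Oracle n) (ω : ℕ → Bool) (m L k₀ : ℕ)
    (g₀ g : ℕ → ℤ), Expr.SizeLE O b (3 * b + 9) L g₀ → m ≤ L → SqrtInv b m L g₀ k₀ 0 g k₀ →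
    Ends O ω (.loop (b + 6) (block b (3 * b + 9) (sqrtBody b))) g k₀ ((m + 1) * (A * L ^ 2))
      (SqrtInv b m L g₀ k₀ m) := by
  obtain ⟨A, -, hA⟩ := exists_ends_block (n := n) b (3 * b + 9) (sqrtBody b) (by
    simp [sqrtBody, Expr.Uses]
    omega)
  refine ⟨2 + A, fun O ω m L k₀ g₀ g hg₀ hm h0 => ?_⟩
  have hL1 := hg₀.one_le
  have hL2 : L ≤ L ^ 2 := Nat.le_self_pow two_ne_zero L
  refine (Ends.loop (m := m) (C := A * L ^ 2) (B := L) (SqrtInv b m L g₀ k₀) ?_ ?_ ?_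
    (Nat.zero_le m) h0).mono ?_ fun _ _ => id
  · exact fun i _ g k h => h.size _ (by omega)
  · intro i hi g k h
    obtain ⟨d, hd⟩ : ∃ d, m - i = d + 1 := ⟨m - i - 1, by omega⟩
    have hd' : m - (i + 1) = d := by omega
    have hincr : g (b + 6) = 2 ^ d := by
      rw [h.incr, hd, pow_succ]
      omega
    have hpos : (0 : ℤ) < 2 ^ d := by positivity
    refine ⟨by rw [hincr]; exact hpos, ?_⟩
    have hprec : g b = g₀ b := h.frame b (by omega) (by omega) (by omega)
    have hsize : Expr.SizeLE O b (3 * b + 9) L g :=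
      ⟨hg₀.lt, hg₀.one_le, h.size, by rw [hprec]; exact hg₀.prec, by rw [hprec]; exact hg₀.approx⟩
    refine (hA O ω g L k hsize).mono le_rfl ?_
    rintro g₁ k₁ ⟨rfl, h3, -⟩
    have hN : g (b + 7) = g₀ (b + 7) := h.frame _ (by omega) (by omega) (by omega)
    have f5 : g₁ (b + 5) = if (g (b + 5) + 2 ^ d) * (g (b + 5) + 2 ^ d) ≤ g₀ (b + 7) then
        g (b + 5) + 2 ^ d else g (b + 5) := by
      rw [h3 _ (by omega)]
      simp only [sqrtBody, evalBlock, Expr.eval, Expr.eval_sub, hincr, hN]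
      rw [Function.update_of_ne (by omega), Function.update_self]
      refine if_congr ?_ rfl rfl
      omega
    have f6 : g₁ (b + 6) = 2 ^ d / 2 := by
      rw [h3 _ (by omega)]
      simp [sqrtBody, evalBlock, Expr.eval, hincr, Int.fdiv_eq_ediv_of_nonneg]
    have f' : ∀ j < 3 * b + 9, j ≠ b + 5 → j ≠ b + 6 → g₁ j = g j := by
      intro j hj h1 h2
      rw [h3 j hj]
      simp [sqrtBody, evalBlock, h1, h2]
    have hnn : 0 ≤ g₁ (b + 5) := by
      have := h.nonneg
      rw [f5]
      split_ifs <;> omega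
    have hle : g₁ (b + 5) * g₁ (b + 5) ≤ g₀ (b + 7) := by
      rw [f5]
      split_ifs with hc
      · exact hc
      · exact h.le
    refine ⟨h.count, hnn, hle, ?_, by rw [hd', f6], fun j hj h1 h2 => ?_, fun j hj => ?_⟩
    · have hlt := h.lt
      rw [hd, pow_succ] at hlt
      rw [hd', f5]
      split_ifs with hc
      · rwa [show g (b + 5) + 2 ^ d + 2 ^ d = g (b + 5) + 2 ^ d * 2 by ring]
      · omega
    · rw [f' j hj h1 h2, h.frame j hj h1 h2]
    · by_cases h1 : j = b + 5
      · rw [h1]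
        refine (bits_le_of_abs_le ?_).trans (hg₀.reg (b + 7) (by omega))
        rw [abs_of_nonneg hnn, abs_of_nonneg ((mul_self_nonneg _).trans hle)]
        nlinarith
      by_cases h2 : j = b + 6
      · rw [h2, f6]
        refine (bits_le_of_abs_le (b := 2 ^ d) ?_).trans ((bits_two_pow_le d).trans (by omega))
        rw [abs_of_nonneg (by positivity), abs_of_pos hpos]
        omega
      · rw [f' j hj h1 h2]
        exact h.size j hj
  · intro g k h
    rw [h.incr]
    simp
  · rw [Nat.sub_zero]
    refine Nat.mul_le_mul_left _ ?_
    nlinarith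

end Program

end RandomIntegerPoint
end

noncomputable section
namespace RandomIntegerPoint

/-! ### The complete program and its cost. -/

section Procedure

variable {n : ℕ}

theorem evalBlock_append (O : Oracle n) (ρ : ℕ) (l₁ l₂ : List (ℕ × Expr n)) (g : ℕ → ℤ) :
    evalBlock O ρ (l₁ ++ l₂) g = evalBlock O ρ l₂ (evalBlock O ρ l₁ g) := by
  induction l₁ generalizing g with
  | nil => rfl
  | cons p l₁ ih => exact ih _

/-- The constants of the sampling procedure. -/
structure Constants (n : ℕ) where
  /-- the common denominator of `G` -/
  N : ℤ
  /-- up to `N`, a matrix of coordinates -/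
  G : Fin (2 * (n + 1)) → Fin (2 * (n + 1)) → ℤ
  /-- the distance from the boundary of the ball -/
  L : ℕ
  /-- half of the distance between consecutive targets -/
  κ : ℤ
  /-- the number of random bits used for the offset -/
  K : ℕ
  /-- the table of offsets -/
  tab : ℕ → Fin (2 * (n + 1)) → ℤ

/-- The coordinates of the point chosen by the random integer `u`. -/
def Constants.point (D : Constants n) (e : RealName n → ℤ) (P s u : ℤ) (j : Fin (2 * (n + 1))) :
    ℤ :=
  coord D.N D.G e P (s - 2 * D.L) (D.κ * (2 * (u / 2 ^ D.K) - P / 2 ^ D.K)) j +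
    D.tab (u % 2 ^ D.K).toNat j

open Classical in
/-- The coordinates of the point returned for the random integer `u`. -/
def Constants.result (D : Constants n) (O : Oracle n) (e : RealName n → ℤ) (P s u : ℤ)
    (c : Fin (n + 1) → ℤ) : Fin (2 * (n + 1)) → ℤ :=
  if (∀ k, 0 < slack e P c (D.point e P s u) k + P ^ 12 + 1) ∧ O.test (D.point e P s u) = true then
    D.point e P s u
  else coord D.N D.G e P (s - 2 * D.L) 0

/-- The assignments before the first loop. -/
def initBlock (b : ℕ) : List (ℕ × Expr n) :=
  [(b + 1, .const 1), (b + 3, .const 1), (b + 8, .const 1)]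

/-- The assignments between the two loops. -/
def radicandBlock (b : ℕ) : List (ℕ × Expr n) :=
  [(b + 7, .div (.fsum fun j : Fin (n + 1) => .reg j * .approx (.embF 0 j))
    (Expr.npow (.reg (b + 1)) 8)), (b + 5, .const 0), (b + 6, .reg (b + 1) * .reg (b + 1))]

/-- The expression for `⌊u / 2 ^ K⌋`. -/
def quotExpr (b K : ℕ) : Expr n := .div (.reg (b + 2)) (.const (2 ^ K))

/-- The expression for `Constants.point`. -/
def pointExpr (D : Constants n) (b : ℕ) (j : Fin (2 * (n + 1))) : Expr n :=
  Expr.coord D.N D.G (.reg (b + 1)) (.reg (b + 5) - .const (2 * D.L)) (.const D.κ *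
    (.const 2 * quotExpr b D.K - .div (.reg (b + 1)) (.const (2 ^ D.K)))) j +
  Expr.table (2 ^ D.K) (fun t => D.tab t j) (.reg (b + 2) - .const (2 ^ D.K) * quotExpr b D.K)

/-- The expression for the number of failed tests. -/
def failExpr (b : ℕ) : Expr n :=
  .fsum (fun k : Fin (n + 1) => .ite (Expr.slack (.reg (b + 1)) (fun j => .reg j)
    (fun j => .reg (b + 9 + j)) k + Expr.npow (.reg (b + 1)) 12 + .const 1) (.const 0) (.const 1)) +
  .ite (.test fun j => b + 9 + j) (.const 0) (.const 1)

/-- The expression for `Constants.result`. -/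
def resultExpr (D : Constants n) (b : ℕ) (j : Fin (2 * (n + 1))) : Expr n :=
  .ite (.const 1 - failExpr b) (.reg (b + 9 + j))
    (Expr.coord D.N D.G (.reg (b + 1)) (.reg (b + 5) - .const (2 * D.L)) (.const 0) j)

/-- The assignments after the second loop. -/
def finalBlock (D : Constants n) (b : ℕ) : List (ℕ × Expr n) :=
  family (b + 9) (pointExpr D b) ++ (family (b + 9 + b) (resultExpr D b) ++
    family 0 fun j : Fin (2 * (n + 1)) => .reg (b + 9 + b + j))

theorem eval_pointExpr (D : Constants n) (b : ℕ) (j : Fin (2 * (n + 1))) (O : Oracle n)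
    (g : ℕ → ℤ) : (pointExpr D b j).eval O b g =
      D.point (fun q => O.approx q (g b).toNat) (g (b + 1)) (g (b + 5)) (g (b + 2)) j := by
  have hK : (0 : ℤ) < 2 ^ D.K := by positivity
  have hv : (Expr.reg (b + 2) - .const (2 ^ D.K) * quotExpr b D.K : Expr n).eval O b g =
      g (b + 2) % 2 ^ D.K := by
    simp only [quotExpr, Expr.eval_sub, Expr.eval,
      Int.fdiv_eq_ediv_of_nonneg _ hK.le]
    rw [Int.emod_def]
  rw [pointExpr, Expr.eval_add, Expr.eval_coord, Expr.eval_table, hv]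
  · simp only [Constants.point, quotExpr, Expr.eval_sub, Expr.eval,
      Int.fdiv_eq_ediv_of_nonneg _ hK.le]
  · rw [hv]
    exact Int.emod_nonneg _ hK.ne'
  · rw [hv]
    exact_mod_cast Int.emod_lt_of_pos _ hK

theorem uses_pointExpr (D : Constants n) (b : ℕ) (j : Fin (2 * (n + 1))) {S : ℕ → Prop}
    (h1 : S (b + 1)) (h2 : S (b + 2)) (h5 : S (b + 5)) : (pointExpr D b j).Uses S :=
  ⟨Expr.uses_coord h1 ⟨h5, trivial⟩ ⟨trivial, ⟨trivial, h2, trivial⟩, h1, trivial⟩,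
    Expr.uses_table ⟨h2, trivial, h2, trivial⟩⟩

open Classical in
-- A sum of indicators of failure is less than `1` exactly when no test fails; this packs the
-- conjunction into one sign test.
theorem eval_failExpr (b : ℕ) (O : Oracle n) (g : ℕ → ℤ) :
    0 < 1 - (failExpr b).eval O b g ↔
      (∀ k, 0 < slack (fun q => O.approx q (g b).toNat) (g (b + 1)) (fun j => g j)
        (fun j => g (b + 9 + j)) k + g (b + 1) ^ 12 + 1) ∧
      O.test (fun j => g (b + 9 + j)) = true := by
  have h1 : (failExpr b).eval O b g = (∑ k, if 0 < slack (fun q => O.approx q (g b).toNat)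
      (g (b + 1)) (fun j => g j) (fun j => g (b + 9 + j)) k + g (b + 1) ^ 12 + 1 then 0 else 1) +
      if O.test (fun j => g (b + 9 + j)) = true then 0 else 1 := by
    rw [failExpr, Expr.eval_add, Expr.eval_fsum]
    congr 1
    · refine Finset.sum_congr rfl fun k _ => ?_
      simp only [Expr.eval, Expr.eval_slack, Expr.eval_npow]
    · simp only [Expr.eval]
      split_ifs <;> simp_all
  have h2 : ∀ k, (0 : ℤ) ≤ if 0 < slack (fun q => O.approx q (g b).toNat)
      (g (b + 1)) (fun j => g j) (fun j => g (b + 9 + j)) k + g (b + 1) ^ 12 + 1 then 0 else 1 :=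
    fun k => by split_ifs <;> simp
  have h3 := Finset.sum_nonneg fun k (_ : k ∈ Finset.univ) => h2 k
  have h4 := Finset.sum_eq_zero_iff_of_nonneg fun k (_ : k ∈ Finset.univ) => h2 k
  rw [h1]
  constructor
  · intro h
    have h5 : O.test (fun j => g (b + 9 + j)) = true := by
      by_contra h6
      rw [if_neg h6] at h
      omega
    rw [if_pos h5] at h
    refine ⟨fun k => ?_, h5⟩
    have := h4.1 (by omega) k (Finset.mem_univ k)
    by_contra h6
    rw [if_neg h6] at this
    omega
  · rintro ⟨h5, h6⟩
    rw [if_pos h6, h4.2 fun k _ => if_pos (h5 k)]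
    omega

theorem uses_failExpr (b : ℕ) {S : ℕ → Prop} (h1 : S (b + 1))
    (hc : ∀ j : Fin (n + 1), S j) (hz : ∀ j : Fin (2 * (n + 1)), S (b + 9 + j)) :
    (failExpr b : Expr n).Uses S := by
  refine ⟨(Expr.uses_fsum _ _).2 fun k => ⟨⟨⟨Expr.uses_slack h1 hc hz, ?_⟩, trivial⟩, trivial,
    trivial⟩, hz, trivial, trivial⟩
  exact Expr.uses_npow h1

theorem uses_resultExpr (D : Constants n) (b : ℕ) (j : Fin (2 * (n + 1))) {S : ℕ → Prop}
    (h1 : S (b + 1)) (h5 : S (b + 5)) (hc : ∀ j : Fin (n + 1), S j)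
    (hz : ∀ j : Fin (2 * (n + 1)), S (b + 9 + j)) : (resultExpr D b j).Uses S :=
  ⟨⟨trivial, uses_failExpr b h1 hc hz⟩, hz j, Expr.uses_coord h1 ⟨h5, trivial⟩ trivial⟩

/-- The result is first stored in auxiliary registers and moved to the output registers last,
because the registers `0, …, n` hold the coordinates of `r` until all tests are done. -/
theorem evalBlock_finalBlock (D : Constants n) {b : ℕ} (hb : 2 * (n + 1) ≤ b) (O : Oracle n)
    (g : ℕ → ℤ) (j : Fin (2 * (n + 1))) : evalBlock O b (finalBlock D b) g j =
      D.result O (fun q => O.approx q (g b).toNat) (g (b + 1)) (g (b + 5)) (g (b + 2))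
        (fun j => g j) j := by
  rw [finalBlock, evalBlock_append, evalBlock_append]
  set g₁ := evalBlock O b (family (b + 9) (pointExpr D b)) g with hg₁
  set g₂ := evalBlock O b (family (b + 9 + b) (resultExpr D b)) g₁ with hg₂
  have f1 : ∀ j : Fin (2 * (n + 1)), g₁ (b + 9 + j) =
      D.point (fun q => O.approx q (g b).toNat) (g (b + 1)) (g (b + 5)) (g (b + 2)) j := by
    intro j
    rw [hg₁, evalBlock_family (S := (· < b + 9)) (by omega) (by omega), eval_pointExpr]
    exact fun j => uses_pointExpr D b j (by omega) (by omega) (by omega)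
  have f1' : ∀ i < b + 9, g₁ i = g i := fun i hi =>
    evalBlock_family_of_notMem fun j => by omega
  have f2 : g₂ (b + 9 + b + j) = (resultExpr D b j).eval O b g₁ := by
    rw [hg₂]
    exact evalBlock_family (S := (· < b + 9 + b)) (by omega) (by omega) (fun j =>
      uses_resultExpr D b j (by omega) (by omega) (by omega) (by omega)) j
  have f3 := evalBlock_family (O := O) (ρ := b) (m := 2 * (n + 1)) (x₀ := 0)
    (e := fun j : Fin (2 * (n + 1)) => .reg (b + 9 + b + j)) (g := g₂) (S := (b ≤ ·)) le_rfl
    (by omega) (fun j => show b ≤ b + 9 + b + j by omega) j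
  rw [zero_add] at f3
  rw [f3, Expr.eval, f2, resultExpr, Expr.eval]
  have hc : ∀ j : Fin (n + 1), g₁ j = g j := fun j => f1' _ (by omega)
  have hp : (fun j : Fin (2 * (n + 1)) => g₁ (b + 9 + j)) =
      D.point (fun q => O.approx q (g b).toNat) (g (b + 1)) (g (b + 5)) (g (b + 2)) := funext f1
  have key := eval_failExpr b O g₁
  simp only [hc, hp, f1' b (by omega), f1' (b + 1) (by omega)] at key
  rw [Constants.result]
  simp only [Expr.eval_sub, Expr.eval_coord]
  simp only [Expr.eval, f1' b (by omega), f1' (b + 1) (by omega), f1' (b + 5) (by omega), f1]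
  by_cases h : 0 < 1 - (failExpr b).eval O b g₁
  · rw [if_pos h, if_pos (key.1 h)]
  · rw [if_neg h, if_neg (mt key.2 h)]

/-- The sampling procedure. -/
def program (D : Constants n) (b : ℕ) : Prog n :=
  .seq (block b (3 * b + 9) (initBlock b)) (.seq (.loop (b + 3) (tossBody b D.K))
    (.seq (.seq (.add b b b) (.seq (.add b b b) (.add b b b)))
      (.seq (block b (3 * b + 9) (radicandBlock b))
        (.seq (.loop (b + 6) (block b (3 * b + 9) (sqrtBody b)))
          (block b (3 * b + 9) (finalBlock D b))))))

/-- With precision `8 * p` approximations are scaled by `2 ^ (8 * p) = P ^ 8`, as `IsApprox` demands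
for `P = 2 ^ p`. -/
theorem ends_octuple (O : Oracle n) (ω : ℕ → Bool) (b : ℕ) (g : ℕ → ℤ) (k p : ℕ) (h : g b = p) :
    Ends O ω (.seq (.add b b b) (.seq (.add b b b) (.add b b b))) g k (5 + 14 * p)
      fun g' k' => g' = Function.update g b ((8 * p : ℕ) : ℤ) ∧ k' = k := by
  have key : ∀ (g : ℕ → ℤ) (m : ℕ), g b = m → Runs O ω (.add b b b) g k
      (Function.update g b ((2 * m : ℕ) : ℤ)) k (1 + bits m + bits m) := by
    intro g m hm
    refine Runs.of_step (by omega) fun l t => ?_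
    simp only [coinStep, hm]
    push_cast
    simp [two_mul, add_assoc]
  refine ⟨_, _, _, (key g p h).seq ((key _ (2 * p) (by simp)).seq (key _ (2 * (2 * p))
    (by simp))), ?_, ?_, rfl⟩
  · have h1 := bits_natCast_le p
    have h2 := bits_natCast_le (2 * p)
    have h3 := bits_natCast_le (2 * (2 * p))
    omega
  · simp only [Function.update_idem]
    congr 2
    ring

/-- The cube arises from loops of `O(p + 1)` rounds, each of quadratic cost in numbers of `O(p + 1)`
bits. The root `s` is left existential, but the two inequalities determine it. -/
theorem exists_ends_program (D : Constants n) {b : ℕ} (hb : 2 * (n + 1) ≤ b) (V : ℕ) :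
    ∃ A : ℕ, ∀ (O : Oracle n) (ω : ℕ → Bool) (p : ℕ) (c : Fin (n + 1) → ℤ) (g : ℕ → ℤ),
    1 ≤ p → (∀ i, 1 ≤ i → i < p → O.approx .eps i ≤ 2 ^ D.K) → 2 ^ D.K < O.approx .eps p →
    (∀ i q, bits (O.approx q i) ≤ V + i) →
    0 ≤ normApprox (fun q => O.approx q (8 * p)) (2 ^ p) c →
    normApprox (fun q => O.approx q (8 * p)) (2 ^ p) c < 4 * (2 ^ p) ^ 4 →
    (∀ j, |c j| ≤ (2 ^ p) ^ 4) → (∀ j : Fin (n + 1), g j = c j) → (∀ j, n + 1 ≤ j → g j = 0) →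
    Ends O ω (program D b) g 0 (A * (p + 1) ^ 3) fun g' k' => k' = p ∧ ∃ s, 0 ≤ s ∧
      s * s ≤ normApprox (fun q => O.approx q (8 * p)) (2 ^ p) c ∧
      normApprox (fun q => O.approx q (8 * p)) (2 ^ p) c < (s + 1) * (s + 1) ∧
      ∀ j : Fin (2 * (n + 1)), g' j =
        D.result O (fun q => O.approx q (8 * p)) (2 ^ p) s (binValue ω p) c j := by
  obtain ⟨A₁, hA₁', hA₁⟩ := exists_ends_block (n := n) b (3 * b + 9) (initBlock b) (by
    simp [initBlock, Expr.Uses]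
    omega)
  obtain ⟨A₂, hA₂⟩ := exists_ends_tossLoop (n := n) b D.K
  obtain ⟨A₄, hA₄', hA₄⟩ := exists_ends_block (n := n) b (3 * b + 9) (radicandBlock b) (by
    have h (j : Fin (n + 1)) : (j : ℕ) < 3 * b + 9 := by omega
    have h' : (Expr.npow (.reg (b + 1)) 8 : Expr n).Uses (· < 3 * b + 9) :=
      Expr.uses_npow (show b + 1 < 3 * b + 9 by omega)
    simp [radicandBlock, Expr.Uses, h, h']
    omega)
  obtain ⟨A₅, hA₅⟩ := exists_ends_sqrtLoop (n := n) b
  obtain ⟨A₆, hA₆', hA₆⟩ := exists_ends_block (n := n) b (3 * b + 9) (finalBlock D b) (by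
    intro p hp
    simp only [finalBlock, family, List.mem_append, List.mem_ofFn'] at hp
    obtain ⟨j, rfl⟩ | ⟨j, rfl⟩ | ⟨j, rfl⟩ := hp
    · exact ⟨show b + 9 + (j : ℕ) < _ by omega, show b + 9 + (j : ℕ) ≠ _ by omega,
        uses_pointExpr D b j (by omega) (by omega) (by omega)⟩
    · exact ⟨show b + 9 + b + (j : ℕ) < _ by omega, show b + 9 + b + (j : ℕ) ≠ _ by omega,
        uses_resultExpr D b j (by omega) (by omega) (by omega) (by omega)⟩
    · exact ⟨show 0 + (j : ℕ) < _ by omega, show 0 + (j : ℕ) ≠ _ by omega,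
        show b + 9 + b + (j : ℕ) < _ by omega⟩)
  -- With this `C`, `L = C * (p + 1)` is at least `V + K + 12 + 12 * p`, which covers approximations
  -- at precision `8 * p` and the coordinates of `r`, of at most `4 * p + 1` bits.
  obtain ⟨C, hC⟩ : ∃ C, C = V + D.K + 12 := ⟨_, rfl⟩
  refine ⟨24 + A₁ * C ^ 2 + A₂ * C ^ 2 + A₄ * C ^ 2 + 2 * (A₅ * (A₄ * C) ^ 2) +
    A₆ * (A₄ * C) ^ 2, ?_⟩
  intro O ω p c g hp hlt hgt hV hN0 hN1 hc hg hg0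
  set N := normApprox (fun q => O.approx q (8 * p)) (2 ^ p) c with hN
  set L := C * (p + 1) with hL
  have hCL : C + 12 * p ≤ L := by
    rw [hL, mul_add, mul_one, add_comm]
    gcongr
    omega
  have hLL : L ≤ A₄ * L := Nat.le_mul_of_pos_left _ hA₄'
  have hP : (0 : ℤ) < 2 ^ p := by positivity
  have hcb : ∀ j, bits (c j) ≤ 4 * p + 1 := by
    intro j
    rw [bits_le_iff]
    refine (hc j).trans_lt ?_
    rw [← pow_mul, mul_comm]
    exact pow_lt_pow_right₀ one_lt_two (by omega)
  have hgb : ∀ j < 3 * b + 9, bits (g j) ≤ L := by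
    intro j hj
    by_cases h : j < n + 1
    · rw [hg ⟨j, h⟩]
      have := hcb ⟨j, h⟩
      omega
    · rw [hg0 j (by omega), bits_zero]
      omega
  have hs0 : Expr.SizeLE O b (3 * b + 9) L g := by
    have hb0 := hg0 b (by omega)
    refine ⟨by omega, by omega, hgb, by simp [hb0], fun q => ?_⟩
    rw [hb0]
    have := hV 0 q
    simp only [Int.toNat_zero]
    omega
  obtain ⟨x, hx⟩ : ∃ x, x = p + 1 := ⟨_, rfl⟩
  have hx1 : 1 ≤ x := by omega
  have hx2 : x ^ 2 ≤ x ^ 3 := Nat.pow_le_pow_right hx1 (by norm_num)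
  have hx3 : x ≤ x ^ 3 := Nat.le_self_pow (by norm_num) x
  refine ((hA₁ O ω g L 0 hs0).seq (C' := 1 + (p + 1) * (A₂ * L ^ 2) + (1 + (5 + 14 * p) +
    (1 + A₄ * L ^ 2 + (1 + (2 * p + 2) * (A₅ * (A₄ * L) ^ 2) + A₆ * (A₄ * L) ^ 2)))) ?_).mono
    ?_ fun _ _ => id
  swap
  · rw [hL, ← hx, show 2 * p + 2 = 2 * x by omega, show p = x - 1 by omega]
    have e1 : A₁ * (C * x) ^ 2 = A₁ * C ^ 2 * x ^ 2 := by ring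
    have e2 : x * (A₂ * (C * x) ^ 2) = A₂ * C ^ 2 * x ^ 3 := by ring
    have e4 : A₄ * (C * x) ^ 2 = A₄ * C ^ 2 * x ^ 2 := by ring
    have e5 : 2 * x * (A₅ * (A₄ * (C * x)) ^ 2) = 2 * (A₅ * (A₄ * C) ^ 2) * x ^ 3 := by ring
    have e6 : A₆ * (A₄ * (C * x)) ^ 2 = A₆ * (A₄ * C) ^ 2 * x ^ 2 := by ring
    have i1 := Nat.mul_le_mul_left (A₁ * C ^ 2) hx2
    have i4 := Nat.mul_le_mul_left (A₄ * C ^ 2) hx2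
    have i6 := Nat.mul_le_mul_left (A₆ * (A₄ * C) ^ 2) hx2
    rw [e1, e2, e4, e5, e6]
    simp only [add_mul]
    omega
  rintro g₁ k₁ ⟨rfl, h1, -⟩
  have f1 : g₁ (b + 1) = 1 := by
    rw [h1 _ (by omega)]
    simp [initBlock, evalBlock, Expr.eval]
  have f3 : g₁ (b + 3) = 1 := by
    rw [h1 _ (by omega)]
    simp [initBlock, evalBlock, Expr.eval]
  have f8 : g₁ (b + 8) = 1 := by
    rw [h1 _ (by omega)]
    simp [initBlock, evalBlock, Expr.eval]
  have f' : ∀ j < 3 * b + 9, j ≠ b + 1 → j ≠ b + 3 → j ≠ b + 8 → g₁ j = g j := by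
    intro j hj h2 h3 h4
    rw [h1 j hj]
    simp [initBlock, evalBlock, h2, h3, h4]
  have hinv : TossInv ω b p L g 0 g₁ 0 := by
    refine ⟨rfl, ?_, by rw [f1, pow_zero], ?_, f8, ?_, fun j hj => ?_, fun j hj => ?_⟩
    · rw [f' b (by omega) (by omega) (by omega) (by omega), hg0 b (by omega), Nat.cast_zero]
    · rw [f' _ (by omega) (by omega) (by omega) (by omega), hg0 _ (by omega), binValue]
    · rw [f3]
      omega
    · exact f' j (by omega) (by omega) (by omega) (by omega)
    · by_cases h2 : j = b + 1
      · rw [h2, f1, bits_one]; omega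
      by_cases h3 : j = b + 3
      · rw [h3, f3, bits_one]; omega
      by_cases h4 : j = b + 8
      · rw [h4, f8, bits_one]; omega
      rw [f' j hj h2 h3 h4]
      exact hgb j hj
  refine (hA₂ O ω p L g g₁ hlt hgt (fun i hi q => ?_) (by omega) hinv).seq ?_
  · have := hV i q
    omega
  intro g₂ k₂ h2
  obtain rfl := h2.count
  refine (ends_octuple O ω b g₂ k₂ k₂ h2.prec).seq ?_
  rintro g₃ k₃ ⟨hg₃, rfl⟩
  have t0 : g₃ b = ((8 * k₃ : ℕ) : ℤ) := by rw [hg₃, Function.update_self]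
  have t' : ∀ j, j ≠ b → g₃ j = g₂ j := fun j hj => by rw [hg₃, Function.update_of_ne hj]
  have hs3 : Expr.SizeLE O b (3 * b + 9) L g₃ := by
    refine ⟨by omega, by omega, fun j hj => ?_, natAbs_le_of_eq_natCast t0 (by omega), fun q => ?_⟩
    · by_cases h : j = b
      · rw [h, t0]
        exact (bits_natCast_le _).trans (by omega)
      · rw [t' j h]
        exact h2.size j hj
    · rw [t0, Int.toNat_natCast]
      have := hV (8 * k₃) q
      omega
  have tc : ∀ j : Fin (n + 1), g₃ j = c j := fun j => by
    rw [t' j (by omega), h2.frame j (by omega), hg]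
  refine (hA₄ O ω g₃ L k₃ hs3).seq ?_
  rintro g₄ k₄ ⟨rfl, h4, hs4⟩
  have u7 : g₄ (b + 7) = N := by
    rw [h4 _ (by omega)]
    have : (8 * (k₄ : ℤ)).toNat = 8 * k₄ := by omega
    simp [radicandBlock, evalBlock, Expr.eval, t0, t', h2.pow, tc, hN, normApprox, this]
  have u5 : g₄ (b + 5) = 0 := by
    rw [h4 _ (by omega)]
    simp [radicandBlock, evalBlock, Expr.eval]
  have u6 : g₄ (b + 6) = 2 ^ k₄ * 2 ^ k₄ := by
    rw [h4 _ (by omega)]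
    simp [radicandBlock, evalBlock, Expr.eval, t', h2.pow]
  have u' : ∀ j < 3 * b + 9, j ≠ b + 7 → j ≠ b + 5 → j ≠ b + 6 → g₄ j = g₃ j := by
    intro j hj h5 h6 h7
    rw [h4 j hj]
    simp [radicandBlock, evalBlock, h5, h6, h7]
  -- The radicand is below `4 * P ^ 4`, the square of `2 ^ (2 * p + 1)`, so `2 * p + 1` rounds
  -- suffice and the first increment is half of this, `P * P`.
  have hpow : (2 : ℤ) ^ (2 * k₄ + 1) = 2 * (2 ^ k₄ * 2 ^ k₄) := by ring
  refine (((hA₅ O ω (2 * k₄ + 1) (A₄ * L) k₄ g₄ g₄ hs4 (by omega) ?_).mono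
    (C' := (2 * k₄ + 2) * (A₅ * (A₄ * L) ^ 2)) le_rfl fun _ _ => id).seq
    (C' := A₆ * (A₄ * L) ^ 2) ?_).mono (by omega) fun _ _ => id
  · refine ⟨rfl, u5.ge, ?_, ?_, ?_, fun _ _ _ _ => rfl, hs4.reg⟩
    · rw [u5, u7]
      simpa using hN0
    · rw [u5, u7, Nat.sub_zero, hpow]
      refine hN1.trans_eq (by ring)
    · rw [u6, Nat.sub_zero, hpow]
      omega
  intro g₅ k₅ h5
  obtain rfl := h5.count
  have v' : ∀ j < 3 * b + 9, j ≠ b → j ≠ b + 5 → j ≠ b + 6 → j ≠ b + 7 → g₅ j = g₂ j := by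
    intro j hj h6 h7 h8 h9
    rw [h5.frame j hj h7 h8, u' j hj h9 h7 h8, t' j h6]
  have v0 : g₅ b = ((8 * k₅ : ℕ) : ℤ) := by
    rw [h5.frame b (by omega) (by omega) (by omega), u' b (by omega) (by omega) (by omega)
      (by omega), t0]
  have hs5 : Expr.SizeLE O b (3 * b + 9) (A₄ * L) g₅ := by
    refine ⟨by omega, by omega, h5.size, natAbs_le_of_eq_natCast v0 (by omega), fun q => ?_⟩
    rw [v0, Int.toNat_natCast]
    have := hV (8 * k₅) q
    omega
  refine (hA₆ O ω g₅ _ k₅ hs5).mono le_rfl ?_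
  rintro g₆ k₆ ⟨rfl, h6, -⟩
  refine ⟨rfl, g₅ (b + 5), h5.nonneg, ?_, ?_, fun j => ?_⟩
  · rw [← u7]
    exact h5.le
  · rw [← u7]
    simpa using h5.lt
  · have vc : (fun j : Fin (n + 1) => g₅ j) = c := funext fun j => by
      rw [v' j (by omega) (by omega) (by omega) (by omega) (by omega), h2.frame j (by omega), hg]
    rw [h6 j (by omega), evalBlock_finalBlock D hb, vc, v0, Int.toNat_natCast,
      v' (b + 1) (by omega) (by omega) (by omega) (by omega) (by omega),
      v' (b + 2) (by omega) (by omega) (by omega) (by omega) (by omega), h2.pow, h2.val]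

end Procedure

end RandomIntegerPoint
end

noncomputable section
namespace RandomIntegerPoint

/-! ### The analysis of the procedure -/

section Analysis

/-- The box of offsets is enumerated, and surplus indices are filled with the zero offset: every
index stays valid, and repetitions do not lower the probability of any offset. -/
theorem exists_table (b B K : ℕ) (h : (2 * B + 1) ^ b ≤ 2 ^ K) : ∃ tab : ℕ → Fin b → ℤ,
    (∀ t j, |tab t j| ≤ B) ∧ ∀ o : Fin b → ℤ, (∀ j, |o j| ≤ B) → ∃ t < 2 ^ K, tab t = o := by
  set S : Finset (Fin b → ℤ) := Fintype.piFinset fun _ => Finset.Icc (-B : ℤ) B with hS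
  have hmem : ∀ o, o ∈ S ↔ ∀ j, |o j| ≤ B := fun o => by
    simp [hS, Fintype.mem_piFinset, abs_le]
  have hcard : S.card ≤ 2 ^ K := by
    refine le_trans (le_of_eq ?_) h
    rw [hS, Fintype.card_piFinset_const, Int.card_Icc]
    congr 1
    omega
  refine ⟨fun t => if ht : t < S.card then (S.equivFin.symm ⟨t, ht⟩ : Fin b → ℤ) else 0,
    fun t j => ?_, fun o ho => ?_⟩
  · dsimp only
    split_ifs with ht
    · exact (hmem _).1 (S.equivFin.symm ⟨t, ht⟩).2 j
    · simp
  · have hi := (S.equivFin ⟨o, (hmem o).2 ho⟩).2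
    exact ⟨S.equivFin ⟨o, (hmem o).2 ho⟩, hi.trans_le hcard, by simp⟩

/-- At the first success `f p ≥ 2 ^ K + 1`, which pays for the error `1`; at the preceding index `2
^ i * ε ≤ 2 ^ K + 1 ≤ 2 ^ (K + 1)`, and doubling gives the upper bound. -/
theorem exists_first_gt {f : ℕ → ℤ} {ε : ℝ} (hε : 0 < ε) (hε' : ε < 1 / 2)
    (hf : ∀ i, |(f i : ℝ) - 2 ^ i * ε| ≤ 1) (K : ℕ) : ∃ p, 1 ≤ p ∧ 2 ^ K < f p ∧
    (∀ i, 1 ≤ i → i < p → f i ≤ 2 ^ K) ∧ (2 : ℝ) ^ K ≤ 2 ^ p * ε ∧ 2 ^ p * ε ≤ 2 ^ (K + 2) := by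
  classical
  have hK : (1 : ℝ) ≤ 2 ^ K := one_le_pow₀ one_le_two
  have hex : ∃ p, 1 ≤ p ∧ 2 ^ K < f p := by
    obtain ⟨p, hp⟩ := pow_unbounded_of_one_lt ((2 ^ K + 2) / ε) (one_lt_two (α := ℝ))
    rw [div_lt_iff₀ hε] at hp
    have h1 : (2 : ℝ) ^ (p + 1) * ε = 2 * (2 ^ p * ε) := by ring
    have h2 := (abs_le.1 (hf (p + 1))).1
    refine ⟨p + 1, by omega, ?_⟩
    have : ((2 ^ K : ℤ) : ℝ) < f (p + 1) := by
      push_cast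
      linarith
    exact_mod_cast this
  obtain ⟨h1, h2⟩ := Nat.find_spec hex
  have h3 : ∀ i, 1 ≤ i → i < Nat.find hex → f i ≤ 2 ^ K := fun i hi hip =>
    not_lt.1 fun h => Nat.find_min hex hip ⟨hi, h⟩
  generalize Nat.find hex = p at *
  refine ⟨p, h1, h2, h3, ?_, ?_⟩
  · have h4 : ((2 ^ K + 1 : ℤ) : ℝ) ≤ f p := by exact_mod_cast h2
    have h5 := (abs_le.1 (hf p)).2
    push_cast at h4
    linarith
  · have h6 : (2 : ℝ) ^ (K + 2) = 4 * 2 ^ K := by ring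
    obtain ⟨i, rfl⟩ : ∃ i, p = i + 1 := ⟨p - 1, by omega⟩
    have h7 : (2 : ℝ) ^ (i + 1) * ε = 2 * (2 ^ i * ε) := by ring
    -- The loop tosses before it tests, so nothing is known about `f 0`; for `p = 1` the upper bound
    -- follows from `ε < 1 / 2`.
    rcases Nat.eq_zero_or_pos i with rfl | hi
    · norm_num at h7 ⊢
      linarith
    · have h4 : (f i : ℝ) ≤ ((2 ^ K : ℤ) : ℝ) := by exact_mod_cast h3 i hi (by omega)
      have h5 := (abs_le.1 (hf i)).1
      push_cast at h4
      linarith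

variable {F : Type*} [Field F] {n : ℕ}

theorem exists_bound_value (σ : Fin (n + 1) → F →+* ℝ) {a : 𝓞 F}
    (bF : Module.Basis (Fin (n + 1)) ℤ (𝓞 F))
    (bK : Module.Basis (Fin (2 * (n + 1))) ℤ (CMIntegers a)) : ∃ W : ℕ, ∀ φ ε, 0 < ε → ε < 1 / 2 →
    ∀ q : RealName n, |q.value σ bF bK φ ε| ≤ W := by
  obtain ⟨H, hH0, hH⟩ := exists_bound_basis σ bK
  obtain ⟨H', hH'⟩ := (Set.finite_range fun p : Fin (n + 1) × Fin (n + 1) =>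
    |σ p.1 (bF p.2)|).bddAbove
  obtain ⟨W, hW⟩ := exists_nat_ge (1 + H + |H'|)
  have h0 := abs_nonneg H'
  refine ⟨W, fun φ ε hε hε' q => ?_⟩
  cases q with
  | eps =>
    rw [RealName.value, abs_of_pos hε]
    linarith
  | cosHalf => exact (Real.abs_cos_le_one _).trans (by linarith)
  | sinHalf => exact (Real.abs_sin_le_one _).trans (by linarith)
  | embF k j =>
    have h1 : |σ k (bF j)| ≤ H' := hH' ⟨(k, j), rfl⟩
    exact h1.trans ((le_abs_self H').trans (by linarith))
  | embRe k j => exact (hH k j).1.trans (by linarith)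
  | embIm k j => exact (hH k j).2.trans (by linarith)

theorem bits_le_of_abs_sub_le {x : ℤ} {i W : ℕ} {v : ℝ} (h : |(x : ℝ) - 2 ^ i * v| ≤ 1)
    (hv : |v| ≤ W) : bits x ≤ W + 2 + i := by
  rw [bits_le_iff]
  have h1 : (1 : ℝ) ≤ 2 ^ i := one_le_pow₀ one_le_two
  have h2 : (W : ℝ) + 2 < 2 ^ (W + 2) := by exact_mod_cast Nat.lt_two_pow_self (n := W + 2)
  have h3 : |(x : ℝ)| ≤ 1 + 2 ^ i * |v| := by
    have := abs_add_le ((x : ℝ) - 2 ^ i * v) (2 ^ i * v)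
    rw [sub_add_cancel, abs_mul (2 ^ i : ℝ), abs_of_pos (by positivity : (0 : ℝ) < 2 ^ i)] at this
    linarith
  have h4 : |(x : ℝ)| < 2 ^ (W + 2 + i) := by
    rw [pow_add]
    nlinarith
  exact_mod_cast h4

/-- Finiteness and the upper bound on the number of candidates mention no oracle but are read off
the sampling map, so some valid oracle is needed. -/
theorem Oracle.exists_valid (σ : Fin (n + 1) → F →+* ℝ) {a : 𝓞 F}
    (bF : Module.Basis (Fin (n + 1)) ℤ (𝓞 F))
    (bK : Module.Basis (Fin (2 * (n + 1))) ℤ (CMIntegers a)) (r : 𝓞 F) (φ ε : ℝ) :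
    ∃ O : Oracle n, O.Valid σ bF bK r φ ε := by
  classical
  refine ⟨⟨fun q p => ⌊2 ^ p * q.value σ bF bK φ ε⌋,
    fun w => decide (sigmaPlus (σ 0) a (ofCoords bK w) ∈ halfPlane σ r φ ε)⟩, fun q p => ?_,
    fun w => by simp⟩
  have h1 := Int.floor_le (2 ^ p * q.value σ bF bK φ ε)
  have h2 := Int.lt_floor_add_one (2 ^ p * q.value σ bF bK φ ε)
  rw [abs_le]
  constructor <;> simp only <;> linarith

theorem eq_of_sq_le_of_lt_sq {s t N : ℤ} (hs : 0 ≤ s) (ht : 0 ≤ t) (hs1 : s * s ≤ N)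
    (hs2 : N < (s + 1) * (s + 1)) (ht1 : t * t ≤ N) (ht2 : N < (t + 1) * (t + 1)) : s = t := by
  have h1 := lt_of_mul_self_lt_mul_self₀ (by omega) (hs1.trans_lt ht2)
  have h2 := lt_of_mul_self_lt_mul_self₀ (by omega) (ht1.trans_lt hs2)
  omega

/-- For a given oracle the output is a fixed function `res` of the random integer, which maps `[0,
2^p)` onto the candidates. -/
theorem exists_sampling_program [NumberField F] [NumberField.IsTotallyReal F]
    (σ : Fin (n + 1) ≃ (F →+* ℝ)) {a : 𝓞 F} (ha : ∀ k, σ k a < 0)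
    (bF : Module.Basis (Fin (n + 1)) ℤ (𝓞 F))
    (bK : Module.Basis (Fin (2 * (n + 1))) ℤ (CMIntegers a)) : ∃ L : ℕ, 0 < L ∧
    (∀ φ ε r Rmax, Admissible σ r ε L Rmax → (Cand σ a r φ ε).Finite →
      4 / ε ≤ (Cand σ a r φ ε).ncard) ∧
    ∀ Rmax : Fin (n + 1) → ℝ, (∀ k, 0 < Rmax k) → ∃ (K A : ℕ) (proc : Prog n),
    ∀ φ ε r (O : Oracle n), Admissible σ r ε L Rmax → O.Valid σ bF bK r φ ε →
      ∃ p : ℕ, 2 ^ p * ε ≤ 2 ^ (K + 2) ∧ ∃ res : ℤ → CMIntegers a,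
        (∀ u, 0 ≤ u → u < 2 ^ p → res u ∈ Cand σ a r φ ε) ∧
        (∀ z ∈ Cand σ a r φ ε, ∃ u, 0 ≤ u ∧ u < 2 ^ p ∧ res u = z) ∧
        ∀ ω, Ends O ω proc (start bF proc r).reg 0 (A * (p + 1) ^ 3) fun g' k' => k' = p ∧
          ofCoords bK (fun j => g' j) = res (binValue ω p) := by
  obtain ⟨N, G, L, hL, hcard, h⟩ := exists_sampling_constants σ ha bF bK
  refine ⟨L, hL, hcard, fun Rmax hRmax => ?_⟩
  obtain ⟨κ, B, Ω, -, h⟩ := h Rmax hRmax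
  -- `2 ^ K` then exceeds both the number of offsets and `Ω`; the latter turns `P = 2 ^ K * q` into
  -- `Ω * q ≤ P`.
  obtain ⟨K, hK⟩ : ∃ K, K = Ω + (2 * B + 1) ^ (2 * (n + 1)) := ⟨_, rfl⟩
  have hKlt : K < 2 ^ K := Nat.lt_two_pow_self
  obtain ⟨tab, htab, htab'⟩ := exists_table (2 * (n + 1)) B K (by omega)
  obtain ⟨W, hW⟩ := exists_bound_value σ bF bK
  obtain ⟨A, hA⟩ := exists_ends_program ⟨N, G, L, κ, K, tab⟩ (le_refl (2 * (n + 1))) (W + 2)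
  set D : Constants n := ⟨N, G, L, κ, K, tab⟩ with hD
  refine ⟨K, A, program D (2 * (n + 1)), fun φ ε r O hadm hO => ?_⟩
  obtain ⟨p, hp1, hp2, hp3, hp4, hp5⟩ := exists_first_gt (f := O.approx .eps) hadm.pos hadm.lt
    (fun i => hO.1 .eps i) K
  have hε1 : ε < 1 := hadm.lt.trans (by norm_num)
  -- The bits of `u` split into `K` bits for the offset and `d = p - K` bits for the target, and `2
  -- ^ K ≤ 2 ^ p * ε` says `1 / ε ≤ 2 ^ d = q`.
  have hKp : K < p := by
    have h1 : (2 : ℝ) ^ p * ε < 2 ^ p := mul_lt_of_lt_one_right (by positivity) hε1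
    exact (pow_lt_pow_iff_right₀ one_lt_two).1 (hp4.trans_lt h1)
  obtain ⟨d, rfl⟩ := Nat.exists_eq_add_of_lt hKp
  rw [show K + d + 1 = K + (d + 1) by omega] at *
  generalize d + 1 = d at *
  have hPq : (2 : ℤ) ^ (K + d) / 2 ^ K = 2 ^ d := by
    rw [pow_add, Int.mul_ediv_cancel_left _ (by positivity)]
  have h2K : (0 : ℤ) < 2 ^ K := by positivity
  set e : RealName n → ℤ := fun q => O.approx q (8 * (K + d)) with he
  have hIs : IsApprox σ bF bK φ ε e (2 ^ (K + d)) := by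
    intro q
    have := hO.1 q (8 * (K + d))
    push_cast
    rwa [← pow_mul, mul_comm (K + d) 8]
  obtain ⟨⟨hN0, hN1, hc⟩, h⟩ := h φ ε r e (2 ^ (K + d)) (2 ^ d) hadm hIs (by
      rw [pow_add]
      gcongr
      have : Ω ≤ 2 ^ K := by omega
      exact_mod_cast this) (one_le_pow₀ one_le_two) (by
      rw [div_le_iff₀ hadm.pos]
      push_cast
      rw [pow_add, mul_assoc] at hp4
      exact le_of_mul_le_mul_left (by linarith) (by positivity : (0 : ℝ) < 2 ^ K))
  have hends := fun ω => hA O ω (K + d) (bF.repr r) (start bF (program D (2 * (n + 1))) r).reg hp1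
    hp3 hp2 (fun i q => bits_le_of_abs_sub_le (hO.1 q i) (hW φ ε hadm.pos hadm.lt q)) hN0 hN1 hc
    (fun j => dif_pos j.2) (fun j hj => dif_neg (by omega))
  -- One arbitrary run supplies the integer square root; by uniqueness every other run computes the
  -- same `s`.
  obtain ⟨-, -, -, -, -, -, s, hs0, hs1, hs2, -⟩ := hends fun _ => false
  obtain ⟨hdef, hbase, hsurj⟩ := h s hs0 hs1 hs2
  have hpt : ∀ m t, 0 ≤ m → t < 2 ^ K → D.point e (2 ^ (K + d)) s (2 ^ K * m + (t : ℕ)) =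
      fun j => coord N G e (2 ^ (K + d)) (s - 2 * L) (κ * (2 * m - 2 ^ d)) j + tab t j := by
    intro m t hm ht
    have ht' : (t : ℤ) < 2 ^ K := by exact_mod_cast ht
    have h1 : (2 ^ K * m + (t : ℤ)) / 2 ^ K = m := by
      rw [Int.mul_add_ediv_left _ _ h2K.ne', Int.ediv_eq_zero_of_lt (by omega) ht', add_zero]
    have h2 : (2 ^ K * m + (t : ℤ)) % 2 ^ K = t := by
      rw [Int.mul_add_emod_self_left, Int.emod_eq_of_lt (by omega) ht']
    funext j
    simp only [Constants.point, hD, h1, h2, hPq, Int.toNat_natCast]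
  have hiff : ∀ m t, 0 ≤ m → m < 2 ^ d → t < 2 ^ K →
      (((∀ k, 0 < slack e (2 ^ (K + d)) (bF.repr r)
        (D.point e (2 ^ (K + d)) s (2 ^ K * m + (t : ℕ))) k + (2 ^ (K + d)) ^ 12 + 1) ∧
        O.test (D.point e (2 ^ (K + d)) s (2 ^ K * m + (t : ℕ))) = true) ↔
      ofCoords bK (D.point e (2 ^ (K + d)) s (2 ^ K * m + (t : ℕ))) ∈ Cand σ a r φ ε) := by
    intro m t hm hmd ht
    rw [hO.2, hpt m t hm ht]
    exact hbase m (tab t) hm hmd (htab t)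
  refine ⟨K + d, hp5, fun u => ofCoords bK (D.result O e (2 ^ (K + d)) s u (bF.repr r)),
    fun u hu0 hu1 => ?_, fun z hz => ?_, fun ω => (hends ω).mono le_rfl ?_⟩
  · have hu : u = 2 ^ K * (u / 2 ^ K) + ((u % 2 ^ K).toNat : ℕ) := by
      rw [Int.toNat_of_nonneg (Int.emod_nonneg _ h2K.ne'), Int.mul_ediv_add_emod]
    have ht : (u % 2 ^ K).toNat < 2 ^ K := by
      have := Int.emod_lt_of_pos u h2K
      rw [Int.toNat_lt (Int.emod_nonneg _ h2K.ne')]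
      exact_mod_cast this
    have key := hiff (u / 2 ^ K) _ (Int.ediv_nonneg hu0 h2K.le) (by
      rw [Int.ediv_lt_iff_lt_mul h2K, mul_comm, ← pow_add]
      exact hu1) ht
    rw [← hu] at key
    simp only [Constants.result]
    split_ifs with hcond
    · exact key.1 hcond
    · exact hdef
  · obtain ⟨m, o, hm0, hm1, ho, rfl⟩ := hsurj z hz
    obtain ⟨t, ht, rfl⟩ := htab' o ho
    rw [← hpt m t hm0 ht] at hz ⊢
    have ht' : (t : ℤ) < 2 ^ K := by exact_mod_cast ht
    -- The random integer with target number `m` and table index `t`.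
    refine ⟨2 ^ K * m + t, by positivity, ?_, ?_⟩
    · rw [pow_add]
      nlinarith
    · simp only [Constants.result]
      rw [if_pos ((hiff m t hm0 hm1 ht).2 hz)]
  · rintro g' k' ⟨hk, s', hs'0, hs'1, hs'2, hg'⟩
    obtain rfl := eq_of_sq_le_of_lt_sq hs0 hs'0 hs1 hs2 hs'1 hs'2
    exact ⟨hk, congrArg _ (funext hg')⟩

end Analysis

end RandomIntegerPoint
end

/-! ### The main theorem. -/

theorem mainTheorem2 {F : Type*} [Field F] [NumberField F] [NumberField.IsTotallyReal F]
    {n : ℕ} (σ : Fin (n + 1) ≃ (F →+* ℝ)) (a : 𝓞 F) (ha : ∀ k, σ k a < 0)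
    (bF : Module.Basis (Fin (n + 1)) ℤ (𝓞 F))
    (bK : Module.Basis (Fin (2 * (n + 1))) ℤ (RandomIntegerPoint.CMIntegers a)) :
    ∃ Rmin : Fin (n + 1) → ℝ, (∀ k, 0 < Rmin k) ∧
    ∀ Rmax : Fin (n + 1) → ℝ, (∀ k, 0 < Rmax k) →
    ∃ p₀ M : ℝ, 0 < p₀ ∧ 0 < M ∧
    ∃ (proc : RandomIntegerPoint.Prog n) (poly : Polynomial ℝ),
    ∀ (φ ε : ℝ) (r : 𝓞 F), 0 < ε → ε < 1 / 2 → (∀ k, 0 < σ k r) →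
      Real.sqrt (σ 0 r) * ε ^ 2 / 4 ∈ Set.Icc (Rmin 0) (Rmax 0) →
      (∀ k, k ≠ 0 → Real.sqrt (σ k r) ∈ Set.Icc (Rmin k) (Rmax k)) →
      -- some integer of `K` has its image in the region
      (∃ z : RandomIntegerPoint.CMIntegers a,
        RandomIntegerPoint.vecSigma σ a z ∈ RandomIntegerPoint.region σ r φ ε) ∧
      -- the number of candidates
      (RandomIntegerPoint.Cand σ a r φ ε).Finite ∧
      ((RandomIntegerPoint.Cand σ a r φ ε).ncard : ℝ) ∈
        Set.Icc (2 * Real.sqrt (4 - ε ^ 2) / ε)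
          ((4 * Real.sqrt (4 - 4 * ε ^ 2) / ε + 2) * M) ∧
      -- the procedure
      ∀ O : RandomIntegerPoint.Oracle n, O.Valid σ bF bK r φ ε →
        ∃ T : ℕ, (T : ℝ) ≤ poly.eval (Real.log (1 / ε)) ∧
          -- it always halts within time `T` with a candidate as its output
          (∀ c ∈ (RandomIntegerPoint.runFor O T (RandomIntegerPoint.start bF proc r)).support,
            c.todo = [] ∧ c.time ≤ T ∧
            RandomIntegerPoint.output bK c ∈ RandomIntegerPoint.Cand σ a r φ ε) ∧
          -- and it returns each candidate with the required probability
          ∀ z ∈ RandomIntegerPoint.Cand σ a r φ ε,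
            ENNReal.ofReal (p₀ / (RandomIntegerPoint.Cand σ a r φ ε).ncard) ≤
              ((RandomIntegerPoint.runFor O T (RandomIntegerPoint.start bF proc r)).map
                (RandomIntegerPoint.output bK)) z := by
  classical
  obtain ⟨L, hL, hcard, h⟩ := RandomIntegerPoint.exists_sampling_program σ ha bF bK
  refine ⟨fun _ => L, fun _ => Nat.cast_pos.2 hL, fun Rmax hRmax => ?_⟩
  obtain ⟨K, A, proc, h⟩ := h Rmax hRmax
  -- From `2 ^ p * ε ≤ 2 ^ (K + 2)` come both `M` and, since `log 2 > 1 / 2`, the estimate `p + 1 ≤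
  -- 2 * log (1 / ε) + K + 3` behind the polynomial; `p₀` is the ratio of `4 / ε` to `2 ^ (K + 2) /
  -- ε`.
  refine ⟨(2 ^ K)⁻¹, 2 ^ (K + 2), by positivity, by positivity, proc,
    .C (A : ℝ) * (.C 2 * .X + .C ((K : ℝ) + 3)) ^ 3, ?_⟩
  intro φ ε r hε hε' hr hr0 hrk
  have hadm : RandomIntegerPoint.Admissible σ r ε L Rmax :=
    ⟨hε, hε', hr, by linarith [hr0.1], by linarith [hr0.2], fun k hk => (hrk k hk).1,
      fun k hk => (hrk k hk).2⟩
  obtain ⟨O₀, hO₀⟩ := RandomIntegerPoint.Oracle.exists_valid σ bF bK r φ ε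
  obtain ⟨p₁, hp₁, res₁, -, hres₁, -⟩ := h φ ε r O₀ hadm hO₀
  have hsub : RandomIntegerPoint.Cand σ a r φ ε ⊆
      ↑((Finset.Ico (0 : ℤ) (2 ^ p₁)).image res₁) := by
    intro z hz
    obtain ⟨u, h0, h1, rfl⟩ := hres₁ z hz
    exact Finset.mem_coe.2 (Finset.mem_image_of_mem _ (Finset.mem_Ico.2 ⟨h0, h1⟩))
  have hfin := (Finset.finite_toSet _).subset hsub
  have hlower := hcard φ ε r Rmax hadm hfin
  have hpos : (0 : ℝ) < (RandomIntegerPoint.Cand σ a r φ ε).ncard :=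
    (by positivity : 0 < 4 / ε).trans_le hlower
  have hupper : ((RandomIntegerPoint.Cand σ a r φ ε).ncard : ℝ) ≤ 2 ^ p₁ := by
    have h1 := Set.ncard_le_ncard hsub (Finset.finite_toSet _)
    rw [Set.ncard_coe_finset] at h1
    have h2 := h1.trans Finset.card_image_le
    rw [Int.card_Ico, sub_zero, show ((2 : ℤ) ^ p₁).toNat = 2 ^ p₁ by
      rw [← Nat.cast_ofNat, ← Nat.cast_pow, Int.toNat_natCast]] at h2
    exact_mod_cast h2
  refine ⟨?_, hfin, ⟨?_, ?_⟩, fun O hO => ?_⟩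
  · obtain ⟨z, hz⟩ := Set.nonempty_of_ncard_ne_zero (by exact_mod_cast hpos.ne')
    exact ⟨z, hz⟩
  · refine le_trans ?_ hlower
    gcongr
    have : Real.sqrt (4 - ε ^ 2) ≤ 2 := Real.sqrt_le_iff.2 ⟨by norm_num, by nlinarith⟩
    linarith
  -- The image of `[0, 2 ^ p₁)` contains all candidates, so their number is at most `2 ^ (K + 2) /
  -- ε`, and the square root does not fall below `1` for `ε < 1 / 2`.
  · have h1 : 1 ≤ Real.sqrt (4 - 4 * ε ^ 2) := Real.one_le_sqrt.2 (by nlinarith)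
    have h2 : (2 : ℝ) ^ p₁ ≤ 1 / ε * 2 ^ (K + 2) := by
      rw [div_mul_eq_mul_div, le_div_iff₀ hε, one_mul]
      exact hp₁
    refine hupper.trans (h2.trans ?_)
    gcongr
    have h3 : 1 / ε ≤ 4 * Real.sqrt (4 - 4 * ε ^ 2) / ε := by
      gcongr
      linarith
    linarith
  · obtain ⟨p, hp, res, hres, hres', hends⟩ := h φ ε r O hadm hO
    refine ⟨A * (p + 1) ^ 3, ?_, fun c hc => ?_, fun z hz => ?_⟩
    · have h1 : (p : ℝ) + 1 ≤ 2 * Real.log (1 / ε) + (K + 3) := by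
        have h2 : (2 : ℝ) ^ p ≤ 2 ^ (K + 2) * (1 / ε) := by
          rw [mul_one_div, le_div_iff₀ hε]
          exact hp
        have h3 := Real.log_le_log (by positivity) h2
        rw [Real.log_mul (by positivity) (by positivity), Real.log_pow, Real.log_pow] at h3
        have h4 := Real.log_two_gt_d9
        have h5 : 0 ≤ Real.log (1 / ε) :=
          Real.log_nonneg (by rw [le_div_iff₀ hε]; linarith)
        push_cast at h3
        by_contra h6
        push Not at h6
        nlinarith
      push_cast
      simp only [Polynomial.eval_mul, Polynomial.eval_pow, Polynomial.eval_add,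
        Polynomial.eval_C, Polynomial.eval_X]
      gcongr
    · obtain ⟨ω, -, hω⟩ := RandomIntegerPoint.exists_coins_of_mem_support O _ _ c hc 0
        fun _ => false
      obtain ⟨g', k', t, he, ht, -, hg'⟩ := (hends ω).iterate_coinStep
      have hc' : c = ⟨[], g', t⟩ := hω.symm.trans (congrArg Prod.fst he)
      obtain ⟨h0, h1⟩ := RandomIntegerPoint.binValue_nonneg_and_lt ω p
      rw [hc']
      exact ⟨rfl, ht, Set.mem_of_eq_of_mem hg' (hres _ h0 h1)⟩
    · obtain ⟨u, h0, h1, rfl⟩ := hres' z hz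
      obtain ⟨ω, rfl⟩ := RandomIntegerPoint.exists_binValue_eq p u h0 h1
      obtain ⟨g', k', t, he, ht, hk, hg'⟩ := (hends ω).iterate_coinStep
      have hprob := RandomIntegerPoint.half_pow_le_runFor O ω (A * (p + 1) ^ 3)
        (RandomIntegerPoint.start bF proc r) 0
      have he' : (RandomIntegerPoint.coinStep O ω)^[A * (p + 1) ^ 3]
          (RandomIntegerPoint.start bF proc r, 0) = (⟨[], g', t⟩, k') := he
      rw [he', pow_zero, one_mul, hk] at hprob
      -- Multiplied out, this is `2 ^ p * ε ≤ 4 * 2 ^ K ≤ |Cand| * ε * 2 ^ K`, by the choice of `p`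
      -- and the lower bound `4 / ε`.
      have hle : (2 ^ K : ℝ)⁻¹ / (RandomIntegerPoint.Cand σ a r φ ε).ncard ≤ 2⁻¹ ^ p := by
        rw [inv_pow, div_le_iff₀ hpos, ← one_div, ← one_div, div_mul_eq_mul_div, one_mul,
          div_le_div_iff₀ (by positivity) (by positivity), one_mul]
        rw [div_le_iff₀ hε] at hlower
        have h2 : (2 : ℝ) ^ (K + 2) = 4 * 2 ^ K := by ring
        have h3 : (2 : ℝ) ^ p * ε ≤
            (RandomIntegerPoint.Cand σ a r φ ε).ncard * 2 ^ K * ε := by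
          have := mul_le_mul_of_nonneg_right hlower (by positivity : (0 : ℝ) ≤ 2 ^ K)
          linarith
        exact le_of_mul_le_mul_right h3 hε
      refine (ENNReal.ofReal_le_ofReal hle).trans ?_
      rw [ENNReal.ofReal_pow (by positivity), ENNReal.ofReal_inv_of_pos two_pos,
        ENNReal.ofReal_ofNat]
      refine hprob.trans ?_
      rw [PMF.map_apply]
      -- The single final configuration reached with `ω` already carries the required mass.
      refine le_trans (le_of_eq ?_) (ENNReal.le_tsum ⟨[], g', t⟩)
      rw [if_pos]
      exact hg'.symm
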